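/- **Notation.** Let $Z$ be the set of finitely supported integer vectors $l=(l_1,l_2,\dots)$ and $Z_\star=Z\setminus\{0\}$; put $\|l\|=\sum_{i\ge1}|l_i|\,i$ and, for $\omega\in\mathbb R^{\mathbb N^+}$, $(\omega,l)=\sum_i l_i\omega_i$. For $r>0$, $AP_r(\omega)$ is the set of functions $f:\{|\operatorname{Im}z|<r\}\to\mathbb C$ of the form $f(z)=\sum_{l\in Z}f_l\,e^{i(\omega,l)z}$ with $f_l\in\mathbb C$ and $\|f\|_r:=\sum_l|f_l|e^{r\|l\|}<\infty$. For $r,s>0$ and a real $\alpha$, $AP_{r,s}(\omega)$ is the set of functions $f:\{|\operatorname{Im}x|<r\}\times\{|y-\alpha|<s\}\to\mathbb C$ of the form $f(x,y)=\sum_{l\in Z}f_l(y)\,e^{i(\omega,l)x}$ with $f_l$ analytic on $\{y\in\mathbb C:|y-\alpha|<s\}$ and $\|f\|_{r,s}:=\sum_l\big(\sup_{|y-\alpha|<s}|f_l(y)|\big)e^{r\|l\|}<\infty$. **Theorem.** Let $r_0,s_0,\gamma,\mu,\varepsilon>0$. There is $\delta=\delta(\varepsilon,r_0,s_0,\gamma,\mu)>0$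 such that the following holds. Let $\omega=(\omega_1,\omega_2,\dots)$ be a real vector with $|\omega_i|\le1$ for all $i$ which, for some $\gamma_0>0$, satisfies $$|(\omega,l)|>\frac{\gamma_0}{\prod_{i\ge1}\big(1+i^{1+\mu}|l_i|^{1+\mu}\big)}\qquad\text{for all } l\in Z_\star,$$ and let $\alpha\in\mathbb R$ satisfy $$\Big|(\omega,l)\frac{\alpha}{2\pi}-n\Big|>\gamma\prod_{i\ge1}\frac1{1+i^{2+2\mu}|l_i|^{2+2\mu}}\qquad\text{for all } l\in Z_\star,\ n\in\mathbb Z.$$ Let $f,g\in AP_{r_0,s_0}(\omega)$ be real-valued at real points, and consider the map $$\mathfrak M:\quad x_1=x+y+f(x,y),\quad y_1=y+g(x,y),\qquad x\in\mathbb R,\ y\in(\alpha-s_0,\alpha+s_0).$$ Assume that $\mathfrak M$ has the intersection property: $\mathfrak M(\Gamma)\cap\Gamma\neq\emptyset$ for every curve $\Gamma=\{(x,\phi(x)):x\in\mathbb R\}$ contained in $\mathbb R\times(\alpha-s_0,\alpha+s_0)$, where $\phi\in\bigcup_{\rho>0}AP_\rho(\omega)$ is real-valued on $\mathbb R$. If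 $$\|f\|_{r_0,s_0}+\|g\|_{r_0,s_0}<\delta,$$ then there are $u,v\in AP_{r_0/2}(\omega)$, real-valued on $\mathbb R$, with $$\|u\|_{r_0/2}+\|v-\alpha\|_{r_0/2}<\varepsilon,$$ such that the curve $\Gamma=\{(\xi+u(\xi),v(\xi)):\xi\in\mathbb R\}$ lies in $\mathbb R\times(\alpha-s_0,\alpha+s_0)$, is invariant, $\mathfrak M(\Gamma)=\Gamma$, and $\mathfrak M$ acts on it as the rotation $\xi\mapsto\xi+\alpha$, that is, $$\mathfrak M\big(\xi+u(\xi),v(\xi)\big)=\big(\xi+\alpha+u(\xi+\alpha),\,v(\xi+\alpha)\big)\qquad\text{for all }\xi\in\mathbb R.$$ -/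

import Mathlib

open scoped ENNReal

noncomputable section

/-- The pairing `(ω, l) = ∑ i, l i * ω i` of a frequency vector with a finitely supported
integer vector. -/
def freqPairing (ω : ℕ+ → ℝ) (l : ℕ+ →₀ ℤ) : ℝ :=
  l.sum fun i k => (k : ℝ) * ω i

/-- The weight `‖l‖ = ∑ i, |l i| * i`. -/
def indexWeight (l : ℕ+ →₀ ℤ) : ℝ :=
  l.sum fun i k => |(k : ℝ)| * ((i : ℕ) : ℝ)

/-- The product `∏ i, (1 + i ^ p * |l i| ^ p)`; for `0 < p` the factors with `l i = 0` are `1`,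
so that the product over the support is the product over all `i`. -/
def divisorProd (p : ℝ) (l : ℕ+ →₀ ℤ) : ℝ :=
  l.prod fun i k => 1 + ((i : ℕ) : ℝ) ^ p * |(k : ℝ)| ^ p

/-- The Diophantine condition on an infinite dimensional frequency vector. -/
structure IsDiophantine (ω : ℕ+ → ℝ) (γ₀ μ : ℝ) : Prop where
  abs_le_one : ∀ i, |ω i| ≤ 1
  lower_bound : ∀ l : ℕ+ →₀ ℤ, l ≠ 0 → γ₀ / divisorProd (1 + μ) l < |freqPairing ω l|

/-- The nonresonance condition on the rotation number `α` relative to `ω`. -/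
def IsNonresonant (ω : ℕ+ → ℝ) (γ μ α : ℝ) : Prop :=
  ∀ l : ℕ+ →₀ ℤ, l ≠ 0 → ∀ n : ℤ,
    γ * (1 / divisorProd (2 + 2 * μ) l) < |freqPairing ω l * (α / (2 * Real.pi)) - n|

/-- `f z = ∑ l, c l * e ^ (i (ω, l) z)` on the strip `|Im z| < r`. -/
def HasFourierSeries (ω : ℕ+ → ℝ) (r : ℝ) (c : (ℕ+ →₀ ℤ) → ℂ) (f : ℂ → ℂ) : Prop :=
  ∀ z : ℂ, |z.im| < r →
    HasSum (fun l => c l * Complex.exp (Complex.I * (freqPairing ω l : ℂ) * z)) (f z)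

/-- The weighted sum `∑ l, |c l| * e ^ (r ‖l‖)`, possibly infinite. -/
def coeffNorm (r : ℝ) (c : (ℕ+ →₀ ℤ) → ℂ) : ℝ≥0∞ :=
  ∑' l, ‖c l‖ₑ * ENNReal.ofReal (Real.exp (r * indexWeight l))

/-- The space `AP_r(ω)`; a function is only looked at on the strip `|Im z| < r`. -/
def AP (ω : ℕ+ → ℝ) (r : ℝ) : Set (ℂ → ℂ) :=
  {f | ∃ c, HasFourierSeries ω r c f ∧ coeffNorm r c < ⊤}

/-- The norm `‖f‖_r`. When the numbers `(ω, l)` are pairwise distinct (in particular for a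
Diophantine `ω`) and `0 < r`, the coefficients of `f` are unique, so that the infimum runs over a
single family; it is `⊤` if `f` has no such expansion. -/
def apNorm (ω : ℕ+ → ℝ) (r : ℝ) (f : ℂ → ℂ) : ℝ≥0∞ :=
  ⨅ (c : (ℕ+ →₀ ℤ) → ℂ) (_ : HasFourierSeries ω r c f), coeffNorm r c

/-- `f x y = ∑ l, c l y * e ^ (i (ω, l) x)` for `|Im x| < r`, `|y - y₀| < s`, with coefficients
`c l` analytic on the disc `|y - y₀| < s`. -/
structure HasFourierSeries₂ (ω : ℕ+ → ℝ) (y₀ r s : ℝ) (c : (ℕ+ →₀ ℤ) → ℂ → ℂ)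
    (f : ℂ → ℂ → ℂ) : Prop where
  analytic : ∀ l, AnalyticOnNhd ℂ (c l) (Metric.ball (y₀ : ℂ) s)
  hasSum : ∀ x : ℂ, |x.im| < r → ∀ y ∈ Metric.ball (y₀ : ℂ) s,
    HasSum (fun l => c l y * Complex.exp (Complex.I * (freqPairing ω l : ℂ) * x)) (f x y)

/-- The weighted sum `∑ l, |c l|_s * e ^ (r ‖l‖)`, where `|c l|_s` is the sup-norm on the disc
`|y - y₀| < s`; possibly infinite. -/
def coeffNorm₂ (y₀ r s : ℝ) (c : (ℕ+ →₀ ℤ) → ℂ → ℂ) : ℝ≥0∞ :=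
  ∑' l, (⨆ y ∈ Metric.ball (y₀ : ℂ) s, ‖c l y‖ₑ) * ENNReal.ofReal (Real.exp (r * indexWeight l))

/-- The space `AP_{r,s}(ω)` of functions on `|Im x| < r`, `|y - y₀| < s`. -/
def AP₂ (ω : ℕ+ → ℝ) (y₀ r s : ℝ) : Set (ℂ → ℂ → ℂ) :=
  {f | ∃ c, HasFourierSeries₂ ω y₀ r s c f ∧ coeffNorm₂ y₀ r s c < ⊤}

/-- The norm `‖f‖_{r,s}`; as in the one-variable case the coefficients are unique on the disc. -/
def apNorm₂ (ω : ℕ+ → ℝ) (y₀ r s : ℝ) (f : ℂ → ℂ → ℂ) : ℝ≥0∞ :=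
  ⨅ (c : (ℕ+ →₀ ℤ) → ℂ → ℂ) (_ : HasFourierSeries₂ ω y₀ r s c f), coeffNorm₂ y₀ r s c

/-- Real-valued on the real axis. -/
def RealOnReals (φ : ℂ → ℂ) : Prop := ∀ x : ℝ, (φ x).im = 0

/-- Real-valued at the real points of `ℂ × {|y - y₀| < s}`. -/
def RealOnStrip (y₀ s : ℝ) (f : ℂ → ℂ → ℂ) : Prop :=
  ∀ x y : ℝ, |y - y₀| < s → (f x y).im = 0

/-- The twist map `(x, y) ↦ (x + y + f(x, y), y + g(x, y))`. If `f` and `g` are real at real points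
it sends real points to real points. -/
def twistMap (f g : ℂ → ℂ → ℂ) (p : ℂ × ℂ) : ℂ × ℂ :=
  (p.1 + p.2 + f p.1 p.2, p.2 + g p.1 p.2)

/-- The set of (real) points `(X ξ, Y ξ)`, `ξ` real. -/
def curveSet (X Y : ℂ → ℂ) : Set (ℂ × ℂ) :=
  Set.range fun ξ : ℝ => (X ξ, Y ξ)

/-- The intersection property of the twist map on the real strip `|y - y₀| < s`: every real
analytic almost periodic curve `y = φ x` lying in the strip meets its image, where `φ` belongs
to `AP_ρ(ω)` for some `ρ > 0`. -/
def HasIntersectionProperty (ω : ℕ+ → ℝ) (y₀ s : ℝ) (f g : ℂ → ℂ → ℂ) : Prop :=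
  ∀ φ : ℂ → ℂ, (∃ ρ : ℝ, 0 < ρ ∧ φ ∈ AP ω ρ) → RealOnReals φ →
    (∀ x : ℝ, φ x ∈ Metric.ball (y₀ : ℂ) s) →
    ((twistMap f g '' curveSet id φ) ∩ curveSet id φ).Nonempty

end

/-!
Expanding in Fourier modes, and `f`, `g` also in powers of `y - α`, everything reduces to estimates
in the Banach algebras of families `(x l)` with norm `∑ l, ‖x l‖ * exp (r * ‖l‖)`, where `l` runs
over any seminormed abelian group. A curve `(ξ + u ξ, α + w ξ)` is sought on which both components
`E₁`, `E₂` of the conjugacy error vanish, by Newton's method with a loss of strip width at each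
step.

The equations linearized at an approximate solution become triangular in the frame formed by the
velocity `(U, W)` of the curve and the direction of `y`: as the determinant of the map is not
assumed to be `1`, one carries along a factor `q` and a multiplier `κ` which approximately reduce
the normal dynamics to the constant `κ`. What remains are two equations with divisors
`κ - e ^ (i (ω, l) α)` and `1 - e ^ (i (ω, l) α)`. The mean of the tangential equation is adjusted
by the twist, whereas the mean of the normal one cannot be removed, so that `E₂` becomes a multiple
`k` of a nearly constant function plus a quadratic remainder. Here the intersection property enters:
the curve is a graph, hence meets its image, and where it does `|E₂| ≤ |E₁|` because the curve is
nearly flat. As `E₁` is already quadratically small, so are `k` and all of `E₂`.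

The nonresonance condition gives divisors of size at least `exp (-(K / ρ ^ 5))` at the price of a
strip loss `ρ`, and errors of order `exp (-(40 * (K / ρ ^ 5)))` for a geometric sequence of `ρ` are
compatible with this.
-/

open scoped NNReal ComplexConjugate
open Complex (I)

noncomputable section

/-! ### Weighted Wiener algebras -/

section ExpWeight

variable {G : Type*} [SeminormedAddCommGroup G]

/-- The exponential weight `e ^ (r ‖l‖)` of the index `l`. -/
def expWeight (r : ℝ≥0) (l : G) : ℝ := Real.exp (r * ‖l‖)

lemma expWeight_pos (r : ℝ≥0) (l : G) : 0 < expWeight r l := Real.exp_pos _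

lemma one_le_expWeight (r : ℝ≥0) (l : G) : 1 ≤ expWeight r l :=
  Real.one_le_exp (mul_nonneg r.2 (norm_nonneg l))

@[simp] lemma abs_expWeight (r : ℝ≥0) (l : G) : |expWeight r l| = expWeight r l :=
  abs_of_pos (expWeight_pos r l)

@[simp] lemma expWeight_zero (r : ℝ≥0) : expWeight r (0 : G) = 1 := by simp [expWeight]

@[simp] lemma expWeight_neg (r : ℝ≥0) (l : G) : expWeight r (-l) = expWeight r l := by
  simp [expWeight]

lemma expWeight_add_le (r : ℝ≥0) (l m : G) :
    expWeight r (l + m) ≤ expWeight r l * expWeight r m := by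
  simp only [expWeight, ← Real.exp_add, ← mul_add]
  gcongr
  exact norm_add_le l m

lemma expWeight_mono {r r' : ℝ≥0} (h : r' ≤ r) (l : G) : expWeight r' l ≤ expWeight r l := by
  unfold expWeight
  gcongr

end ExpWeight

/-- The coefficient families `c` with `∑ l, ‖c l‖ * e ^ (r ‖l‖) < ∞`. -/
def weightedSummable (G : Type*) [SeminormedAddCommGroup G] (r : ℝ≥0) : Submodule ℂ (G → ℂ) where
  carrier := {c | Summable fun l => ‖c l‖ * expWeight r l}
  zero_mem' := by simp [summable_zero]
  add_mem' {a b} ha hb := by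
    refine (ha.add hb).of_nonneg_of_le
      (fun l => mul_nonneg (norm_nonneg _) (expWeight_pos r l).le) fun l => ?_
    rw [← add_mul]
    exact mul_le_mul_of_nonneg_right (norm_add_le _ _) (expWeight_pos r l).le
  smul_mem' c a ha := (ha.mul_left ‖c‖).congr fun l => by simp [mul_assoc]

/-- The weighted Wiener algebra of an abelian group `G`: the families with
`∑ l, ‖x l‖ * e ^ (r ‖l‖) < ∞` under convolution. For `G = ℤ^(ℕ+)`, the family `x` stands for the
almost periodic function `∑ l, x l * e ^ (i (ω, l) z)` on the strip of width `r`, and convolution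
for the product of functions. -/
def WienerAlgebra (G : Type*) [SeminormedAddCommGroup G] (r : ℝ≥0) : Type _ :=
  weightedSummable G r

namespace WienerAlgebra

variable {G : Type*} [SeminormedAddCommGroup G] {r r' r'' : ℝ≥0}

instance : AddCommGroup (WienerAlgebra G r) :=
  inferInstanceAs (AddCommGroup (weightedSummable G r))
instance : Module ℂ (WienerAlgebra G r) := inferInstanceAs (Module ℂ (weightedSummable G r))
instance : FunLike (WienerAlgebra G r) G ℂ := ⟨fun x => x.1, fun _ _ h => Subtype.ext h⟩

/-- The element of the Wiener algebra with the coefficients `c`. -/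
def mk (c : G → ℂ) (hc : Summable fun l => ‖c l‖ * expWeight r l) : WienerAlgebra G r := ⟨c, hc⟩

section Coefficients

variable (x y : WienerAlgebra G r) (l : G)

@[simp] lemma mk_apply (c : G → ℂ) (hc : Summable fun l => ‖c l‖ * expWeight r l) :
    mk c hc l = c l := rfl
@[simp] lemma add_apply : (x + y) l = x l + y l := rfl
@[simp] lemma sub_apply : (x - y) l = x l - y l := rfl
@[simp] lemma neg_apply : (-x) l = -x l := rfl
@[simp] lemma zero_apply : (0 : WienerAlgebra G r) l = 0 := rfl
@[simp] lemma smul_apply (c : ℂ) : (c • x) l = c * x l := rfl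

end Coefficients

@[ext] lemma ext {x y : WienerAlgebra G r} (h : ∀ l, x l = y l) : x = y := DFunLike.ext x y h

lemma summable (x : WienerAlgebra G r) : Summable fun l => ‖x l‖ * expWeight r l := x.2

/-- The weighting `x ↦ (x l * e ^ (r ‖l‖))`, which identifies the Wiener algebra with `ℓ¹`. -/
def toLp (G : Type*) [SeminormedAddCommGroup G] (r : ℝ≥0) :
    WienerAlgebra G r ≃ₗ[ℂ] lp (fun _ : G => ℂ) 1 :=
  have weight_ne_zero (l : G) : (expWeight r l : ℂ) ≠ 0 := by exact_mod_cast (expWeight_pos r l).ne'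
  { toFun := fun x => ⟨fun l => x l * (expWeight r l : ℂ),
      (memℓp_gen_iff (p := 1) (by simp)).2 (x.summable.congr fun l => by simp)⟩
    map_add' := fun x y => by ext l; exact add_mul _ _ _
    map_smul' := fun c x => by ext l; exact mul_assoc _ _ _
    invFun := fun y => mk (fun l => y l / (expWeight r l : ℂ)) <|
      ((memℓp_gen_iff (p := 1) (by simp)).1 y.2).congr fun l => by
        simp [div_mul_cancel₀ _ (expWeight_pos r l).ne']
    left_inv := fun x => by ext l; exact mul_div_cancel_right₀ _ (weight_ne_zero l)
    right_inv := fun y => by ext l; exact div_mul_cancel₀ _ (weight_ne_zero l) }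

instance : NormedAddCommGroup (WienerAlgebra G r) :=
  NormedAddCommGroup.induced _ _ (toLp G r) (toLp G r).injective
instance : NormedSpace ℂ (WienerAlgebra G r) := NormedSpace.induced ℂ _ _ (toLp G r)

lemma isometry_toLp : Isometry (toLp G r) := AddMonoidHomClass.isometry_of_norm _ fun _ => rfl

instance : CompleteSpace (WienerAlgebra G r) :=
  (IsometryEquiv.mk (toLp G r).toEquiv isometry_toLp).completeSpace

lemma norm_def (x : WienerAlgebra G r) : ‖x‖ = ∑' l, ‖x l‖ * expWeight r l := by
  have weighted (l : G) : toLp G r x l = x l * (expWeight r l : ℂ) := rfl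
  change ‖toLp G r x‖ = _
  rw [lp.norm_eq_tsum_rpow (by simp)]
  simp [weighted]

lemma norm_apply_mul_le (x : WienerAlgebra G r) (l : G) : ‖x l‖ * expWeight r l ≤ ‖x‖ := by
  rw [norm_def]
  exact x.summable.le_tsum l fun m _ => mul_nonneg (norm_nonneg _) (expWeight_pos r m).le

lemma norm_apply_le (x : WienerAlgebra G r) (l : G) : ‖x l‖ ≤ ‖x‖ :=
  (le_mul_of_one_le_right (norm_nonneg _) (one_le_expWeight r l)).trans (norm_apply_mul_le x l)

/-- The coefficient functional `x ↦ x l`. -/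
def coeffCLM (r : ℝ≥0) (l : G) : WienerAlgebra G r →L[ℂ] ℂ :=
  LinearMap.mkContinuous ⟨⟨fun x => x l, fun _ _ => rfl⟩, fun _ _ => rfl⟩ 1
    fun x => (norm_apply_le x l).trans_eq (one_mul _).symm

@[simp] lemma coeffCLM_apply (x : WienerAlgebra G r) (l : G) : coeffCLM r l x = x l := rfl

open Classical in
/-- The family with the single coefficient `1` at `l`, which stands for `e ^ (i (ω, l) z)`. -/
def monomial (r : ℝ≥0) (l : G) : WienerAlgebra G r :=
  mk (Pi.single l 1) (summable_of_ne_finset_zero (s := {l}) fun m hm => by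
    simp [Pi.single_eq_of_ne (Finset.notMem_singleton.1 hm)])

lemma monomial_apply [DecidableEq G] (l m : G) : monomial r l m = (Pi.single l 1 : G → ℂ) m := by
  simp only [monomial, mk_apply]
  congr!

@[simp] lemma norm_monomial (l : G) : ‖monomial r l‖ = expWeight r l := by
  classical
  rw [norm_def, tsum_eq_single l]
  · simp [monomial_apply]
  · intro m hm
    simp [monomial_apply, Pi.single_eq_of_ne hm]

lemma hasSum_monomial (x : WienerAlgebra G r) : HasSum (fun l => x l • monomial r l) x := by
  classical
  have hs : Summable fun l => x l • monomial r l :=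
    .of_norm (x.summable.congr fun l => by rw [norm_smul, norm_monomial])
  refine (Summable.hasSum_iff hs).2 (ext fun m => ?_)
  refine (hs.hasSum.mapL (coeffCLM r m)).unique ?_
  convert hasSum_ite_eq m (x m) using 2 with l
  by_cases h : l = m
  · subst h; simp [monomial_apply]
  · simp [monomial_apply, h]

lemma addMonoidHom_ext {B : Type*} [AddCommMonoid B] [TopologicalSpace B] [T2Space B]
    {f g : WienerAlgebra G r →+ B} (hf : Continuous f) (hg : Continuous g)
    (h : ∀ (c : ℂ) l, f (c • monomial r l) = g (c • monomial r l)) : f = g := by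
  ext x
  refine ((hasSum_monomial x).map f hf).unique
    (((hasSum_monomial x).map g hg).congr_fun fun l => ?_)
  simp [h]

section Lift

variable {B : Type*} [NormedAddCommGroup B] [NormedSpace ℂ B]

lemma clm_ext {f g : WienerAlgebra G r →L[ℂ] B} (h : ∀ l, f (monomial r l) = g (monomial r l)) :
    f = g :=
  ContinuousLinearMap.coe_injective <| LinearMap.toAddMonoidHom_injective <|
    addMonoidHom_ext f.continuous g.continuous fun c l => by simp [h]

variable {v : G → B} {C : ℝ}

lemma norm_apply_smul_le (hv : ∀ l, ‖v l‖ ≤ C * expWeight r l) (x : WienerAlgebra G r) (l : G) :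
    ‖x l • v l‖ ≤ C * (‖x l‖ * expWeight r l) := by
  rw [norm_smul, mul_left_comm]
  exact mul_le_mul_of_nonneg_left (hv l) (norm_nonneg _)

variable [CompleteSpace B]

/-- The continuous linear map with prescribed values `v` on the monomials. -/
def lift (v : G → B) (C : ℝ) (hv : ∀ l, ‖v l‖ ≤ C * expWeight r l) : WienerAlgebra G r →L[ℂ] B :=
  have hs (x : WienerAlgebra G r) : Summable fun l => x l • v l :=
    .of_norm_bounded (x.summable.mul_left C) (norm_apply_smul_le hv x)
  LinearMap.mkContinuous
    { toFun := fun x => ∑' l, x l • v l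
      map_add' := fun x y => by simp [add_smul, (hs x).tsum_add (hs y)]
      map_smul' := fun c x => by simp [mul_smul, (hs x).tsum_const_smul] } C fun x => by
    rw [norm_def, ← tsum_mul_left]
    exact tsum_of_norm_bounded (x.summable.mul_left C).hasSum (norm_apply_smul_le hv x)

variable (hv : ∀ l, ‖v l‖ ≤ C * expWeight r l)

lemma lift_apply (x : WienerAlgebra G r) : lift v C hv x = ∑' l, x l • v l := rfl

@[simp] lemma lift_monomial (l : G) : lift v C hv (monomial r l) = v l := by
  classical
  rw [lift_apply, tsum_eq_single l]
  · simp [monomial_apply]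
  · intro m hm
    simp [monomial_apply, Pi.single_eq_of_ne hm]

lemma norm_lift_apply_le (x : WienerAlgebra G r) : ‖lift v C hv x‖ ≤ C * ‖x‖ := by
  rw [norm_def, ← tsum_mul_left, lift_apply]
  exact tsum_of_norm_bounded (x.summable.mul_left C).hasSum (norm_apply_smul_le hv x)

end Lift

/-- Multiplication by a monomial, that is, translation of the coefficients. -/
def shift (r : ℝ≥0) (l : G) : WienerAlgebra G r →L[ℂ] WienerAlgebra G r :=
  lift (fun m => monomial r (l + m)) (expWeight r l) fun m => by
    rw [norm_monomial]
    exact expWeight_add_le r l m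

/-- Convolution of coefficient families, the multiplication of the Wiener algebra. -/
def conv (G : Type*) [SeminormedAddCommGroup G] (r : ℝ≥0) :
    WienerAlgebra G r →L[ℂ] WienerAlgebra G r →L[ℂ] WienerAlgebra G r :=
  lift (shift r) 1 fun l => by
    rw [one_mul]
    exact ContinuousLinearMap.opNorm_le_bound _ (expWeight_pos r l).le (norm_lift_apply_le _)

lemma conv_monomial_monomial (l m : G) :
    conv G r (monomial r l) (monomial r m) = monomial r (l + m) := by
  rw [conv, lift_monomial, shift, lift_monomial]

lemma conv_comm (x y : WienerAlgebra G r) : conv G r x y = conv G r y x := by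
  have flip_eq : conv G r = (conv G r).flip := clm_ext fun l => clm_ext fun m => by
    rw [ContinuousLinearMap.flip_apply, conv_monomial_monomial, conv_monomial_monomial, add_comm]
  exact DFunLike.congr_fun (DFunLike.congr_fun flip_eq x) y

lemma conv_assoc (x y z : WienerAlgebra G r) :
    conv G r (conv G r x y) z = conv G r x (conv G r y z) := by
  let compL := ContinuousLinearMap.compL ℂ (WienerAlgebra G r) (WienerAlgebra G r)
    (WienerAlgebra G r)
  have monomials (l m : G) : conv G r (conv G r (monomial r l) (monomial r m)) =
      (conv G r (monomial r l)).comp (conv G r (monomial r m)) := clm_ext fun n => by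
    simp only [ContinuousLinearMap.comp_apply, conv_monomial_monomial, add_assoc]
  have left_monomial (l : G) : (conv G r).comp (conv G r (monomial r l)) =
      (compL (conv G r (monomial r l))).comp (conv G r) := clm_ext fun m => monomials l m
  have all : (conv G r).comp ((conv G r).flip y) = (compL.flip (conv G r y)).comp (conv G r) :=
    clm_ext fun l => DFunLike.congr_fun (left_monomial l) y
  exact DFunLike.congr_fun (DFunLike.congr_fun all x) z

instance : Mul (WienerAlgebra G r) := ⟨fun x y => conv G r x y⟩
instance : One (WienerAlgebra G r) := ⟨monomial r 0⟩

lemma mul_def (x y : WienerAlgebra G r) : x * y = conv G r x y := rfl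
lemma one_def : (1 : WienerAlgebra G r) = monomial r 0 := rfl

lemma one_conv (x : WienerAlgebra G r) : conv G r (monomial r 0) x = x :=
  DFunLike.congr_fun (clm_ext fun l => by simp [conv_monomial_monomial] :
    conv G r (monomial r 0) = ContinuousLinearMap.id ℂ _) x

instance : CommRing (WienerAlgebra G r) :=
  { (inferInstance : AddCommGroup (WienerAlgebra G r)),
    (inferInstance : Mul (WienerAlgebra G r)), (inferInstance : One (WienerAlgebra G r)) with
    left_distrib := fun x y z => by simp [mul_def]
    right_distrib := fun x y z => by simp [mul_def]
    zero_mul := fun x => by simp [mul_def]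
    mul_zero := fun x => by simp [mul_def]
    mul_assoc := conv_assoc
    mul_comm := conv_comm
    one_mul := one_conv
    mul_one := fun x => (conv_comm x _).trans (one_conv x) }

instance : NormedCommRing (WienerAlgebra G r) :=
  { (inferInstance : NormedAddCommGroup (WienerAlgebra G r)),
    (inferInstance : CommRing (WienerAlgebra G r)) with
    norm_mul_le := fun x y => by
      rw [mul_def]
      refine (ContinuousLinearMap.le_opNorm _ _).trans ?_
      gcongr
      exact (norm_lift_apply_le (v := shift r) (C := 1) _ x).trans_eq (one_mul _) }

instance : Algebra ℂ (WienerAlgebra G r) :=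
  Algebra.ofModule (fun c x y => by simp [mul_def]) fun c x y => by simp [mul_def]

instance : NormedAlgebra ℂ (WienerAlgebra G r) where
  norm_smul_le := norm_smul_le

instance : NormedAlgebra ℚ (WienerAlgebra G r) := NormedAlgebra.restrictScalars ℚ ℂ _

instance : NormOneClass (WienerAlgebra G r) := ⟨by rw [one_def, norm_monomial, expWeight_zero]⟩

lemma monomial_mul_monomial (l m : G) : monomial r l * monomial r m = monomial r (l + m) :=
  conv_monomial_monomial l m

lemma one_apply [DecidableEq G] (l : G) :
    (1 : WienerAlgebra G r) l = if l = 0 then 1 else 0 := by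
  rw [one_def, monomial_apply, Pi.single_apply]

lemma one_apply_zero : (1 : WienerAlgebra G r) 0 = 1 := by
  classical
  simp [one_apply]

lemma norm_smul_one (c : ℂ) : ‖c • (1 : WienerAlgebra G r)‖ = ‖c‖ := by
  rw [norm_smul, norm_one, mul_one]

/-- Conjugation of the function that the coefficients represent, whose coefficients are
`conj (x (-l))`; the self-adjoint elements stand for the functions that are real on the real
axis. -/
instance : Star (WienerAlgebra G r) where
  star x := mk (fun l => conj (x (-l)))
    (((Equiv.neg G).summable_iff.2 x.summable).congr fun l => by simp)

@[simp] lemma star_apply (x : WienerAlgebra G r) (l : G) : (star x) l = conj (x (-l)) := rfl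

instance : StarAddMonoid (WienerAlgebra G r) where
  star_involutive x := by ext l; simp
  star_add x y := by ext l; simp

instance : StarModule ℂ (WienerAlgebra G r) where
  star_smul c x := by ext l; simp

instance : NormedStarGroup (WienerAlgebra G r) where
  norm_star_le x := by
    rw [norm_def, norm_def, ← (Equiv.neg G).tsum_eq]
    simp

@[simp] lemma star_monomial (l : G) : star (monomial r l) = monomial r (-l) := by
  classical
  ext k
  by_cases h : k = -l
  · simp [h, monomial_apply]
  · have h' : -k ≠ l := fun h' => h (by rw [← h', neg_neg])
    simp [monomial_apply, Pi.single_eq_of_ne h, Pi.single_eq_of_ne h']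

instance : StarRing (WienerAlgebra G r) :=
  { (inferInstance : StarAddMonoid (WienerAlgebra G r)) with
    star_mul := fun x y => by
      let σ : WienerAlgebra G r →+ WienerAlgebra G r := starAddEquiv.toAddMonoidHom
      have monomials (c d : ℂ) (l m : G) : star ((c • monomial r l) * (d • monomial r m)) =
          star (d • monomial r m) * star (c • monomial r l) := by
        simp [monomial_mul_monomial, smul_comm (conj c), add_comm]
      have left_monomial (c : ℂ) (l : G) : σ.comp (AddMonoidHom.mulLeft (c • monomial r l)) =
          (AddMonoidHom.mulRight (star (c • monomial r l))).comp σ :=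
        addMonoidHom_ext (continuous_star.comp (continuous_const.mul continuous_id))
          (continuous_star.mul continuous_const) fun d m => monomials c d l m
      have all : σ.comp (AddMonoidHom.mulRight y) = (AddMonoidHom.mulLeft (star y)).comp σ :=
        addMonoidHom_ext (continuous_star.comp (continuous_id.mul continuous_const))
          (continuous_const.mul continuous_star)
          fun c l => DFunLike.congr_fun (left_monomial c l) y
      exact DFunLike.congr_fun all x }

end WienerAlgebra

/-! ### Homomorphisms of weighted Wiener algebras -/

namespace WienerAlgebra

section LiftHom

variable {G : Type*} [SeminormedAddCommGroup G] {r : ℝ≥0}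
  {B : Type*} [NormedCommRing B] [NormedAlgebra ℂ B] [CompleteSpace B] [StarRing B]
  [ContinuousStar B] [StarModule ℂ B]

/-- The `⋆`-homomorphism with prescribed values on the monomials, for a character that is unitary
and dominated by the weight. -/
def liftHom (χ : AddChar G B) (hχ : ∀ l, ‖χ l‖ ≤ expWeight r l)
    (hstar : ∀ l, χ (-l) = star (χ l)) : WienerAlgebra G r →⋆ₐ[ℂ] B :=
  have hχ' (l : G) : ‖χ l‖ ≤ 1 * expWeight r l := (hχ l).trans_eq (one_mul _).symm
  { AlgHom.ofLinearMap (lift χ 1 hχ' : WienerAlgebra G r →ₗ[ℂ] B) (by simp [one_def])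
      fun x y => by
        let f := lift χ 1 hχ'
        have on_monomials : (ContinuousLinearMap.compL ℂ _ _ B f).comp (conv G r) =
            (((ContinuousLinearMap.mul ℂ B).comp f).flip.comp f).flip :=
          clm_ext fun l => clm_ext fun m => by
            simp [f, conv_monomial_monomial, AddChar.map_add_eq_mul]
        exact DFunLike.congr_fun (DFunLike.congr_fun on_monomials x) y with
    map_star' := fun x => by
      change ∑' l, star x l • χ l = star (∑' l, x l • χ l)
      rw [tsum_star, ← (Equiv.neg G).tsum_eq]
      simp [hstar] }

variable {χ : AddChar G B} {hχ : ∀ l, ‖χ l‖ ≤ expWeight r l} {hstar : ∀ l, χ (-l) = star (χ l)}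

lemma liftHom_apply (x : WienerAlgebra G r) : liftHom χ hχ hstar x = ∑' l, x l • χ l := rfl

lemma norm_liftHom_le (x : WienerAlgebra G r) : ‖liftHom χ hχ hstar x‖ ≤ ‖x‖ :=
  (norm_lift_apply_le (fun l => (hχ l).trans_eq (one_mul _).symm) x).trans_eq (one_mul _)

lemma continuous_liftHom : Continuous (liftHom χ hχ hstar) :=
  (lift χ 1 fun l => (hχ l).trans_eq (one_mul _).symm).continuous

lemma liftHom_monomial (l : G) : liftHom χ hχ hstar (monomial r l) = χ l :=
  lift_monomial (fun l => (hχ l).trans_eq (one_mul _).symm) l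

end LiftHom

variable {G : Type*} [SeminormedAddCommGroup G] {r r' : ℝ≥0}

section Diagonal

/-- The diagonal operator with the eigenvalues `m` on the monomials. -/
def diagonal (m : G → ℂ) (C : ℝ) (hm : ∀ l, ‖m l‖ * expWeight r' l ≤ C * expWeight r l) :
    WienerAlgebra G r →L[ℂ] WienerAlgebra G r' :=
  lift (fun l => m l • monomial r' l) C fun l => by
    rw [norm_smul, norm_monomial]
    exact hm l

variable {m : G → ℂ} {C : ℝ} (hm : ∀ l, ‖m l‖ * expWeight r' l ≤ C * expWeight r l)

lemma diagonal_apply (x : WienerAlgebra G r) (l : G) : diagonal m C hm x l = m l * x l := by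
  classical
  have coeff_comp : (coeffCLM r' l).comp (diagonal m C hm) = m l • coeffCLM r l :=
    clm_ext fun k => by
      by_cases hk : l = k
      · simp [diagonal, hk, monomial_apply]
      · simp [diagonal, monomial_apply, Pi.single_eq_of_ne hk]
  exact DFunLike.congr_fun coeff_comp x

lemma norm_diagonal_le (x : WienerAlgebra G r) : ‖diagonal m C hm x‖ ≤ C * ‖x‖ :=
  norm_lift_apply_le _ x

end Diagonal

section Restrict

/-- The character `l ↦ e ^ (i (ω, l) z)` of the index group. -/
def monomialChar (G : Type*) [SeminormedAddCommGroup G] (r : ℝ≥0) :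
    AddChar G (WienerAlgebra G r) where
  toFun := monomial r
  map_zero_eq_one' := rfl
  map_add_eq_mul' l m := (monomial_mul_monomial l m).symm

/-- Restriction of functions to a narrower strip. -/
def restrict (h : r' ≤ r) : WienerAlgebra G r →⋆ₐ[ℂ] WienerAlgebra G r' :=
  liftHom (monomialChar G r') (fun l => (norm_monomial l).trans_le (expWeight_mono h l))
    fun l => (star_monomial l).symm

variable (h : r' ≤ r)

@[simp] lemma restrict_monomial (l : G) : restrict h (monomial r l) = monomial r' l :=
  liftHom_monomial l

lemma norm_restrict_le (x : WienerAlgebra G r) : ‖restrict h x‖ ≤ ‖x‖ := norm_liftHom_le x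

lemma norm_restrict_le_of_le {x : WienerAlgebra G r} {C : ℝ} (hx : ‖x‖ ≤ C) :
    ‖restrict h x‖ ≤ C := (norm_restrict_le h x).trans hx

lemma continuous_restrict : Continuous (restrict h : WienerAlgebra G r → WienerAlgebra G r') :=
  continuous_liftHom

@[simp] lemma restrict_apply (x : WienerAlgebra G r) (l : G) : restrict h x l = x l := by
  rw [← one_mul (x l), ← diagonal_apply (r := r) (r' := r') (m := fun _ => 1) (C := 1)
    (fun l => by simpa using expWeight_mono h l)]
  simp [diagonal, lift_apply, restrict, liftHom_apply, monomialChar]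

lemma restrict_restrict {r'' : ℝ≥0} (h' : r'' ≤ r') (x : WienerAlgebra G r) :
    restrict h' (restrict h x) = restrict (h'.trans h) x := by ext l; simp

end Restrict

end WienerAlgebra

/-- A frequency functional on the index group that is bounded by the weight, such as
`l ↦ (ω, l)` for a frequency vector with `|ω i| ≤ 1`. -/
structure Frequency (G : Type*) [SeminormedAddCommGroup G] extends G →+ ℝ where
  abs_le' : ∀ l, |toFun l| ≤ ‖l‖

namespace Frequency

variable {G : Type*} [SeminormedAddCommGroup G]

instance : FunLike (Frequency G) G ℝ where
  coe ω := ω.toFun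
  coe_injective ω ω' h := by
    cases ω
    cases ω'
    congr
    exact DFunLike.coe_injective h

instance : AddMonoidHomClass (Frequency G) G ℝ where
  map_add ω := ω.map_add'
  map_zero ω := ω.map_zero'

variable (ω : Frequency G)

lemma abs_le (l : G) : |ω l| ≤ ‖l‖ := ω.abs_le' l

/-- The character `l ↦ e ^ (i (ω, l) t)`. -/
def phase (t : ℝ) : AddChar G ℂ where
  toFun l := Complex.exp (I * ω l * t)
  map_zero_eq_one' := by simp
  map_add_eq_mul' l m := by
    rw [← Complex.exp_add, map_add]
    push_cast
    ring_nf

variable {ω} {t : ℝ}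

lemma phase_apply (l : G) : ω.phase t l = Complex.exp (I * ω l * t) := rfl

@[simp] lemma phase_zero_apply (l : G) : ω.phase 0 l = 1 := by simp [phase_apply]

lemma phase_add_apply (s t : ℝ) (l : G) : ω.phase (s + t) l = ω.phase s l * ω.phase t l := by
  simp only [phase_apply, ← Complex.exp_add]
  push_cast
  ring_nf

@[simp] lemma norm_phase (l : G) : ‖ω.phase t l‖ = 1 := by
  rw [phase_apply, mul_assoc, ← Complex.ofReal_mul, mul_comm]
  exact Complex.norm_exp_ofReal_mul_I _

lemma phase_neg (l : G) : ω.phase t (-l) = conj (ω.phase t l) := by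
  simp [phase_apply, ← Complex.exp_conj]

end Frequency

namespace WienerAlgebra

variable {G : Type*} [SeminormedAddCommGroup G] {r r' : ℝ≥0} (ω : Frequency G)

section Translate

/-- Translation of the argument, `z ↦ z + t`. -/
def translate (t : ℝ) : WienerAlgebra G r →⋆ₐ[ℂ] WienerAlgebra G r :=
  liftHom
    { toFun := fun l => ω.phase t l • monomial r l
      map_zero_eq_one' := by simp [one_def]
      map_add_eq_mul' := fun l m => by
        rw [smul_mul_smul_comm, monomial_mul_monomial, AddChar.map_add_eq_mul] }
    (fun l => by simp [norm_smul]) fun l => by simp [Frequency.phase_neg]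

variable {ω} {t : ℝ}

@[simp] lemma translate_monomial (l : G) :
    translate ω t (monomial r l) = ω.phase t l • monomial r l := liftHom_monomial l

@[simp] lemma translate_apply (x : WienerAlgebra G r) (l : G) :
    translate ω t x l = ω.phase t l * x l :=
  diagonal_apply (C := 1) (fun l => by simp) x l

@[simp] lemma translate_zero (x : WienerAlgebra G r) : translate ω 0 x = x := by ext l; simp

lemma norm_translate_le (x : WienerAlgebra G r) : ‖translate ω t x‖ ≤ ‖x‖ := norm_liftHom_le x

lemma norm_translate_le_of_le {x : WienerAlgebra G r} {C : ℝ} (hx : ‖x‖ ≤ C) :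
    ‖translate ω t x‖ ≤ C := (norm_translate_le x).trans hx

lemma continuous_translate :
    Continuous (translate ω t : WienerAlgebra G r → WienerAlgebra G r) := continuous_liftHom

lemma restrict_translate (h : r' ≤ r) (x : WienerAlgebra G r) :
    restrict h (translate ω t x) = translate ω t (restrict h x) := by ext l; simp

end Translate

section Eval

/-- Evaluation of the represented function at a real point. -/
def eval (ξ : ℝ) : WienerAlgebra G r →⋆ₐ[ℂ] ℂ :=
  liftHom (ω.phase ξ) (fun l => (Frequency.norm_phase l).trans_le (one_le_expWeight r l))
    Frequency.phase_neg

variable {ω} {ξ : ℝ}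

lemma eval_eq_tsum (x : WienerAlgebra G r) : eval ω ξ x = ∑' l, x l * ω.phase ξ l := rfl

@[simp] lemma eval_monomial (l : G) : eval ω ξ (monomial r l) = ω.phase ξ l := liftHom_monomial l

lemma norm_eval_le (x : WienerAlgebra G r) : ‖eval ω ξ x‖ ≤ ‖x‖ := norm_liftHom_le x

lemma continuous_eval : Continuous (eval ω ξ : WienerAlgebra G r → ℂ) := continuous_liftHom

lemma eval_translate (t : ℝ) (x : WienerAlgebra G r) :
    eval ω ξ (translate ω t x) = eval ω (ξ + t) x := by
  simp only [eval_eq_tsum, translate_apply, Frequency.phase_add_apply]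
  exact tsum_congr fun l => by ring

lemma ofReal_re_eval {x : WienerAlgebra G r} (hx : IsSelfAdjoint x) (ω : Frequency G) (ξ : ℝ) :
    ((eval ω ξ x).re : ℂ) = eval ω ξ x :=
  Complex.conj_eq_iff_re.1 (hx.map (eval ω ξ))

end Eval

section SelfAdjoint

lemma conj_apply_neg {x : WienerAlgebra G r} (hx : IsSelfAdjoint x) (l : G) :
    conj (x (-l)) = x l := DFunLike.congr_fun hx.star_eq l

lemma ofReal_re_apply_zero {x : WienerAlgebra G r} (hx : IsSelfAdjoint x) :
    ((x 0).re : ℂ) = x 0 :=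
  Complex.conj_eq_iff_re.1 (by simpa using conj_apply_neg hx 0)

end SelfAdjoint

end WienerAlgebra

section Inverse

lemma isSelfAdjoint_of_mul_eq_one {A : Type*} [CommRing A] [StarRing A] {x y : A}
    (hx : IsSelfAdjoint x) (h : x * y = 1) : IsSelfAdjoint y := by
  have mul_star : x * star y = 1 := by
    rw [← hx.star_eq, ← star_mul', h, star_one]
  exact (left_inv_eq_right_inv ((mul_comm y x).trans h) mul_star).symm

variable {A : Type*} [NormedCommRing A] [CompleteSpace A] [NormOneClass A]

lemma exists_mul_eq_one_of_norm_sub_one_le {x : A} (hx : ‖x - 1‖ ≤ 1 / 2) :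
    ∃ y, x * y = 1 ∧ ‖y‖ ≤ 2 := by
  have hx' : ‖1 - x‖ < 1 := by rw [norm_sub_rev]; linarith
  refine ⟨∑' n, (1 - x) ^ n, by simpa using mul_neg_geom_series (1 - x) hx',
    tsum_of_norm_bounded hasSum_geometric_two fun n => (norm_pow_le _ _).trans ?_⟩
  rw [norm_sub_rev]
  gcongr

end Inverse

section Exponential

variable {A : Type*} [NormedRing A] [NormOneClass A] [NormedAlgebra ℂ A]

lemma norm_exp_le_exp_norm (x : A) : ‖NormedSpace.exp x‖ ≤ Real.exp ‖x‖ := by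
  rw [NormedSpace.exp_eq_tsum ℂ, Real.exp_eq_exp_ℝ]
  refine tsum_of_norm_bounded (NormedSpace.expSeries_div_hasSum_exp (𝔸 := ℝ) ‖x‖) fun n => ?_
  rw [norm_smul, div_eq_inv_mul, norm_inv, RCLike.norm_natCast]
  gcongr
  exact norm_pow_le x n

end Exponential

/-! ### Substitution into convergent germs -/

section Cauchy

open Metric

variable {B : Type*} [NormedAddCommGroup B] [NormedSpace ℂ B] {φ : ℂ → B} {T d : ℝ}

lemma norm_sub_le_of_norm_le_on_ball (hT : 1 < T) (hφ : DifferentiableOn ℂ φ (ball 0 T))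
    (hd : ∀ z ∈ ball (0 : ℂ) T, ‖φ z‖ ≤ d) : ‖φ 1 - φ 0‖ ≤ 2 * d / T := by
  have maps : Set.MapsTo φ (ball 0 T) (closedBall (φ 0) (2 * d)) := fun z hz => by
    rw [mem_closedBall, dist_eq_norm, two_mul]
    exact norm_sub_le_of_le (hd z hz) (hd 0 (mem_ball_self (one_pos.trans hT)))
  simpa [dist_eq_norm] using
    Complex.dist_le_div_mul_dist_of_mapsTo_ball hφ maps (by simpa : (1 : ℂ) ∈ ball 0 T)

/-- The Schwarz lemma for `φ` bounds its difference quotient, to which it then applies again. -/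
lemma norm_sub_sub_deriv_le_of_norm_le_on_ball [CompleteSpace B] (hT : 1 < T)
    (hφ : DifferentiableOn ℂ φ (ball 0 T)) (hd : ∀ z ∈ ball (0 : ℂ) T, ‖φ z‖ ≤ d) :
    ‖φ 1 - φ 0 - deriv φ 0‖ ≤ 4 * d / T ^ 2 := by
  have hT0 : 0 < T := one_pos.trans hT
  have maps : Set.MapsTo φ (ball 0 T) (closedBall (φ 0) (2 * d)) := fun z hz => by
    rw [mem_closedBall, dist_eq_norm, two_mul]
    exact norm_sub_le_of_le (hd z hz) (hd 0 (mem_ball_self hT0))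
  have slope := norm_sub_le_of_norm_le_on_ball hT
    ((Complex.differentiableOn_dslope (ball_mem_nhds 0 hT0)).2 hφ)
    fun z hz => Complex.norm_dslope_le_div_of_mapsTo_ball hφ maps hz
  rw [dslope_same, dslope_of_ne _ one_ne_zero, slope_def_module] at slope
  simpa [sq, mul_div_assoc, div_div, ← mul_assoc, show (2 : ℝ) * 2 = 4 by norm_num] using slope

end Cauchy

lemma injective_prodMap_id_succ {α : Type*} :
    Function.Injective (Prod.map id Nat.succ : α × ℕ → α × ℕ) :=
  Function.injective_id.prodMap Nat.succ_injective

section Germ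

variable {G : Type*} [SeminormedAddCommGroup G]

lemma mul_expWeight_le {r r' : ℝ≥0} {ρ c : ℝ} (hr : r' + ρ ≤ r) {l : G}
    (hc : c ≤ Real.exp (ρ * ‖l‖)) : c * expWeight r' l ≤ expWeight r l := by
  refine (mul_le_mul_of_nonneg_right hc (expWeight_pos r' l).le).trans ?_
  rw [expWeight, expWeight, ← Real.exp_add, ← add_mul]
  gcongr
  linarith

lemma Frequency.abs_mul_expWeight_le (ω : Frequency G) {r r' : ℝ≥0} {ρ : ℝ} (hρ : 0 < ρ)
    (hr : r' + ρ ≤ r) (l : G) : |ω l| * expWeight r' l ≤ ρ⁻¹ * expWeight r l := by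
  rw [inv_mul_eq_div, le_div_iff₀ hρ, mul_right_comm]
  refine mul_expWeight_le hr ?_
  calc |ω l| * ρ ≤ ‖l‖ * ρ := by gcongr; exact ω.abs_le l
    _ ≤ Real.exp (ρ * ‖l‖) := by linarith [Real.add_one_le_exp (ρ * ‖l‖)]

/-- The germ of a function `∑ a (l, k) y ^ k e ^ (i (ω, l) x)` at `y = 0`, given by its
coefficients. -/
abbrev Germ (G : Type*) := G × ℕ → ℂ

namespace Germ

/-- The derivative of a germ in `x`. -/
def dx (ω : Frequency G) (a : Germ G) : Germ G := fun j => I * ω j.1 * a j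

/-- The derivative of a germ in `y`. -/
def dy (a : Germ G) : Germ G := fun j => (j.2 + 1) * a (j.1, j.2 + 1)

/-- The germ is real at real points. -/
def IsReal (a : Germ G) : Prop := ∀ l k, a (-l, k) = conj (a (l, k))

/-- The germ has weighted norm at most `d` on the polydisc of radii `R`, `s`. -/
structure HasBound (a : Germ G) (R : ℝ≥0) (s d : ℝ) : Prop where
  summable : Summable fun j => ‖a j‖ * (s ^ j.2 * expWeight R j.1)
  le : ∑' j, ‖a j‖ * (s ^ j.2 * expWeight R j.1) ≤ d

variable {ω : Frequency G} {a : Germ G}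

lemma IsReal.dx (h : a.IsReal) : (a.dx ω).IsReal := fun l k => by simp [Germ.dx, h l k]

lemma IsReal.dy (h : a.IsReal) : a.dy.IsReal := fun l k => by simp [Germ.dy, h l (k + 1)]

namespace HasBound

variable {R R' : ℝ≥0} {s s' d ρ : ℝ}

lemma nonneg (h : a.HasBound R s d) (hs : 0 ≤ s) : 0 ≤ d :=
  (tsum_nonneg fun j => by have := expWeight_pos R j.1; positivity).trans h.le

lemma of_le {b : Germ G} {C : ℝ} (h : a.HasBound R s d) (hs' : 0 ≤ s') (hC : 0 ≤ C)
    (hb : ∀ j, ‖b j‖ * (s' ^ j.2 * expWeight R' j.1) ≤ C * (‖a j‖ * (s ^ j.2 * expWeight R j.1))) :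
    b.HasBound R' s' (C * d) := by
  have summable_b : Summable fun j => ‖b j‖ * (s' ^ j.2 * expWeight R' j.1) :=
    .of_nonneg_of_le (fun j => by have := expWeight_pos R' j.1; positivity) hb
      (h.summable.mul_left C)
  refine ⟨summable_b, (summable_b.tsum_le_tsum hb (h.summable.mul_left C)).trans ?_⟩
  rw [tsum_mul_left]
  exact mul_le_mul_of_nonneg_left h.le hC

lemma mono (h : a.HasBound R s d) (hR : R' ≤ R) (hs : s' ≤ s) (hs' : 0 ≤ s') :
    a.HasBound R' s' d := by
  rw [← one_mul d]
  refine h.of_le hs' zero_le_one fun j => ?_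
  have := expWeight_mono hR j.1
  have := expWeight_pos R' j.1
  have := hs'.trans hs
  rw [one_mul]
  gcongr

lemma dx (h : a.HasBound R s d) (hs : 0 ≤ s) (hρ : 0 < ρ) (hR : R' + ρ ≤ R) :
    (a.dx ω).HasBound R' s (ρ⁻¹ * d) := by
  refine h.of_le hs (by positivity) fun j => ?_
  calc ‖a.dx ω j‖ * (s ^ j.2 * expWeight R' j.1)
      = ‖a j‖ * s ^ j.2 * (|ω j.1| * expWeight R' j.1) := by simp [Germ.dx]; ring
    _ ≤ ‖a j‖ * s ^ j.2 * (ρ⁻¹ * expWeight R j.1) := by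
        refine mul_le_mul_of_nonneg_left ?_ (by positivity)
        exact ω.abs_mul_expWeight_le hρ hR j.1
    _ = ρ⁻¹ * (‖a j‖ * (s ^ j.2 * expWeight R j.1)) := by ring

lemma succ_mul_pow_le (hs' : 0 ≤ s') (hρ : 0 < ρ) (hs : s' + ρ ≤ s) (k : ℕ) :
    ((k : ℝ) + 1) * s' ^ k ≤ ρ⁻¹ * s ^ (k + 1) := by
  rw [inv_mul_eq_div, le_div_iff₀ hρ]
  have bernoulli : s' ^ (k + 1) + (k + 1 : ℕ) * s' ^ k * ρ ≤ (s' + ρ) ^ (k + 1) := by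
    simpa using pow_add_mul_le_add_pow_of_sq_nonneg (a := s') (b := ρ) hs' (sq_nonneg _)
      (sq_nonneg _) (by linarith) (k + 1)
  calc ((k : ℝ) + 1) * s' ^ k * ρ ≤ (s' + ρ) ^ (k + 1) := by
        push_cast at bernoulli
        linarith [pow_nonneg hs' (k + 1)]
    _ ≤ s ^ (k + 1) := by gcongr

lemma dy (h : a.HasBound R s d) (hs' : 0 ≤ s') (hρ : 0 < ρ) (hs : s' + ρ ≤ s) :
    a.dy.HasBound R s' (ρ⁻¹ * d) := by
  have hs0 : 0 ≤ s := by linarith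
  let term (j : G × ℕ) : ℝ := ‖a j‖ * (s ^ j.2 * expWeight R j.1)
  have term_nonneg (j) : 0 ≤ term j := by have := expWeight_pos R j.1; positivity
  have dy_le (j : G × ℕ) :
      ‖a.dy j‖ * (s' ^ j.2 * expWeight R j.1) ≤ ρ⁻¹ * term (Prod.map id Nat.succ j) := by
    have := expWeight_pos R j.1
    calc ‖a.dy j‖ * (s' ^ j.2 * expWeight R j.1)
        = ((j.2 : ℝ) + 1) * s' ^ j.2 * (‖a (j.1, j.2 + 1)‖ * expWeight R j.1) := by
          rw [Germ.dy, norm_mul, ← Nat.cast_succ, Complex.norm_natCast]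
          push_cast
          ring
      _ ≤ ρ⁻¹ * s ^ (j.2 + 1) * (‖a (j.1, j.2 + 1)‖ * expWeight R j.1) := by
          refine mul_le_mul_of_nonneg_right ?_ (by positivity)
          exact succ_mul_pow_le hs' hρ hs j.2
      _ = ρ⁻¹ * term (Prod.map id Nat.succ j) := by
          simp only [term, Prod.map, id, Nat.succ_eq_add_one]
          ring
  have shifted : Summable fun j => term (Prod.map id Nat.succ j) :=
    h.summable.comp_injective injective_prodMap_id_succ
  have dy_nonneg (j : G × ℕ) : 0 ≤ ‖a.dy j‖ * (s' ^ j.2 * expWeight R j.1) := by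
    have := expWeight_pos R j.1
    positivity
  have summable_dy := Summable.of_nonneg_of_le dy_nonneg dy_le (shifted.mul_left _)
  refine ⟨summable_dy, (summable_dy.tsum_le_tsum dy_le (shifted.mul_left _)).trans ?_⟩
  rw [tsum_mul_left]
  gcongr
  exact (tsum_comp_le_tsum_of_inj h.summable term_nonneg injective_prodMap_id_succ).trans h.le

end HasBound

end Germ

end Germ

section InPolydisc

variable {G : Type*} [SeminormedAddCommGroup G] {r r' : ℝ≥0}

/-- The substitution of `(x + u x, w x)` for `(x, y)` is defined on germs with a bound on the
polydisc of radii `R`, `s`, and remains defined after perturbations of `u` and `w` of size `η`. -/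
structure InPolydisc (R : ℝ≥0) (s η : ℝ) (u w : WienerAlgebra G r) : Prop where
  add_norm_le : r + ‖u‖ + η ≤ R
  norm_add_le : ‖w‖ + η ≤ s

namespace InPolydisc

variable {R : ℝ≥0} {s η η' : ℝ} {u w : WienerAlgebra G r}

lemma mono (h : InPolydisc R s η u w) (hη : η' ≤ η) : InPolydisc R s η' u w :=
  ⟨by linarith [h.add_norm_le], by linarith [h.norm_add_le]⟩

lemma nonneg (h : InPolydisc R s 0 u w) : 0 ≤ s := by linarith [h.norm_add_le, norm_nonneg w]

lemma restrict (h : InPolydisc R s η u w) (hr : r' ≤ r) :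
    InPolydisc R s η (u.restrict hr) (w.restrict hr) :=
  ⟨by linarith [h.add_norm_le, WienerAlgebra.norm_restrict_le hr u, NNReal.coe_le_coe.2 hr],
    by linarith [h.norm_add_le, WienerAlgebra.norm_restrict_le hr w]⟩

lemma add_smul (h : InPolydisc R s η u w) {ν : ℝ} (hν : 0 < ν) {u' w' : WienerAlgebra G r}
    (hu' : ‖u'‖ ≤ ν) (hw' : ‖w'‖ ≤ ν) {t : ℂ} (ht : t ∈ Metric.ball 0 (η / ν)) :
    InPolydisc R s 0 (u + t • u') (w + t • w') := by
  rw [mem_ball_zero_iff, lt_div_iff₀ hν] at ht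
  have norm_le {x y : WienerAlgebra G r} (hy : ‖y‖ ≤ ν) : ‖x + t • y‖ ≤ ‖x‖ + η := by
    refine norm_add_le_of_le le_rfl ((norm_smul_le t y).trans ?_)
    exact (mul_le_mul_of_nonneg_left hy (norm_nonneg t)).trans ht.le
  exact ⟨by linarith [h.add_norm_le, norm_le (x := u) hu'],
    by linarith [h.norm_add_le, norm_le (x := w) hw']⟩

end InPolydisc

end InPolydisc

namespace Germ

variable {G : Type*} [SeminormedAddCommGroup G] {r r' : ℝ≥0}

/-- The summand of index `j` of the substitution `Germ.subst`. -/
def substTerm (ω : Frequency G) (a : Germ G) (u w : WienerAlgebra G r) (j : G × ℕ) :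
    WienerAlgebra G r :=
  a j • (.monomial r j.1 * NormedSpace.exp ((I * ω j.1) • u) * w ^ j.2)

/-- The function `a (x + u x, w x)` of `x`. -/
def subst (ω : Frequency G) (a : Germ G) (u w : WienerAlgebra G r) : WienerAlgebra G r :=
  ∑' j, substTerm ω a u w j

/-- The differential of `Germ.subst` in `(u, w)`. -/
def fderivSubst (ω : Frequency G) (a : Germ G) (u w : WienerAlgebra G r) :
    WienerAlgebra G r × WienerAlgebra G r →L[ℂ] WienerAlgebra G r :=
  (ContinuousLinearMap.mul ℂ _ (subst ω (a.dx ω) u w)).coprod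
    (ContinuousLinearMap.mul ℂ _ (subst ω a.dy u w))

variable {ω : Frequency G} {a : Germ G} {u w u' w' : WienerAlgebra G r} {R : ℝ≥0} {s d η ν : ℝ}

@[simp] lemma fderivSubst_apply :
    fderivSubst ω a u w (u', w') = subst ω (a.dx ω) u w * u' + subst ω a.dy u w * w' := rfl

open WienerAlgebra

lemma norm_substTerm_le (h : InPolydisc R s 0 u w) (j : G × ℕ) :
    ‖substTerm ω a u w j‖ ≤ ‖a j‖ * (s ^ j.2 * expWeight R j.1) := by
  have norm_exp_le : ‖NormedSpace.exp ((I * ω j.1) • u)‖ ≤ Real.exp (‖u‖ * ‖j.1‖) := by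
    refine (norm_exp_le_exp_norm _).trans (Real.exp_le_exp.2 ?_)
    rw [norm_smul, mul_comm]
    gcongr
    simpa using ω.abs_le j.1
  have norm_pow_le' : ‖w ^ j.2‖ ≤ s ^ j.2 :=
    (norm_pow_le w j.2).trans (pow_le_pow_left₀ (norm_nonneg w) (by linarith [h.norm_add_le]) _)
  rw [substTerm, norm_smul, mul_comm (s ^ j.2)]
  refine mul_le_mul_of_nonneg_left (norm_mul_le_of_le ?_ norm_pow_le') (norm_nonneg _)
  refine (norm_mul_le _ _).trans ?_
  rw [norm_monomial, mul_comm]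
  exact mul_expWeight_le (by linarith [h.add_norm_le]) norm_exp_le

lemma hasSum_subst (ha : a.HasBound R s d) (h : InPolydisc R s 0 u w) :
    HasSum (substTerm ω a u w) (subst ω a u w) :=
  (Summable.of_norm_bounded ha.summable (norm_substTerm_le h)).hasSum

lemma norm_subst_le (ha : a.HasBound R s d) (h : InPolydisc R s 0 u w) :
    ‖subst ω a u w‖ ≤ d :=
  (tsum_of_norm_bounded ha.summable.hasSum (norm_substTerm_le h)).trans ha.le

lemma restrict_subst (ha : a.HasBound R s d) (h : InPolydisc R s 0 u w) (hr : r' ≤ r) :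
    restrict hr (subst ω a u w) = subst ω a (restrict hr u) (restrict hr w) := by
  have termwise := (hasSum_subst (ω := ω) ha h).map (restrict hr) (continuous_restrict hr)
  rw [← termwise.tsum_eq, subst]
  refine tsum_congr fun j => ?_
  simp only [Function.comp, substTerm, map_smul, map_mul, restrict_monomial, map_pow,
    NormedSpace.map_exp (restrict hr) (continuous_restrict hr)]

lemma hasSum_eval_subst (ha : a.HasBound R s d) (h : InPolydisc R s 0 u w) (ξ : ℝ) :
    HasSum (fun j : G × ℕ => a j * eval ω ξ w ^ j.2 * Complex.exp (I * ω j.1 * (ξ + eval ω ξ u)))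
      (eval ω ξ (subst ω a u w)) := by
  refine ((hasSum_subst ha h).map (eval ω ξ) continuous_eval).congr_fun fun j => ?_
  simp only [Function.comp, substTerm, map_smul, map_mul, map_pow, eval_monomial,
    NormedSpace.map_exp (eval ω ξ) continuous_eval, ← Complex.exp_eq_exp_ℂ, smul_eq_mul,
    Frequency.phase_apply]
  rw [mul_add, Complex.exp_add]
  ring

lemma isSelfAdjoint_subst (ha : a.IsReal) (hu : IsSelfAdjoint u) (hw : IsSelfAdjoint w) :
    IsSelfAdjoint (subst ω a u w) := by
  rw [isSelfAdjoint_iff, subst, tsum_star,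
    ← (Equiv.prodCongr (Equiv.neg G) (Equiv.refl ℕ)).tsum_eq (substTerm ω a u w)]
  refine tsum_congr fun ⟨l, k⟩ => ?_
  simp [substTerm, hu.star_eq, hw.star_eq, NormedSpace.star_exp, ha l k]

lemma translate_subst (ha : a.HasBound R s d) (h : InPolydisc R s 0 u w) (t : ℝ) :
    translate ω t (subst ω a u w) =
      subst ω a (translate ω t u + (t : ℂ) • 1) (translate ω t w) := by
  have termwise := (hasSum_subst (ω := ω) ha h).map (translate ω t) continuous_translate
  rw [← termwise.tsum_eq, subst]
  refine tsum_congr fun j => ?_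
  have exp_smul_one : NormedSpace.exp ((I * ω j.1) • (t : ℂ) • (1 : WienerAlgebra G r)) =
      ω.phase t j.1 • 1 := by
    rw [smul_smul, ← Algebra.algebraMap_eq_smul_one, ← Algebra.algebraMap_eq_smul_one,
      Frequency.phase_apply, Complex.exp_eq_exp_ℂ]
    exact (NormedSpace.algebraMap_exp_comm (𝕂 := ℂ) (𝔸 := WienerAlgebra G r) _).symm
  simp only [Function.comp, substTerm, map_smul, map_mul, translate_monomial, map_pow,
    NormedSpace.map_exp (translate ω t) continuous_translate, smul_add,
    NormedSpace.exp_add, exp_smul_one, smul_mul_assoc,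
    mul_smul_comm, mul_one]

/-- The derivative of `Germ.substTerm` at `(u, w)` in the direction `(u', w')`. -/
def substTermDeriv (ω : Frequency G) (a : Germ G) (u w u' w' : WienerAlgebra G r) (j : G × ℕ) :
    WienerAlgebra G r :=
  a j • (.monomial r j.1 * (NormedSpace.exp ((I * ω j.1) • u) * ((I * ω j.1) • u')) * w ^ j.2 +
    .monomial r j.1 * NormedSpace.exp ((I * ω j.1) • u) * (j.2 * w ^ (j.2 - 1) * w'))

lemma hasDerivAt_substTerm (u w u' w' : WienerAlgebra G r) (j : G × ℕ) (t : ℂ) :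
    HasDerivAt (fun t : ℂ => substTerm ω a (u + t • u') (w + t • w') j)
      (substTermDeriv ω a (u + t • u') (w + t • w') u' w' j) t := by
  have line (x y : WienerAlgebra G r) : HasDerivAt (fun t : ℂ => x + t • y) y t := by
    simpa using ((hasDerivAt_id t).smul_const y).const_add x
  have exp_line := (hasFDerivAt_exp (𝕂 := ℂ) (x := (I * ω j.1) • (u + t • u'))).comp_hasDerivAt t
    ((line u u').const_smul (I * ω j.1 : ℂ))
  refine (((HasDerivAt.congr_deriv exp_line ?_).const_mul (monomial r j.1)).mul
    ((line w w').pow j.2)).const_smul (a j)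
  simp

lemma hasSum_subst_dy (ha : a.HasBound R s d) (hη : 0 < η) (h : InPolydisc R s η u w) :
    HasSum (fun j : G × ℕ => a j • (monomial r j.1 * NormedSpace.exp ((I * ω j.1) • u) *
      (j.2 * w ^ (j.2 - 1)))) (subst ω a.dy u w) := by
  have dy_bound := ha.dy (norm_nonneg w) hη h.norm_add_le
  rw [← injective_prodMap_id_succ.hasSum_iff]
  · refine (hasSum_subst dy_bound ⟨by linarith [h.add_norm_le], by simp⟩).congr_fun
      fun ⟨l, k⟩ => ?_
    simp [substTerm, dy, ← map_natCast (algebraMap ℂ (WienerAlgebra G r)),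
      Algebra.algebraMap_eq_smul_one, smul_smul, mul_comm (a _), -map_natCast]
  · rintro ⟨l, _ | k⟩ hk
    · simp
    · exact absurd ⟨(l, k), rfl⟩ hk

lemma hasSum_fderivSubst (ha : a.HasBound R s d) (hη : 0 < η) (h : InPolydisc R s η u w) :
    HasSum (substTermDeriv ω a u w u' w') (fderivSubst ω a u w (u', w')) := by
  have dx_bound : (a.dx ω).HasBound (r + ‖u‖₊) s (η⁻¹ * d) :=
    ha.dx (h.mono hη.le).nonneg hη (by simpa using h.add_norm_le)
  have sum_dx := hasSum_subst (ω := ω) (u := u) (w := w) dx_bound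
    ⟨by simp, by linarith [h.norm_add_le]⟩
  refine ((sum_dx.mul_right u').add ((hasSum_subst_dy ha hη h).mul_right w')).congr_fun fun j => ?_
  simp only [substTermDeriv, substTerm, dx, smul_add, mul_smul_comm, smul_mul_assoc, smul_smul]
  congr 1
  · congr 1 <;> ring
  · congr 1; ring

section Line

variable (ha : a.HasBound R s d) (h : InPolydisc R s η u w) (hν : 0 < ν) (hu' : ‖u'‖ ≤ ν)
  (hw' : ‖w'‖ ≤ ν)
include ha h hν hu' hw'

lemma differentiableOn_subst_line :
    DifferentiableOn ℂ (fun t : ℂ => subst ω a (u + t • u') (w + t • w')) (Metric.ball 0 (η / ν)) :=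
  Complex.differentiableOn_tsum_of_summable_norm ha.summable
    (fun j t _ => (hasDerivAt_substTerm u w u' w' j t).differentiableAt.differentiableWithinAt)
    Metric.isOpen_ball fun j _ ht => norm_substTerm_le (h.add_smul hν hu' hw' ht) j

lemma deriv_subst_line (hη : 0 < η) :
    deriv (fun t : ℂ => subst ω a (u + t • u') (w + t • w')) 0 =
      fderivSubst ω a u w (u', w') := by
  have termwise := Complex.hasSum_deriv_of_summable_norm ha.summable
    (fun j t _ => (hasDerivAt_substTerm u w u' w' j t).differentiableAt.differentiableWithinAt)
    Metric.isOpen_ball (fun j _ ht => norm_substTerm_le (ω := ω) (h.add_smul hν hu' hw' ht) j)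
    (Metric.mem_ball_self (div_pos hη hν))
  refine termwise.unique ((hasSum_fderivSubst ha hη h).congr_fun fun j => ?_)
  simp [(hasDerivAt_substTerm u w u' w' j 0).deriv]

lemma norm_subst_add_sub_le (hνη : ν < η) :
    ‖subst ω a (u + u') (w + w') - subst ω a u w‖ ≤ 2 * d * ν / η := by
  have lipschitz := norm_sub_le_of_norm_le_on_ball ((one_lt_div hν).2 hνη)
    (differentiableOn_subst_line (ω := ω) ha h hν hu' hw')
    fun _ ht => norm_subst_le ha (h.add_smul hν hu' hw' ht)
  simpa [div_div_eq_mul_div] using lipschitz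

lemma norm_subst_add_sub_sub_fderiv_le (hνη : ν < η) :
    ‖subst ω a (u + u') (w + w') - subst ω a u w - fderivSubst ω a u w (u', w')‖ ≤
      4 * d * ν ^ 2 / η ^ 2 := by
  have taylor := norm_sub_sub_deriv_le_of_norm_le_on_ball ((one_lt_div hν).2 hνη)
    (differentiableOn_subst_line (ω := ω) ha h hν hu' hw')
    fun _ ht => norm_subst_le ha (h.add_smul hν hu' hw' ht)
  rw [deriv_subst_line ha h hν hu' hw' (hν.trans hνη)] at taylor
  simpa [div_pow, div_div_eq_mul_div] using taylor

end Line

lemma hasFDerivAt_subst (ha : a.HasBound R s d) (hη : 0 < η) (h : InPolydisc R s η u w) :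
    HasFDerivAt (fun p : WienerAlgebra G r × WienerAlgebra G r => subst ω a p.1 p.2)
      (fderivSubst ω a u w) (u, w) := by
  rw [hasFDerivAt_iff_isLittleO_nhds_zero]
  refine Asymptotics.IsBigO.trans_isLittleO
    (g := fun p : WienerAlgebra G r × WienerAlgebra G r => ‖p‖ ^ 2) ?_ ?_
  · refine .of_bound (4 * d / η ^ 2) ?_
    filter_upwards [Metric.ball_mem_nhds 0 hη] with p hp
    rw [mem_ball_zero_iff] at hp
    rcases eq_or_ne p 0 with rfl | hp0
    · simp
    · refine (norm_subst_add_sub_sub_fderiv_le ha h (norm_pos_iff.2 hp0) (norm_fst_le p)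
        (norm_snd_le p) hp).trans_eq ?_
      simp only [norm_pow, norm_norm]
      ring
  · simpa using Asymptotics.isLittleO_norm_pow_id one_lt_two

end Germ

namespace WienerAlgebra

variable {G : Type*} [SeminormedAddCommGroup G] {r r' : ℝ≥0}

/-- The function `du` is the derivative of `u`. It is a relation because the derivative exists only
on narrower strips. -/
def IsDeriv (ω : Frequency G) (u : WienerAlgebra G r) (du : WienerAlgebra G r') : Prop :=
  ∀ l, du l = I * ω l * u l

variable {ω : Frequency G} {u v w : WienerAlgebra G r} {du dv dw : WienerAlgebra G r'} {ρ : ℝ}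

namespace IsDeriv

lemma add (hu : IsDeriv ω u du) (hv : IsDeriv ω v dv) : IsDeriv ω (u + v) (du + dv) := fun l => by
  simp [hu l, hv l]
  ring

lemma sub (hu : IsDeriv ω u du) (hv : IsDeriv ω v dv) : IsDeriv ω (u - v) (du - dv) := fun l => by
  simp [hu l, hv l]
  ring

lemma translate (hu : IsDeriv ω u du) (t : ℝ) :
    IsDeriv ω (u.translate ω t) (du.translate ω t) := fun l => by
  simp [hu l]
  ring

lemma isSelfAdjoint (hu : IsDeriv ω u du) (h : IsSelfAdjoint u) : IsSelfAdjoint du :=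
  ext fun l => by simp [hu l, hu (-l), conj_apply_neg h l]

lemma restrict {r'' : ℝ≥0} (hu : IsDeriv ω u du) (h : r'' ≤ r') :
    IsDeriv ω u (du.restrict h) := fun l => by simp [hu l]

lemma norm_le (hρ : 0 < ρ) (hr : r' + ρ ≤ r) (hu : IsDeriv ω u du) : ‖du‖ ≤ ρ⁻¹ * ‖u‖ := by
  have hm (l : G) : ‖I * ω l‖ * expWeight r' l ≤ ρ⁻¹ * expWeight r l := by
    simpa using ω.abs_mul_expWeight_le hρ hr l
  have du_eq : du = diagonal (fun l => I * ω l) ρ⁻¹ hm u :=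
    ext fun l => (hu l).trans (diagonal_apply hm u l).symm
  exact du_eq ▸ norm_diagonal_le hm u

end IsDeriv

lemma exists_isDeriv (hρ : 0 < ρ) (hr : r' + ρ ≤ r) (u : WienerAlgebra G r) :
    ∃ du : WienerAlgebra G r', IsDeriv ω u du := by
  have hm (l : G) : ‖I * ω l‖ * expWeight r' l ≤ ρ⁻¹ * expWeight r l := by
    simpa using ω.abs_mul_expWeight_le hρ hr l
  exact ⟨diagonal (fun l => I * ω l) ρ⁻¹ hm u, diagonal_apply hm u⟩

lemma hasDerivAt_phase (l : G) (t : ℝ) :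
    HasDerivAt (fun t : ℝ => ω.phase t l) (I * ω l * ω.phase t l) t := by
  have := (((hasDerivAt_id t).ofReal_comp).const_mul (I * ω l)).cexp
  simpa [Frequency.phase_apply, mul_comm] using this

lemma hasDerivAt_restrict_translate (hρ : 0 < ρ) (hr : r' + ρ ≤ r) (hle : r' ≤ r)
    (hu : IsDeriv ω u du) :
    HasDerivAt (fun t : ℝ => restrict hle (translate ω t u)) du 0 := by
  have term_deriv (l : G) (t : ℝ) : HasDerivAt (fun t : ℝ => (ω.phase t l * u l) • monomial r' l)
      ((I * ω l * ω.phase t l * u l) • monomial r' l) t :=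
    ((hasDerivAt_phase l t).mul_const (u l)).smul_const (monomial r' l)
  have term_bound (l : G) (t : ℝ) : ‖(I * ω l * ω.phase t l * u l) • monomial r' l‖ ≤
      ρ⁻¹ * (‖u l‖ * expWeight r l) := by
    have := mul_le_mul_of_nonneg_left (ω.abs_mul_expWeight_le hρ hr l) (norm_nonneg (u l))
    simp only [norm_smul, norm_mul, Complex.norm_I, Complex.norm_real, Real.norm_eq_abs,
      Frequency.norm_phase, norm_monomial]
    linarith
  have expansion (t : ℝ) : HasSum (fun l => (ω.phase t l * u l) • monomial r' l)
      (restrict hle (translate ω t u)) := by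
    simpa using hasSum_monomial (restrict hle (translate ω t u))
  have deriv_expansion : HasSum (fun l => (I * ω l * ω.phase 0 l * u l) • monomial r' l) du :=
    (hasSum_monomial du).congr_fun fun l => by simp [hu l]
  have key := hasDerivAt_tsum (u.summable.mul_left ρ⁻¹) term_deriv term_bound
    (expansion 0).summable 0
  rwa [funext fun t => (expansion t).tsum_eq, deriv_expansion.tsum_eq] at key

end WienerAlgebra

namespace Germ

open WienerAlgebra

variable {G : Type*} [SeminormedAddCommGroup G] {r r' : ℝ≥0} {ω : Frequency G} {a : Germ G}
  {u w : WienerAlgebra G r} {du dw : WienerAlgebra G r'} {R : ℝ≥0} {s d η ρ : ℝ}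

/-- The chain rule, obtained by differentiating the translates of both sides at time `0`. -/
lemma isDeriv_subst (ha : a.HasBound R s d) (hη : 0 < η) (h : InPolydisc R s η u w) (hρ : 0 < ρ)
    (hr : r' + ρ ≤ r) (hle : r' ≤ r) (hdu : IsDeriv ω u du) (hdw : IsDeriv ω w dw) :
    IsDeriv ω (subst ω a u w) (fderivSubst ω a (restrict hle u) (restrict hle w) (1 + du, dw)) := by
  obtain ⟨dF, hdF⟩ := exists_isDeriv (ω := ω) hρ hr (subst ω a u w)
  have deriv_id : HasDerivAt (fun t : ℝ => (t : ℂ) • (1 : WienerAlgebra G r')) 1 0 := by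
    simpa using (hasDerivAt_id (0 : ℝ)).smul_const (1 : WienerAlgebra G r')
  have deriv_args := (deriv_id.add (hasDerivAt_restrict_translate hρ hr hle hdu)).prodMk
    (hasDerivAt_restrict_translate hρ hr hle hdw)
  have chain := ((hasFDerivAt_subst (ω := ω) ha hη (h.restrict hle)).restrictScalars
    ℝ).comp_hasDerivAt_of_eq (0 : ℝ) deriv_args (by simp)
  have translates : (fun p : WienerAlgebra G r' × WienerAlgebra G r' => subst ω a p.1 p.2) ∘
      (fun t : ℝ => ((t : ℂ) • 1 + restrict hle (translate ω t u), restrict hle (translate ω t w)))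
      = fun t => restrict hle (translate ω t (subst ω a u w)) := funext fun t => by
    have h0 := h.mono hη.le
    simp only [Function.comp, restrict_translate, restrict_subst ha h0,
      translate_subst ha (h0.restrict hle), add_comm]
  have deriv_eq : dF = fderivSubst ω a (restrict hle u) (restrict hle w) (1 + du, dw) :=
    (hasDerivAt_restrict_translate hρ hr hle hdF).unique (translates ▸ chain)
  exact deriv_eq ▸ hdF

end Germ

section SmallDivisors

/-- The divisors `κ - e ^ (i (ω, l) α)` with `1 / 4 ≤ κ` cost at most the factor `Λ` on strips whose
widths differ by `ρ`. The case `κ = 1` is the usual cohomological equation; the other values occur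
for the linearised map when `κ` is not normalised. -/
def SmallDivisors {G : Type*} [SeminormedAddCommGroup G] (ω : Frequency G) (α ρ Λ : ℝ) : Prop :=
  ∀ κ : ℝ, 1 / 4 ≤ κ → ∀ l ≠ 0, 1 ≤ Λ * Real.exp (ρ * ‖l‖) * ‖(κ : ℂ) - ω.phase α l‖

lemma le_norm_exp_mul_I_sub_one {θ δ : ℝ} (h : ∀ n : ℤ, δ ≤ |θ / (2 * Real.pi) - n|) :
    4 * δ ≤ ‖Complex.exp (I * θ) - 1‖ := by
  have hpi := Real.pi_pos
  set n := round (θ / (2 * Real.pi))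
  set y := θ / (2 * Real.pi) - n with hy
  have abs_y_le : |y| ≤ 1 / 2 := abs_sub_round _
  have exp_eq : Complex.exp (I * θ) = Complex.exp (I * (2 * Real.pi * y : ℝ)) := by
    rw [Complex.exp_eq_exp_iff_exists_int]
    refine ⟨n, ?_⟩
    have hθ : θ = 2 * Real.pi * y + n * (2 * Real.pi) := by rw [hy]; field_simp; ring
    rw [hθ]
    push_cast
    ring
  have jordan := Real.mul_abs_le_abs_sin (x := Real.pi * y) (by
    rw [abs_mul, abs_of_pos hpi]
    nlinarith)
  have cancel_pi : 2 / Real.pi * (Real.pi * |y|) = 2 * |y| := by field_simp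
  rw [abs_mul, abs_of_pos hpi, cancel_pi] at jordan
  have half_angle : 2 * Real.pi * y / 2 = Real.pi * y := by ring
  rw [exp_eq, Complex.norm_exp_I_mul_ofReal_sub_one, half_angle, norm_mul, Real.norm_eq_abs,
    Real.norm_eq_abs, abs_two]
  linarith [h n]

lemma norm_exp_mul_I_sub_one_le {κ θ : ℝ} (hκ : 1 / 4 ≤ κ) :
    ‖Complex.exp (I * θ) - 1‖ ≤ 2 * ‖(κ : ℂ) - Complex.exp (I * θ)‖ := by
  refine (sq_le_sq₀ (norm_nonneg _) (by positivity)).1 ?_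
  rw [mul_pow, Complex.sq_norm, Complex.sq_norm, mul_comm I, Complex.exp_mul_I,
    ← Complex.ofReal_cos, ← Complex.ofReal_sin]
  simp only [Complex.normSq_apply, Complex.sub_re, Complex.add_re, Complex.mul_re, Complex.I_re,
    Complex.I_im, Complex.ofReal_re, Complex.ofReal_im, Complex.one_re, Complex.one_im,
    Complex.sub_im, Complex.add_im, Complex.mul_im]
  nlinarith [Real.sin_sq_add_cos_sq θ, sq_nonneg (κ - 1), Real.cos_le_one θ]

namespace SmallDivisors

variable {G : Type*} [SeminormedAddCommGroup G] {r r' : ℝ≥0} {ω : Frequency G} {α ρ Λ κ : ℝ}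

lemma norm_pos (h : SmallDivisors ω α ρ Λ) (hκ : 1 / 4 ≤ κ) {l : G} (hl : l ≠ 0) :
    0 < ‖(κ : ℂ) - ω.phase α l‖ := by
  refine (norm_nonneg _).lt_of_ne' fun h0 => ?_
  linarith [(h κ hκ l hl).trans_eq (by rw [h0, mul_zero])]

open Classical in
/-- The Fourier multiplier inverting `y ↦ κ y - y (· + α)` on functions of mean value zero. -/
def multiplier (ω : Frequency G) (α κ : ℝ) (l : G) : ℂ :=
  if l = 0 then 0 else ((κ : ℂ) - ω.phase α l)⁻¹

lemma multiplier_zero : multiplier ω α κ 0 = 0 := if_pos rfl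

lemma multiplier_of_ne {l : G} (hl : l ≠ 0) : multiplier ω α κ l = ((κ : ℂ) - ω.phase α l)⁻¹ :=
  if_neg hl

lemma conj_multiplier_neg (l : G) : conj (multiplier ω α κ (-l)) = multiplier ω α κ l := by
  rcases eq_or_ne l 0 with rfl | hl
  · simp [multiplier_zero]
  · rw [multiplier_of_ne hl, multiplier_of_ne (neg_ne_zero.2 hl)]
    simp [Frequency.phase_apply, ← Complex.exp_conj]

lemma norm_multiplier_mul_le (h : SmallDivisors ω α ρ Λ) (hΛ : 0 ≤ Λ) (hr : r' + ρ ≤ r)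
    (hκ : 1 / 4 ≤ κ) (l : G) :
    ‖multiplier ω α κ l‖ * expWeight r' l ≤ Λ * expWeight r l := by
  have hw := expWeight_pos r l
  have hw' := expWeight_pos r' l
  rcases eq_or_ne l 0 with rfl | hl
  · rw [multiplier_zero, norm_zero, zero_mul]
    positivity
  · rw [multiplier_of_ne hl, norm_inv]
    calc ‖(κ : ℂ) - ω.phase α l‖⁻¹ * expWeight r' l
        ≤ Λ * Real.exp (ρ * ‖l‖) * expWeight r' l := by
          gcongr
          exact (inv_le_iff_one_le_mul₀ (h.norm_pos hκ hl)).2 (h κ hκ l hl)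
      _ = Λ * (Real.exp (ρ * ‖l‖) * expWeight r' l) := mul_assoc _ _ _
      _ ≤ Λ * expWeight r l := by
          gcongr
          exact mul_expWeight_le hr le_rfl

open WienerAlgebra in
lemma exists_smul_sub_translate_eq (h : SmallDivisors ω α ρ Λ) (hΛ : 0 ≤ Λ) (hr : r' + ρ ≤ r)
    (hle : r' ≤ r) (hκ : 1 / 4 ≤ κ) {x : WienerAlgebra G r} (hx : IsSelfAdjoint x) :
    ∃ y : WienerAlgebra G r', IsSelfAdjoint y ∧ y 0 = 0 ∧ ‖y‖ ≤ Λ * ‖x‖ ∧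
      (κ : ℂ) • y - translate ω α y = restrict hle x - x 0 • 1 := by
  classical
  have bound := h.norm_multiplier_mul_le hΛ hr hκ
  refine ⟨diagonal _ Λ bound x, ?_, ?_, norm_diagonal_le bound x, ?_⟩
  · refine ext fun l => ?_
    rw [star_apply, diagonal_apply, diagonal_apply, map_mul, conj_multiplier_neg,
      conj_apply_neg hx]
  · rw [diagonal_apply, multiplier_zero, zero_mul]
  · refine ext fun l => ?_
    simp only [WienerAlgebra.sub_apply, WienerAlgebra.smul_apply, WienerAlgebra.translate_apply,
      diagonal_apply, restrict_apply, one_apply]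
    rcases eq_or_ne l 0 with rfl | hl
    · simp [multiplier_zero]
    · have divisor_ne := norm_pos_iff.1 (h.norm_pos hκ hl)
      rw [multiplier_of_ne hl, if_neg hl]
      field_simp
      ring

end SmallDivisors

end SmallDivisors

/-! ### The conjugacy equations along a curve -/

section SmallGerm

variable {G : Type*} [SeminormedAddCommGroup G] {r r' : ℝ≥0} {ω : Frequency G} {a : Germ G}
  {u w u' w' : WienerAlgebra G r} {R : ℝ≥0} {d η ν ρ : ℝ}

namespace Germ

open WienerAlgebra

/-- The germ has weighted norm at most `d` on a polydisc on which the substitution of `(x + u, w)`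
is defined with margin `η`. -/
def HasBoundNear (a : Germ G) (η d : ℝ) (u w : WienerAlgebra G r) : Prop :=
  ∃ (R : ℝ≥0) (s : ℝ), a.HasBound R s d ∧ InPolydisc R s η u w

namespace HasBoundNear

variable (ha : a.HasBoundNear η d u w)
include ha

lemma norm_subst_le (hη : 0 ≤ η) : ‖subst ω a u w‖ ≤ d :=
  let ⟨_, _, hb, h⟩ := ha
  Germ.norm_subst_le hb (h.mono hη)

lemma restrict_subst (hη : 0 ≤ η) (hr : r' ≤ r) :
    restrict hr (subst ω a u w) = subst ω a (restrict hr u) (restrict hr w) :=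
  let ⟨_, _, hb, h⟩ := ha
  Germ.restrict_subst hb (h.mono hη) hr

lemma norm_subst_add_sub_le (hν : 0 < ν) (hu' : ‖u'‖ ≤ ν) (hw' : ‖w'‖ ≤ ν) (hνη : ν < η) :
    ‖subst ω a (u + u') (w + w') - subst ω a u w‖ ≤ 2 * d * ν / η :=
  let ⟨_, _, hb, h⟩ := ha
  Germ.norm_subst_add_sub_le hb h hν hu' hw' hνη

end HasBoundNear

/-- The remainder of the first-order Taylor expansion of the substitution. -/
def taylorRemainder (ω : Frequency G) (a : Germ G) (u w u' w' : WienerAlgebra G r) :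
    WienerAlgebra G r :=
  subst ω a (u + u') (w + w') - subst ω a u w - fderivSubst ω a u w (u', w')

/-- A germ that is real and small relative to the size `η` of the domain on which the Newton
iteration takes place. -/
structure IsSmall (a : Germ G) (R : ℝ≥0) (η : ℝ) : Prop where
  pos : 0 < η
  le_one : η ≤ 1
  isReal : a.IsReal
  bound : a.HasBound R (3 * η) (η ^ 2 / 1600)

end Germ

/-- The domain of the Newton iteration. -/
structure InDomain (R : ℝ≥0) (η : ℝ) (u w : WienerAlgebra G r) : Prop where
  add_le : r + 3 * η ≤ R
  norm_left_le : ‖u‖ ≤ η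
  norm_right_le : ‖w‖ ≤ η

namespace Germ.IsSmall

open WienerAlgebra

lemma hasBoundNear (ha : a.IsSmall R η) (h : InDomain R η u w) :
    a.HasBoundNear η (η ^ 2 / 1600) u w :=
  ⟨R, 3 * η, ha.bound, by linarith [h.add_le, h.norm_left_le, ha.pos],
    by linarith [h.norm_right_le, ha.pos]⟩

lemma dx_hasBoundNear (ha : a.IsSmall R η) (h : InDomain R η u w) :
    (a.dx ω).HasBoundNear η (η / 1600) u w := by
  have hη := ha.pos
  have key : (a.dx ω).HasBound (r + ‖u‖₊ + η.toNNReal) (3 * η) (η⁻¹ * (η ^ 2 / 1600)) := by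
    refine ha.bound.dx (by positivity) hη ?_
    push_cast [Real.coe_toNNReal η hη.le]
    linarith [h.add_le, h.norm_left_le]
  rw [show η⁻¹ * (η ^ 2 / 1600) = η / 1600 by field_simp] at key
  exact ⟨_, _, key, by simp [hη.le], by linarith [h.norm_right_le]⟩

lemma dy_hasBoundNear (ha : a.IsSmall R η) (h : InDomain R η u w) :
    a.dy.HasBoundNear η (η / 1600) u w := by
  have hη := ha.pos
  have key : a.dy.HasBound R (2 * η) (η⁻¹ * (η ^ 2 / 1600)) :=
    ha.bound.dy (by positivity) hη (by linarith)
  rw [show η⁻¹ * (η ^ 2 / 1600) = η / 1600 by field_simp] at key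
  exact ⟨_, _, key, by linarith [h.add_le, h.norm_left_le], by linarith [h.norm_right_le]⟩

lemma norm_subst_dx_le (ha : a.IsSmall R η) (h : InDomain R η u w) :
    ‖subst ω (a.dx ω) u w‖ ≤ 1 / 100 :=
  ((ha.dx_hasBoundNear h).norm_subst_le ha.pos.le).trans (by linarith [ha.le_one])

lemma norm_subst_dy_le (ha : a.IsSmall R η) (h : InDomain R η u w) :
    ‖subst ω a.dy u w‖ ≤ 1 / 100 :=
  ((ha.dy_hasBoundNear h).norm_subst_le ha.pos.le).trans (by linarith [ha.le_one])

section Increment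

variable (ha : a.IsSmall R η) (h : InDomain R η u w) (hν : 0 < ν) (hu' : ‖u'‖ ≤ ν) (hw' : ‖w'‖ ≤ ν)
  (hνη : ν < η)
include ha h hν hu' hw' hνη

lemma norm_taylorRemainder_le : ‖taylorRemainder ω a u w u' w'‖ ≤ ν ^ 2 := by
  obtain ⟨_, _, hb, h⟩ := ha.hasBoundNear h
  have hη := ha.pos
  refine (Germ.norm_subst_add_sub_sub_fderiv_le hb h hν hu' hw' hνη).trans ?_
  rw [show 4 * (η ^ 2 / 1600) * ν ^ 2 / η ^ 2 = ν ^ 2 / 400 by field_simp; norm_num]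
  linarith [sq_nonneg ν]

lemma norm_subst_dx_add_sub_le :
    ‖subst ω (a.dx ω) (u + u') (w + w') - subst ω (a.dx ω) u w‖ ≤ ν := by
  have hη := ha.pos
  refine ((ha.dx_hasBoundNear h).norm_subst_add_sub_le hν hu' hw' hνη).trans ?_
  rw [show 2 * (η / 1600) * ν / η = ν / 800 by field_simp; norm_num]
  linarith

lemma norm_subst_dy_add_sub_le :
    ‖subst ω a.dy (u + u') (w + w') - subst ω a.dy u w‖ ≤ ν := by
  have hη := ha.pos
  refine ((ha.dy_hasBoundNear h).norm_subst_add_sub_le hν hu' hw' hνη).trans ?_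
  rw [show 2 * (η / 1600) * ν / η = ν / 800 by field_simp; norm_num]
  linarith

end Increment

end Germ.IsSmall

lemma InDomain.restrict (h : InDomain R η u w) (hr : r' ≤ r) :
    InDomain R η (u.restrict hr) (w.restrict hr) :=
  ⟨by linarith [h.add_le, NNReal.coe_le_coe.2 hr],
    WienerAlgebra.norm_restrict_le_of_le hr h.norm_left_le,
    WienerAlgebra.norm_restrict_le_of_le hr h.norm_right_le⟩

end SmallGerm

section Errors

open WienerAlgebra Germ

variable {G : Type*} [SeminormedAddCommGroup G] {r r' : ℝ≥0}

/-- The first component of the error in the equation saying that the curve `(ξ + u ξ, w ξ)` is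
invariant and carries the rotation by `α`; the second coordinate is measured from `α`. -/
def conjugacyErr₁ (ω : Frequency G) (α : ℝ) (a : Germ G) (u w : WienerAlgebra G r) :
    WienerAlgebra G r :=
  u + w + subst ω a u w - translate ω α u

/-- The second component of the error of which `conjugacyErr₁` is the first. -/
def conjugacyErr₂ (ω : Frequency G) (α : ℝ) (b : Germ G) (u w : WienerAlgebra G r) :
    WienerAlgebra G r :=
  w + subst ω b u w - translate ω α w

/-- The Jacobian determinant of the map along the curve `(ξ + u ξ, w ξ)`. -/
def jacobian (ω : Frequency G) (a b : Germ G) (u w : WienerAlgebra G r) : WienerAlgebra G r :=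
  (1 + subst ω (a.dx ω) u w) * (1 + subst ω b.dy u w) -
    (1 + subst ω a.dy u w) * subst ω (b.dx ω) u w

/-- The error in the reduction of the normal dynamics along the curve `(ξ + u ξ, w ξ)` to the
constant multiplier `κ` by the factor `q`. -/
def normalErr (ω : Frequency G) (α : ℝ) (a b : Germ G) (u w q : WienerAlgebra G r) (κ : ℝ) :
    WienerAlgebra G r :=
  jacobian ω a b u w * q - (κ : ℂ) • translate ω α q

/-- The derivative of `conjugacyErr₁`, for `U` and `W` the derivatives of `ξ + u ξ` and `w ξ`. -/
def tangentErr₁ (ω : Frequency G) (α : ℝ) (a : Germ G) (u w U W : WienerAlgebra G r) :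
    WienerAlgebra G r :=
  (1 + subst ω (a.dx ω) u w) * U + (1 + subst ω a.dy u w) * W - translate ω α U

/-- The derivative of `conjugacyErr₂`, for `U` and `W` the derivatives of `ξ + u ξ` and `w ξ`. -/
def tangentErr₂ (ω : Frequency G) (α : ℝ) (b : Germ G) (u w U W : WienerAlgebra G r) :
    WienerAlgebra G r :=
  subst ω (b.dx ω) u w * U + (1 + subst ω b.dy u w) * W - translate ω α W

variable {ω : Frequency G} {α : ℝ} {a b : Germ G} {u w u' w' q U W : WienerAlgebra G r} {κ : ℝ}
  {R : ℝ≥0} {η ν ρ : ℝ}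

section SelfAdjoint

variable (hu : IsSelfAdjoint u) (hw : IsSelfAdjoint w)
include hu hw

lemma isSelfAdjoint_conjugacyErr₁ (ha : a.IsReal) : IsSelfAdjoint (conjugacyErr₁ ω α a u w) :=
  ((hu.add hw).add (isSelfAdjoint_subst ha hu hw)).sub (hu.map _)

lemma isSelfAdjoint_conjugacyErr₂ (hb : b.IsReal) : IsSelfAdjoint (conjugacyErr₂ ω α b u w) :=
  (hw.add (isSelfAdjoint_subst hb hu hw)).sub (hw.map _)

lemma isSelfAdjoint_jacobian (ha : a.IsReal) (hb : b.IsReal) :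
    IsSelfAdjoint (jacobian ω a b u w) := by
  have subst_real {c : Germ G} (hc : c.IsReal) : IsSelfAdjoint (subst ω c u w) :=
    isSelfAdjoint_subst hc hu hw
  exact (((IsSelfAdjoint.one _).add (subst_real ha.dx)).mul
    ((IsSelfAdjoint.one _).add (subst_real hb.dy))).sub
    (((IsSelfAdjoint.one _).add (subst_real ha.dy)).mul (subst_real hb.dx))

end SelfAdjoint

section Restrict

variable (h : InDomain R η u w) (hr : r' ≤ r)
include h

lemma restrict_conjugacyErr₁ (ha : a.IsSmall R η) : restrict hr (conjugacyErr₁ ω α a u w) =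
    conjugacyErr₁ ω α a (restrict hr u) (restrict hr w) := by
  simp only [conjugacyErr₁, map_add, map_sub, (ha.hasBoundNear h).restrict_subst ha.pos.le,
    restrict_translate]

lemma restrict_conjugacyErr₂ (hb : b.IsSmall R η) : restrict hr (conjugacyErr₂ ω α b u w) =
    conjugacyErr₂ ω α b (restrict hr u) (restrict hr w) := by
  simp only [conjugacyErr₂, map_add, map_sub, (hb.hasBoundNear h).restrict_subst hb.pos.le,
    restrict_translate]

lemma restrict_normalErr (ha : a.IsSmall R η) (hb : b.IsSmall R η) :
    restrict hr (normalErr ω α a b u w q κ) =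
      normalErr ω α a b (restrict hr u) (restrict hr w) (restrict hr q) κ := by
  simp only [normalErr, jacobian, map_add, map_sub, map_mul, map_one, map_smul, restrict_translate,
    (ha.dx_hasBoundNear h).restrict_subst ha.pos.le,
    (ha.dy_hasBoundNear h).restrict_subst ha.pos.le,
    (hb.dx_hasBoundNear h).restrict_subst ha.pos.le,
    (hb.dy_hasBoundNear h).restrict_subst ha.pos.le]

end Restrict

section Tangent

variable (hρ : 0 < ρ) (hr : r' + ρ ≤ r) (hle : r' ≤ r) (h : InDomain R η u w)
  (hU : IsDeriv ω u (U - 1)) (hW : IsDeriv ω w W)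
include hρ hr h hU hW

lemma isDeriv_subst_tangent (ha : a.IsSmall R η) : IsDeriv ω (subst ω a u w) (fderivSubst ω a
    (restrict hle u) (restrict hle w) (restrict hle U, restrict hle W)) := by
  obtain ⟨_, _, hb, h⟩ := ha.hasBoundNear h
  simpa using isDeriv_subst hb ha.pos h hρ hr hle (hU.restrict hle) (hW.restrict hle)

lemma isDeriv_conjugacyErr₁ (ha : a.IsSmall R η) :
    IsDeriv ω (conjugacyErr₁ ω α a u w) (tangentErr₁ ω α a (restrict hle u) (restrict hle w)
      (restrict hle U) (restrict hle W)) := by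
  have key := (((hU.restrict hle).add (hW.restrict hle)).add
    (isDeriv_subst_tangent hρ hr hle h hU hW ha)).sub ((hU.restrict hle).translate α)
  convert key using 1
  · rw [conjugacyErr₁]
  · simp only [tangentErr₁, fderivSubst_apply, map_sub, map_one]
    ring

lemma isDeriv_conjugacyErr₂ (hb : b.IsSmall R η) :
    IsDeriv ω (conjugacyErr₂ ω α b u w) (tangentErr₂ ω α b (restrict hle u) (restrict hle w)
      (restrict hle U) (restrict hle W)) := by
  have key := ((hW.restrict hle).add (isDeriv_subst_tangent hρ hr hle h hU hW hb)).sub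
    ((hW.restrict hle).translate α)
  convert key using 1
  · rw [conjugacyErr₂]
  · simp only [tangentErr₂, fderivSubst_apply]
    ring

lemma norm_tangentErr₁_le (ha : a.IsSmall R η) :
    ‖tangentErr₁ ω α a (restrict hle u) (restrict hle w) (restrict hle U) (restrict hle W)‖ ≤
      ρ⁻¹ * ‖conjugacyErr₁ ω α a u w‖ :=
  (isDeriv_conjugacyErr₁ hρ hr hle h hU hW ha).norm_le hρ hr

lemma norm_tangentErr₂_le (hb : b.IsSmall R η) :
    ‖tangentErr₂ ω α b (restrict hle u) (restrict hle w) (restrict hle U) (restrict hle W)‖ ≤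
      ρ⁻¹ * ‖conjugacyErr₂ ω α b u w‖ :=
  (isDeriv_conjugacyErr₂ hρ hr hle h hU hW hb).norm_le hρ hr

end Tangent

end Errors

section JacobianIncrement

variable {A : Type*} [NormedCommRing A] {x x' y y' : A} {C D ν : ℝ}

lemma norm_mul_sub_mul_le (hx : ‖x' - x‖ ≤ ν) (hy : ‖y' - y‖ ≤ ν) (hxn : ‖x‖ ≤ C) (hyn : ‖y'‖ ≤ D) :
    ‖x' * y' - x * y‖ ≤ (D + C) * ν := by
  calc ‖x' * y' - x * y‖ = ‖(x' - x) * y' + x * (y' - y)‖ := by ring_nf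
    _ ≤ ν * D + C * ν := norm_add_le_of_le (norm_mul_le_of_le hx hyn) (norm_mul_le_of_le hxn hy)
    _ = (D + C) * ν := by ring

open WienerAlgebra Germ

lemma norm_jacobian_add_sub_le {G : Type*} [SeminormedAddCommGroup G] {r R : ℝ≥0}
    {ω : Frequency G} {a b : Germ G} {u w u' w' : WienerAlgebra G r} {η : ℝ} (ha : a.IsSmall R η)
    (hb : b.IsSmall R η) (h : InDomain R η u w) (h' : InDomain R η (u + u') (w + w')) (hν : 0 < ν)
    (hu' : ‖u'‖ ≤ ν) (hw' : ‖w'‖ ≤ ν) (hνη : ν < η) :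
    ‖jacobian ω a b (u + u') (w + w') - jacobian ω a b u w‖ ≤ 8 * ν := by
  have norm_one_add {x : WienerAlgebra G r} (hx : ‖x‖ ≤ 1 / 100) : ‖1 + x‖ ≤ 2 :=
    (norm_add_le_of_le norm_one.le hx).trans (by norm_num)
  have one_add_sub {x y : WienerAlgebra G r} (hx : ‖y - x‖ ≤ ν) : ‖1 + y - (1 + x)‖ ≤ ν := by
    rwa [add_sub_add_left_eq_sub]
  have diagonal_term := norm_mul_sub_mul_le
    (one_add_sub (ha.norm_subst_dx_add_sub_le (ω := ω) h hν hu' hw' hνη))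
    (one_add_sub (hb.norm_subst_dy_add_sub_le (ω := ω) h hν hu' hw' hνη))
    (norm_one_add (ha.norm_subst_dx_le h)) (norm_one_add (hb.norm_subst_dy_le h'))
  have off_diagonal_term := norm_mul_sub_mul_le
    (one_add_sub (ha.norm_subst_dy_add_sub_le (ω := ω) h hν hu' hw' hνη))
    (hb.norm_subst_dx_add_sub_le (ω := ω) h hν hu' hw' hνη)
    (norm_one_add (ha.norm_subst_dy_le h))
    ((hb.norm_subst_dx_le h').trans (by norm_num : _ ≤ (2 : ℝ)))
  rw [jacobian, jacobian, sub_sub_sub_comm]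
  exact (norm_sub_le_of_le diagonal_term off_diagonal_term).trans (by linarith)

end JacobianIncrement

section NormEstimates

lemma norm_smul_le_mul_of_le {𝕜 E : Type*} [NormedField 𝕜] [SeminormedAddCommGroup E]
    [NormedSpace 𝕜 E] {k : 𝕜} {x : E} {c d : ℝ} (hk : ‖k‖ ≤ c) (hx : ‖x‖ ≤ d) :
    ‖k • x‖ ≤ c * d :=
  (norm_smul_le k x).trans (mul_le_mul hk hx (norm_nonneg x) ((norm_nonneg k).trans hk))

variable {A : Type*} [NormedCommRing A] {x y : A} {c d : ℝ}

lemma norm_sub_one_le_of_mul_eq_one (hx : ‖x - 1‖ ≤ c) (h : x * y = 1) (hy : ‖y‖ ≤ d) :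
    ‖y - 1‖ ≤ d * c := by
  rw [show y - 1 = -(y * (x - 1)) by linear_combination h, norm_neg]
  exact norm_mul_le_of_le hy hx

variable [NormOneClass A]

lemma norm_le_one_add_of_norm_sub_one_le (hx : ‖x - 1‖ ≤ c) : ‖x‖ ≤ 1 + c := by
  simpa using norm_add_le_of_le (norm_one (α := A)).le hx

lemma norm_mul_sub_one_le (hx : ‖x - 1‖ ≤ c) (hy : ‖y - 1‖ ≤ d) :
    ‖x * y - 1‖ ≤ c * (1 + d) + d := by
  rw [show x * y - 1 = (x - 1) * y + (y - 1) by ring]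
  exact norm_add_le_of_le (norm_mul_le_of_le hx (norm_le_one_add_of_norm_sub_one_le hy)) hy

lemma one_sub_le_norm_of_norm_sub_one_le (hx : ‖x - 1‖ ≤ c) : 1 - c ≤ ‖x‖ := by
  have key := norm_sub_norm_le (1 : A) (1 - x)
  rw [norm_one, norm_sub_rev, sub_sub_cancel] at key
  linarith

end NormEstimates

/-- Strips whose widths differ by `ρ` cost at most a factor `Λ` in the solution of the cohomological
equations and in differentiation. -/
structure Loss {G : Type*} [SeminormedAddCommGroup G] (ω : Frequency G) (α : ℝ) (ρ : ℝ≥0) (Λ : ℝ) :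
    Prop where
  pos : 0 < ρ
  inv_le : (ρ : ℝ)⁻¹ ≤ Λ
  large : 10 ^ 5 ≤ Λ
  divisors : SmallDivisors ω α ρ Λ

section LinearizedEquation

open WienerAlgebra

variable {G : Type*} [SeminormedAddCommGroup G] {r r' ρ : ℝ≥0} {ω : Frequency G}
  {α κ e m Λ : ℝ}

namespace WienerAlgebra

lemma norm_apply_zero_sub_one_le {g : WienerAlgebra G r} {c : ℝ} (hg : ‖g - 1‖ ≤ c) :
    ‖g 0 - 1‖ ≤ c := by
  rw [← one_apply_zero (G := G) (r := r), ← WienerAlgebra.sub_apply]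
  exact (norm_apply_le _ 0).trans hg

lemma restrict_sub_one (hle : r' ≤ r) (x : WienerAlgebra G r) :
    restrict hle x - 1 = restrict hle (x - 1) := by
  rw [map_sub, map_one]

lemma translate_sub_one (x : WienerAlgebra G r) :
    translate ω α x - 1 = translate ω α (x - 1) := by
  rw [map_sub, map_one]

lemma exists_add_mul_add_smul_one_apply_zero_eq_zero {y g s : WienerAlgebra G r}
    (hy : IsSelfAdjoint y) (hg : IsSelfAdjoint g) (hs : IsSelfAdjoint s)
    (hg_one : ‖g - 1‖ ≤ 1 / 2) :
    ∃ β : ℝ, (y + g * (s + (β : ℂ) • 1)) 0 = 0 ∧ |β| ≤ 2 * ‖y + g * s‖ := by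
  have half_le := one_sub_le_norm_of_norm_sub_one_le (norm_apply_zero_sub_one_le hg_one)
  have mean_ne : g 0 ≠ 0 := norm_pos_iff.1 (by linarith)
  obtain ⟨β, hβ⟩ : ∃ β : ℝ, (β : ℂ) * g 0 = -(y + g * s) 0 := by
    refine ⟨-((y + g * s) 0).re / (g 0).re, ?_⟩
    rw [Complex.ofReal_div, Complex.ofReal_neg, ofReal_re_apply_zero (hy.add (hg.mul hs)),
      ofReal_re_apply_zero hg, div_mul_cancel₀ _ mean_ne]
  refine ⟨β, ?_, ?_⟩
  · rw [mul_add, mul_smul_comm, mul_one, ← add_assoc, WienerAlgebra.add_apply,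
      WienerAlgebra.smul_apply, hβ, add_neg_cancel]
  · have norm_mul_eq : |β| * ‖g 0‖ = ‖(y + g * s) 0‖ := by
      rw [← norm_neg ((y + g * s) 0), ← hβ, norm_mul, Complex.norm_real, Real.norm_eq_abs]
    nlinarith [norm_apply_le (y + g * s) 0, abs_nonneg β]

end WienerAlgebra

namespace Loss

variable (L : Loss ω α ρ Λ)
include L

lemma mul_pow_mul_le {x : ℝ} (hx : 0 ≤ x) {k n : ℕ} (h : k < n) :
    10 ^ 5 * (Λ ^ k * x) ≤ Λ ^ n * x := by
  have hΛ : 1 ≤ Λ := le_trans (by norm_num) L.large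
  calc 10 ^ 5 * (Λ ^ k * x) = 10 ^ 5 * Λ ^ k * x := by ring
    _ ≤ Λ * Λ ^ k * x := by gcongr; exact L.large
    _ = Λ ^ (k + 1) * x := by ring
    _ ≤ Λ ^ n * x := by gcongr; exact h

lemma exists_smul_sub_translate_eq (hr : r' + ρ ≤ r) (hle : r' ≤ r) (hκ : |κ - 1| ≤ 1 / 100)
    {x : WienerAlgebra G r} (hx : IsSelfAdjoint x) :
    ∃ y : WienerAlgebra G r', IsSelfAdjoint y ∧ ‖y‖ ≤ Λ * ‖x‖ ∧
      (κ : ℂ) • y - translate ω α y = restrict hle x - x 0 • 1 := by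
  have κ_ge : 1 / 4 ≤ κ := by linarith [abs_le.1 hκ]
  obtain ⟨y, y_real, -, y_norm, y_eq⟩ := L.divisors.exists_smul_sub_translate_eq
    (le_trans (by norm_num) L.large) (mod_cast hr) hle κ_ge hx
  exact ⟨y, y_real, y_norm, y_eq⟩

lemma exists_sub_translate_eq (hr : r' + ρ ≤ r) (hle : r' ≤ r) {x : WienerAlgebra G r}
    (hx : IsSelfAdjoint x) :
    ∃ y : WienerAlgebra G r', IsSelfAdjoint y ∧ ‖y‖ ≤ Λ * ‖x‖ ∧
      y - translate ω α y = restrict hle x - x 0 • 1 := by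
  simpa using L.exists_smul_sub_translate_eq (κ := 1) hr hle (by norm_num) hx

/-- The mean value of the normal component `n` is free and is used to make the equation for the
tangential component `t` solvable. -/
lemma exists_normal_tangent (hr : r' + 2 * ρ ≤ r) (hle : r' ≤ r) (hκ : |κ - 1| ≤ 1 / 100)
    {x y g : WienerAlgebra G r} (hx : IsSelfAdjoint x) (hy : IsSelfAdjoint y)
    (hg : IsSelfAdjoint g) (hxe : ‖x‖ ≤ 6 * e) (hye : ‖y‖ ≤ 2 * e) (hg_one : ‖g - 1‖ ≤ 1 / 2) :
    ∃ (n t : WienerAlgebra G r') (k : ℂ), IsSelfAdjoint n ∧ IsSelfAdjoint t ∧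
      ‖n‖ ≤ 40 * (Λ * e) ∧ ‖t‖ ≤ 62 * (Λ ^ 2 * e) ∧
      (κ : ℂ) • n - translate ω α n = restrict hle x + k • 1 ∧
      t - translate ω α t = -(restrict hle y + restrict hle g * n) := by
  have hΛ := L.large
  have he : 0 ≤ e := by linarith [norm_nonneg y]
  have hΛe : 10 ^ 5 * e ≤ Λ * e := by gcongr
  have h₁ : r' + ρ ≤ r := le_trans (by gcongr; exact le_mul_of_one_le_left' one_le_two) hr
  have h₂ : r' + ρ + ρ ≤ r := by rwa [add_assoc, ← two_mul]
  obtain ⟨s, s_real, s_norm, s_eq⟩ := L.exists_smul_sub_translate_eq h₂ h₁ hκ hx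
  replace s_norm : ‖s‖ ≤ 6 * (Λ * e) := s_norm.trans (by nlinarith)
  have y_norm := norm_restrict_le_of_le h₁ hye
  have g_one : ‖restrict h₁ g - 1‖ ≤ 1 / 2 := by
    rw [restrict_sub_one]
    exact norm_restrict_le_of_le h₁ hg_one
  have g_norm := norm_le_one_add_of_norm_sub_one_le g_one
  obtain ⟨β, mean_eq, β_le⟩ := exists_add_mul_add_smul_one_apply_zero_eq_zero
    (hy.map (restrict h₁)) (hg.map (restrict h₁)) s_real g_one
  have β_norm : ‖(β : ℂ) • (1 : WienerAlgebra G (r' + ρ))‖ ≤ 32 * (Λ * e) := by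
    rw [norm_smul_one, Complex.norm_real]
    linarith [norm_add_le_of_le y_norm (norm_mul_le_of_le g_norm s_norm), Real.norm_eq_abs β]
  set n := s + (β : ℂ) • (1 : WienerAlgebra G (r' + ρ)) with hn
  have n_real : IsSelfAdjoint n := s_real.add (.smul (Complex.conj_ofReal β) (.one _))
  have n_norm : ‖n‖ ≤ 40 * (Λ * e) := (norm_add_le_of_le s_norm β_norm).trans (by linarith)
  have source_norm := norm_add_le_of_le y_norm (norm_mul_le_of_le g_norm n_norm)
  obtain ⟨t, t_real, t_norm, t_eq⟩ := L.exists_sub_translate_eq le_rfl (le_self_add (a := r'))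
    ((hy.map (restrict h₁)).add ((hg.map (restrict h₁)).mul n_real)).neg
  refine ⟨restrict le_self_add n, t, (κ - 1) * β - x 0, n_real.map _, t_real,
    norm_restrict_le_of_le _ n_norm, t_norm.trans ?_, ?_, ?_⟩
  · rw [norm_neg]
    nlinarith
  · have n_eq : (κ : ℂ) • n - translate ω α n = restrict h₁ x + ((κ - 1) * β - x 0) • 1 := by
      rw [hn, map_add, map_smul, map_one, smul_add, smul_smul, sub_smul, sub_mul, sub_smul, one_mul]
      linear_combination s_eq
    rw [← restrict_translate, ← map_smul, ← map_sub, n_eq, map_add, map_smul, map_one,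
      restrict_restrict]
  · rw [t_eq, WienerAlgebra.neg_apply, mean_eq, neg_zero, zero_smul, sub_zero, map_neg, map_add,
      map_mul, restrict_restrict, restrict_restrict]

lemma exists_update_multiplier (hr : r' + ρ ≤ r) (hle : r' ≤ r) (hκ : |κ - 1| ≤ 1 / 100)
    {q M : WienerAlgebra G r} (hq : IsSelfAdjoint q) (hM : IsSelfAdjoint M)
    (hq_one : ‖q - 1‖ ≤ 1 / 100) (hm : ‖M‖ ≤ m) :
    ∃ (z : WienerAlgebra G r') (κ' : ℝ), IsSelfAdjoint z ∧ ‖z‖ ≤ 3 * (Λ * m) ∧ |κ'| ≤ 4 * m ∧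
      (κ : ℂ) • (translate ω α (restrict hle q) * (z - translate ω α z)) =
        (κ' : ℂ) • translate ω α (restrict hle q) - restrict hle M := by
  have hκ' := abs_le.1 hκ
  have κ_pos : 0 < κ := by linarith
  obtain ⟨p, hqp, hp⟩ := exists_mul_eq_one_of_norm_sub_one_le (hq_one.trans (by norm_num))
  have p_real := isSelfAdjoint_of_mul_eq_one hq hqp
  set x := -(((κ⁻¹ : ℝ) : ℂ) • (M * translate ω α p)) with hx
  have x_real : IsSelfAdjoint x := (IsSelfAdjoint.smul (Complex.conj_ofReal _)
    (hM.mul (p_real.map (translate ω α)))).neg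
  have x_norm : ‖x‖ ≤ 3 * m := by
    have κ_inv_le : κ⁻¹ ≤ 3 / 2 := inv_le_of_inv_le₀ (by norm_num) (by linarith)
    rw [hx, norm_neg, norm_smul, Complex.norm_real, Real.norm_of_nonneg (by positivity)]
    calc κ⁻¹ * ‖M * translate ω α p‖ ≤ 3 / 2 * (m * 2) := by
          gcongr
          exact norm_mul_le_of_le hm (norm_translate_le_of_le hp)
      _ = 3 * m := by ring
  obtain ⟨z, z_real, z_norm, z_eq⟩ := L.exists_sub_translate_eq hr hle x_real
  refine ⟨z, -κ * (x 0).re, z_real, ?_, ?_, ?_⟩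
  · have hΛ := L.large
    nlinarith
  · rw [abs_mul, abs_neg, abs_of_pos κ_pos]
    have mean_le : |(x 0).re| ≤ 3 * m :=
      (Complex.abs_re_le_norm _).trans ((norm_apply_le x 0).trans x_norm)
    nlinarith [norm_nonneg M]
  · have inv_eq : translate ω α (restrict hle q) * translate ω α (restrict hle p) = 1 := by
      rw [← map_mul, ← map_mul, hqp, map_one, map_one]
    have κ_smul : (κ : ℂ) • restrict hle x =
        -(restrict hle M * translate ω α (restrict hle p)) := by
      rw [hx, map_neg, map_smul, map_mul, restrict_translate, smul_neg, smul_smul,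
        Complex.ofReal_inv, mul_inv_cancel₀ (mod_cast κ_pos.ne'), one_smul]
    rw [z_eq, ← mul_smul_comm, smul_sub, κ_smul, smul_smul, Complex.ofReal_mul, Complex.ofReal_neg,
      ofReal_re_apply_zero x_real, mul_sub, neg_mul, neg_smul, mul_neg, mul_smul_comm,
      mul_one]
    linear_combination -restrict hle M * inv_eq

end Loss

end LinearizedEquation

section FramedCurve

open WienerAlgebra Germ

variable {G : Type*} [SeminormedAddCommGroup G] {r r' ρ : ℝ≥0}

/-- A curve `(ξ + u ξ, w ξ)` together with its velocity `(U, W)` and with a factor `q` and a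
multiplier `κ` describing the dynamics normal to it. -/
structure FramedCurve (G : Type*) [SeminormedAddCommGroup G] (r : ℝ≥0) where
  (u w U W q : WienerAlgebra G r)
  κ : ℝ

variable {ω : Frequency G} {α c e Λ : ℝ} {a b : Germ G} {Γ : FramedCurve G r}

namespace FramedCurve

/-- Restriction of the curve and its frame to a narrower strip. -/
@[simps]
def restrict (hle : r' ≤ r) (Γ : FramedCurve G r) : FramedCurve G r' where
  u := Γ.u.restrict hle
  w := Γ.w.restrict hle
  U := Γ.U.restrict hle
  W := Γ.W.restrict hle
  q := Γ.q.restrict hle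
  κ := Γ.κ

/-- The framed curve is real and `c`-close to the curve `(ξ, 0)` with its standard frame. -/
structure IsNearTrivial (ω : Frequency G) (c : ℝ) (Γ : FramedCurve G r) : Prop where
  real_u : IsSelfAdjoint Γ.u
  real_w : IsSelfAdjoint Γ.w
  real_q : IsSelfAdjoint Γ.q
  deriv_u : IsDeriv ω Γ.u (Γ.U - 1)
  deriv_w : IsDeriv ω Γ.w Γ.W
  norm_u : ‖Γ.u‖ ≤ c
  norm_w : ‖Γ.w‖ ≤ c
  norm_U : ‖Γ.U - 1‖ ≤ c
  norm_W : ‖Γ.W‖ ≤ c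
  norm_q : ‖Γ.q - 1‖ ≤ c
  abs_κ : |Γ.κ - 1| ≤ c

namespace IsNearTrivial

variable (h : Γ.IsNearTrivial ω c)
include h

lemma real_U : IsSelfAdjoint Γ.U := by
  simpa using (h.deriv_u.isSelfAdjoint h.real_u).add (.one _)

lemma real_W : IsSelfAdjoint Γ.W := h.deriv_w.isSelfAdjoint h.real_w

lemma restrict (hle : r' ≤ r) : (Γ.restrict hle).IsNearTrivial ω c where
  real_u := h.real_u.map _
  real_w := h.real_w.map _
  real_q := h.real_q.map _
  deriv_u l := by
    simpa only [restrict_U, restrict_u, restrict_sub_one, restrict_apply] using h.deriv_u l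
  deriv_w l := by simpa using h.deriv_w l
  norm_u := norm_restrict_le_of_le hle h.norm_u
  norm_w := norm_restrict_le_of_le hle h.norm_w
  norm_U := by
    rw [restrict_U, restrict_sub_one]
    exact norm_restrict_le_of_le hle h.norm_U
  norm_W := norm_restrict_le_of_le hle h.norm_W
  norm_q := by
    rw [restrict_q, restrict_sub_one]
    exact norm_restrict_le_of_le hle h.norm_q
  abs_κ := h.abs_κ

end IsNearTrivial

/-- A solution of the equations of the invariant curve linearized at `Γ`, with errors `E₁` and `E₂`
and with twist coefficient `D`: the curve is moved by `t` along itself and by `N` in the direction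
of the second coordinate. The second equation is solved up to the multiple `k` of `q`. -/
structure IsLinearizedSolution (Γ : FramedCurve G r) (ω : Frequency G) (α : ℝ)
    (D E₁ E₂ n t N : WienerAlgebra G r) (k : ℂ) : Prop where
  mul_eq : Γ.U * N = Γ.q * n
  normal_eq : translate ω α Γ.q * ((Γ.κ : ℂ) • n - translate ω α n) =
    k • translate ω α Γ.q - (translate ω α Γ.U * E₂ - translate ω α Γ.W * E₁)
  tangent_eq : translate ω α Γ.U * (t - translate ω α t) = -(E₁ + D * N)

lemma isLinearizedSolution_of_mul_eq_one {D E₁ E₂ n t V p : WienerAlgebra G r} {k : ℂ}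
    (hUV : Γ.U * V = 1) (hqp : Γ.q * p = 1)
    (hn : (Γ.κ : ℂ) • n - translate ω α n =
      -((translate ω α Γ.U * E₂ - translate ω α Γ.W * E₁) * translate ω α p) + k • 1)
    (ht : t - translate ω α t =
      -(E₁ * translate ω α V + D * Γ.q * (V * translate ω α V) * n)) :
    Γ.IsLinearizedSolution ω α D E₁ E₂ n t (Γ.q * n * V) k := by
  have translate_hUV := congrArg (translate ω α) hUV
  have translate_hqp := congrArg (translate ω α) hqp
  simp only [map_mul, map_one] at translate_hUV translate_hqp
  constructor
  · linear_combination Γ.q * n * hUV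
  · rw [hn, mul_add, mul_smul_comm, mul_one]
    linear_combination -(translate ω α Γ.U * E₂ - translate ω α Γ.W * E₁) * translate_hqp
  · rw [ht]
    linear_combination -(E₁ + D * Γ.q * V * n) * translate_hUV

lemma IsNearTrivial.exists_isLinearizedSolution (h : Γ.IsNearTrivial ω c) (hc : c ≤ 1 / 100)
    (L : Loss ω α ρ Λ) (hr : r' + 2 * ρ ≤ r) (hle : r' ≤ r) {D E₁ E₂ : WienerAlgebra G r}
    (hD : IsSelfAdjoint D) (hE₁ : IsSelfAdjoint E₁) (hE₂ : IsSelfAdjoint E₂)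
    (hD_one : ‖D - 1‖ ≤ 1 / 100) (hE₁e : ‖E₁‖ ≤ e) (hE₂e : ‖E₂‖ ≤ e) :
    ∃ (n t N : WienerAlgebra G r') (k : ℂ),
      (Γ.restrict hle).IsLinearizedSolution ω α (D.restrict hle) (E₁.restrict hle)
        (E₂.restrict hle) n t N k ∧
      IsSelfAdjoint t ∧ IsSelfAdjoint N ∧
      ‖n‖ ≤ 40 * (Λ * e) ∧ ‖t‖ ≤ 62 * (Λ ^ 2 * e) ∧ ‖N‖ ≤ 160 * (Λ * e) := by
  have U_one := h.norm_U.trans hc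
  have q_one := h.norm_q.trans hc
  obtain ⟨V, hUV, V_norm⟩ := exists_mul_eq_one_of_norm_sub_one_le (U_one.trans (by norm_num))
  obtain ⟨p, hqp, p_norm⟩ := exists_mul_eq_one_of_norm_sub_one_le (q_one.trans (by norm_num))
  have V_real := isSelfAdjoint_of_mul_eq_one h.real_U hUV
  have p_real := isSelfAdjoint_of_mul_eq_one h.real_q hqp
  have τU_real := h.real_U.map (translate ω α)
  have τV_real := V_real.map (translate ω α)
  have V_one := norm_sub_one_le_of_mul_eq_one U_one hUV V_norm
  have τV_one : ‖translate ω α V - 1‖ ≤ 2 * (1 / 100) := by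
    rw [translate_sub_one]
    exact norm_translate_le_of_le V_one
  have τU_norm : ‖translate ω α Γ.U‖ ≤ 1 + 1 / 100 :=
    norm_translate_le_of_le (norm_le_one_add_of_norm_sub_one_le U_one)
  have τW_norm : ‖translate ω α Γ.W‖ ≤ 1 / 100 := norm_translate_le_of_le (h.norm_W.trans hc)
  have he : 0 ≤ e := (norm_nonneg _).trans hE₁e
  obtain ⟨n, t, k, n_real, t_real, n_norm, t_norm, n_eq, t_eq⟩ := L.exists_normal_tangent (e := e)
    (x := -((translate ω α Γ.U * E₂ - translate ω α Γ.W * E₁) * translate ω α p))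
    (y := E₁ * translate ω α V) (g := D * Γ.q * (V * translate ω α V)) hr hle (h.abs_κ.trans hc)
    (((τU_real.mul hE₂).sub ((h.real_W.map _).mul hE₁)).mul (p_real.map _)).neg
    (hE₁.mul τV_real) ((hD.mul h.real_q).mul (V_real.mul τV_real))
    (by
      rw [norm_neg]
      refine (norm_mul_le_of_le (norm_sub_le_of_le (norm_mul_le_of_le τU_norm hE₂e)
        (norm_mul_le_of_le τW_norm hE₁e)) (norm_translate_le_of_le p_norm)).trans ?_
      linarith)
    ((norm_mul_le_of_le hE₁e (norm_translate_le_of_le V_norm)).trans (by linarith))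
    ((norm_mul_sub_one_le (norm_mul_sub_one_le hD_one q_one)
      (norm_mul_sub_one_le V_one τV_one)).trans (by norm_num))
  have q_norm : ‖Γ.q‖ ≤ 2 := (norm_le_one_add_of_norm_sub_one_le q_one).trans (by norm_num)
  have restrict_hUV := congrArg (WienerAlgebra.restrict hle) hUV
  have restrict_hqp := congrArg (WienerAlgebra.restrict hle) hqp
  rw [map_mul, map_one] at restrict_hUV restrict_hqp
  simp only [map_neg, map_mul, map_sub, restrict_translate] at n_eq t_eq
  refine ⟨n, t, Γ.q.restrict hle * n * V.restrict hle, k,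
    isLinearizedSolution_of_mul_eq_one restrict_hUV restrict_hqp n_eq t_eq, t_real,
    ((h.real_q.map _).mul n_real).mul (V_real.map _), n_norm, t_norm, ?_⟩
  refine (norm_mul_le_of_le (norm_mul_le_of_le (norm_restrict_le_of_le hle q_norm) n_norm)
    (norm_restrict_le_of_le hle V_norm)).trans ?_
  linarith

/-- What remains of the second component of the error after a Newton correction, apart from a
multiple of `q`. -/
def normalRemainder (Γ : FramedCurve G r) (ω : Frequency G) (α : ℝ) (a b : Germ G)
    (n t N : WienerAlgebra G r) : WienerAlgebra G r :=
  n * normalErr ω α a b Γ.u Γ.w Γ.q Γ.κ +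
    N * ((1 + subst ω a.dy Γ.u Γ.w) * tangentErr₂ ω α b Γ.u Γ.w Γ.U Γ.W -
      (1 + subst ω b.dy Γ.u Γ.w) * tangentErr₁ ω α a Γ.u Γ.w Γ.U Γ.W) +
    translate ω α Γ.U * (t * tangentErr₂ ω α b Γ.u Γ.w Γ.U Γ.W +
      taylorRemainder ω b Γ.u Γ.w (Γ.U * t) (Γ.W * t + N))

section Correction

variable {n t N : WienerAlgebra G r} {k : ℂ}
  (h : Γ.IsLinearizedSolution ω α (1 + subst ω a.dy Γ.u Γ.w) (conjugacyErr₁ ω α a Γ.u Γ.w)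
    (conjugacyErr₂ ω α b Γ.u Γ.w) n t N k)
include h

lemma IsLinearizedSolution.conjugacyErr₁_add :
    conjugacyErr₁ ω α a (Γ.u + Γ.U * t) (Γ.w + (Γ.W * t + N)) =
      t * tangentErr₁ ω α a Γ.u Γ.w Γ.U Γ.W +
        taylorRemainder ω a Γ.u Γ.w (Γ.U * t) (Γ.W * t + N) := by
  have tangent_eq := h.tangent_eq
  simp only [conjugacyErr₁, tangentErr₁, taylorRemainder, fderivSubst_apply, map_add, map_mul]
    at tangent_eq ⊢
  linear_combination tangent_eq

lemma IsLinearizedSolution.translate_mul_conjugacyErr₂_add :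
    translate ω α Γ.U * conjugacyErr₂ ω α b (Γ.u + Γ.U * t) (Γ.w + (Γ.W * t + N)) =
      k • translate ω α Γ.q + Γ.normalRemainder ω α a b n t N := by
  have tangent_eq := h.tangent_eq
  have normal_eq := h.normal_eq
  have mul_eq := h.mul_eq
  have translate_mul_eq := congrArg (translate ω α) h.mul_eq
  simp only [normalRemainder, conjugacyErr₁, conjugacyErr₂, tangentErr₁, tangentErr₂, normalErr,
    jacobian, taylorRemainder, fderivSubst_apply, map_add, map_mul, Algebra.smul_def]
    at tangent_eq normal_eq translate_mul_eq ⊢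
  linear_combination normal_eq + translate ω α Γ.W * tangent_eq - translate_mul_eq +
    ((1 + subst ω (a.dx ω) Γ.u Γ.w) * (1 + subst ω b.dy Γ.u Γ.w) -
      (1 + subst ω a.dy Γ.u Γ.w) * subst ω (b.dx ω) Γ.u Γ.w) * mul_eq

end Correction

end FramedCurve

end FramedCurve

/-! ### The Newton iteration -/

section NewtonStep

open WienerAlgebra Germ FramedCurve

variable {G : Type*} [SeminormedAddCommGroup G] {r r' r₀ R ρ : ℝ≥0} {ω : Frequency G}
  {α c c₀ e η κ m ν δ Λ : ℝ} {a b : Germ G} {Γ : FramedCurve G r}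

/-- A framed curve along which the conjugacy equations and the reduction of the normal dynamics hold
up to an error `e`. -/
structure FramedCurve.IsApprox (ω : Frequency G) (α : ℝ) (a b : Germ G) (c e : ℝ)
    (Γ : FramedCurve G r) : Prop extends Γ.IsNearTrivial ω c where
  norm_err₁ : ‖conjugacyErr₁ ω α a Γ.u Γ.w‖ ≤ e
  norm_err₂ : ‖conjugacyErr₂ ω α b Γ.u Γ.w‖ ≤ e
  norm_normalErr : ‖normalErr ω α a b Γ.u Γ.w Γ.q Γ.κ‖ ≤ e

namespace FramedCurve

lemma IsNearTrivial.inDomain (h : Γ.IsNearTrivial ω c) (hr : r + 3 * η ≤ R) (hc : c ≤ η) :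
    InDomain R η Γ.u Γ.w :=
  ⟨hr, h.norm_u.trans hc, h.norm_w.trans hc⟩

section CorrectionBounds

variable {n t N : WienerAlgebra G r} (h : Γ.IsNearTrivial ω c) (hc : c ≤ 1 / 100)
  (L : Loss ω α ρ Λ) (he : 0 < e) (ht : ‖t‖ ≤ 62 * (Λ ^ 2 * e)) (hN : ‖N‖ ≤ 160 * (Λ * e))
include h hc L he ht

lemma IsNearTrivial.norm_mul_le : ‖Γ.U * t‖ ≤ Λ ^ 3 * e := by
  have U_norm := norm_le_one_add_of_norm_sub_one_le (h.norm_U.trans hc)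
  have Λ_pos : 0 < Λ := lt_of_lt_of_le (by norm_num) L.large
  have := L.mul_pow_mul_le he.le (show 2 < 3 by norm_num)
  have : 0 < Λ ^ 2 * e := by positivity
  exact (norm_mul_le_of_le U_norm ht).trans (by linarith)

include hN

lemma IsNearTrivial.norm_mul_add_le : ‖Γ.W * t + N‖ ≤ Λ ^ 3 * e := by
  have Λ_pos : 0 < Λ := lt_of_lt_of_le (by norm_num) L.large
  have h₁ := L.mul_pow_mul_le he.le (show 1 < 3 by norm_num)
  have h₂ := L.mul_pow_mul_le he.le (show 2 < 3 by norm_num)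
  have : 0 < Λ ^ 2 * e := by positivity
  refine (norm_add_le_of_le (norm_mul_le_of_le (h.norm_W.trans hc) ht) hN).trans ?_
  linarith

lemma IsNearTrivial.norm_normalRemainder_le (ha : a.IsSmall R η) (hb : b.IsSmall R η)
    (hd : InDomain R η Γ.u Γ.w) (hn : ‖n‖ ≤ 40 * (Λ * e))
    (hT₁ : ‖tangentErr₁ ω α a Γ.u Γ.w Γ.U Γ.W‖ ≤ Λ * e)
    (hT₂ : ‖tangentErr₂ ω α b Γ.u Γ.w Γ.U Γ.W‖ ≤ Λ * e)
    (hM : ‖normalErr ω α a b Γ.u Γ.w Γ.q Γ.κ‖ ≤ e) (hη : Λ ^ 3 * e < η) :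
    ‖Γ.normalRemainder ω α a b n t N‖ ≤ Λ ^ 7 * e ^ 2 := by
  have Λ_pos : 0 < Λ := lt_of_lt_of_le (by norm_num) L.large
  have norm_one_add {x : WienerAlgebra G r} (hx : ‖x‖ ≤ 1 / 100) : ‖1 + x‖ ≤ 2 :=
    (norm_add_le_of_le norm_one.le hx).trans (by norm_num)
  have U_norm : ‖translate ω α Γ.U‖ ≤ 2 := norm_translate_le_of_le
    ((norm_le_one_add_of_norm_sub_one_le (h.norm_U.trans hc)).trans (by norm_num))
  have taylor_norm := hb.norm_taylorRemainder_le (ω := ω) hd (by positivity)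
    (h.norm_mul_le hc L he ht) (h.norm_mul_add_le hc L he ht hN) hη
  refine (norm_add_le_of_le (norm_add_le_of_le (norm_mul_le_of_le hn hM)
    (norm_mul_le_of_le hN (norm_sub_le_of_le
      (norm_mul_le_of_le (norm_one_add (ha.norm_subst_dy_le hd)) hT₂)
      (norm_mul_le_of_le (norm_one_add (hb.norm_subst_dy_le hd)) hT₁))))
    (norm_mul_le_of_le U_norm (norm_add_le_of_le (norm_mul_le_of_le ht hT₂) taylor_norm))).trans ?_
  have h₁ := L.mul_pow_mul_le (sq_nonneg e) (show 1 < 7 by norm_num)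
  have h₂ := L.mul_pow_mul_le (sq_nonneg e) (show 2 < 7 by norm_num)
  have h₃ := L.mul_pow_mul_le (sq_nonneg e) (show 3 < 7 by norm_num)
  have h₆ := L.mul_pow_mul_le (sq_nonneg e) (show 6 < 7 by norm_num)
  have : 0 < Λ ^ 7 * e ^ 2 := by positivity
  linarith

end CorrectionBounds

namespace IsApprox

variable (h : Γ.IsApprox ω α a b c e) (ha : a.IsSmall R η) (hb : b.IsSmall R η)
  (hd : InDomain R η Γ.u Γ.w)
include h ha hb hd

lemma restrict (hle : r' ≤ r) : (Γ.restrict hle).IsApprox ω α a b c e where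
  toIsNearTrivial := h.toIsNearTrivial.restrict hle
  norm_err₁ := by
    rw [restrict_u, restrict_w, ← restrict_conjugacyErr₁ hd hle ha]
    exact norm_restrict_le_of_le hle h.norm_err₁
  norm_err₂ := by
    rw [restrict_u, restrict_w, ← restrict_conjugacyErr₂ hd hle hb]
    exact norm_restrict_le_of_le hle h.norm_err₂
  norm_normalErr := by
    rw [restrict_u, restrict_w, restrict_q, ← restrict_normalErr hd hle ha hb]
    exact norm_restrict_le_of_le hle h.norm_normalErr

/-- The first error becomes quadratic; of the second one there remains a multiple of a known
function that does not vanish, to be controlled by the intersection property. -/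
lemma exists_correction (L : Loss ω α ρ Λ) (hc : c ≤ 1 / 100) (hr : r' + 2 * ρ ≤ r) (hle : r' ≤ r)
    (he : 0 < e) (hη : Λ ^ 3 * e < η) :
    ∃ (u' w' Y : WienerAlgebra G r') (k : ℂ), IsSelfAdjoint u' ∧ IsSelfAdjoint w' ∧
      ‖u'‖ ≤ Λ ^ 3 * e ∧ ‖w'‖ ≤ Λ ^ 3 * e ∧ ‖Y‖ ≤ Λ ^ 7 * e ^ 2 ∧
      ‖conjugacyErr₁ ω α a (Γ.u.restrict hle + u') (Γ.w.restrict hle + w')‖ ≤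
        2 * (Λ ^ 6 * e ^ 2) ∧
      translate ω α (Γ.U.restrict hle) *
          conjugacyErr₂ ω α b (Γ.u.restrict hle + u') (Γ.w.restrict hle + w') =
        k • translate ω α (Γ.q.restrict hle) + Y := by
  have Λ_pos : 0 < Λ := lt_of_lt_of_le (by norm_num) L.large
  have hr' : (r' : ℝ) + ρ ≤ r := by
    have : (r' : ℝ) + 2 * ρ ≤ r := mod_cast hr
    linarith [ρ.coe_nonneg]
  obtain ⟨n, t, N, k, sol, t_real, N_real, n_norm, t_norm, N_norm⟩ :=
    h.exists_isLinearizedSolution (D := 1 + subst ω a.dy Γ.u Γ.w) hc L hr hle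
      ((IsSelfAdjoint.one _).add (isSelfAdjoint_subst ha.isReal.dy h.real_u h.real_w))
      (isSelfAdjoint_conjugacyErr₁ h.real_u h.real_w ha.isReal)
      (isSelfAdjoint_conjugacyErr₂ h.real_u h.real_w hb.isReal)
      (by simpa using ha.norm_subst_dy_le hd) h.norm_err₁ h.norm_err₂
  rw [map_add, map_one, (ha.dy_hasBoundNear hd).restrict_subst ha.pos.le,
    restrict_conjugacyErr₁ hd hle ha, restrict_conjugacyErr₂ hd hle hb] at sol
  have h' := h.restrict ha hb hd hle
  have hd' := hd.restrict hle
  have inv_mul_le {x : WienerAlgebra G r} (hx : ‖x‖ ≤ e) : (ρ : ℝ)⁻¹ * ‖x‖ ≤ Λ * e :=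
    mul_le_mul L.inv_le hx (norm_nonneg _) Λ_pos.le
  have T₁_norm := (norm_tangentErr₁_le (α := α) (mod_cast L.pos) hr' hle hd h.deriv_u h.deriv_w
    ha).trans (inv_mul_le h.norm_err₁)
  have T₂_norm := (norm_tangentErr₂_le (α := α) (mod_cast L.pos) hr' hle hd h.deriv_u h.deriv_w
    hb).trans (inv_mul_le h.norm_err₂)
  have u'_norm := h'.norm_mul_le hc L he t_norm
  have w'_norm := h'.norm_mul_add_le hc L he t_norm N_norm
  refine ⟨_, _, _, k, h'.real_U.mul t_real, (h'.real_W.mul t_real).add N_real, u'_norm, w'_norm,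
    h'.norm_normalRemainder_le hc L he t_norm N_norm ha hb hd' n_norm T₁_norm T₂_norm
      h'.norm_normalErr hη, ?_, sol.translate_mul_conjugacyErr₂_add⟩
  refine (congrArg norm sol.conjugacyErr₁_add).trans_le ((norm_add_le_of_le
    (norm_mul_le_of_le t_norm T₁_norm)
    (ha.norm_taylorRemainder_le hd' (by positivity) u'_norm w'_norm hη)).trans ?_)
  have := L.mul_pow_mul_le (sq_nonneg e) (show 3 < 6 by norm_num)
  have : 0 < Λ ^ 3 * e ^ 2 := by positivity
  linarith

lemma norm_normalErr_add_le {u' w' : WienerAlgebra G r} (hd' : InDomain R η (Γ.u + u') (Γ.w + w'))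
    (L : Loss ω α ρ Λ) (he : 0 < e) (hu' : ‖u'‖ ≤ Λ ^ 3 * e) (hw' : ‖w'‖ ≤ Λ ^ 3 * e)
    (hη : Λ ^ 3 * e < η) (hq : ‖Γ.q - 1‖ ≤ 1 / 100) :
    ‖normalErr ω α a b (Γ.u + u') (Γ.w + w') Γ.q Γ.κ‖ ≤ 17 * (Λ ^ 3 * e) := by
  have Λ_pos : 0 < Λ := lt_of_lt_of_le (by norm_num) L.large
  have h₀ := L.mul_pow_mul_le he.le (show 0 < 3 by norm_num)
  have e₃_pos : 0 < Λ ^ 3 * e := by positivity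
  have jacobian_norm := norm_jacobian_add_sub_le (ω := ω) ha hb hd hd' e₃_pos hu' hw' hη
  rw [show normalErr ω α a b (Γ.u + u') (Γ.w + w') Γ.q Γ.κ =
    (jacobian ω a b (Γ.u + u') (Γ.w + w') - jacobian ω a b Γ.u Γ.w) * Γ.q +
      normalErr ω α a b Γ.u Γ.w Γ.q Γ.κ by simp only [normalErr]; ring]
  refine (norm_add_le_of_le (norm_mul_le_of_le jacobian_norm
    (norm_le_one_add_of_norm_sub_one_le hq)) h.norm_normalErr).trans ?_
  linarith

end IsApprox

end FramedCurve

/-- If the error were of constant sign up to a small remainder, it would not be small anywhere. -/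
lemma norm_le_of_mul_eq_smul_add {P Q E Y : WienerAlgebra G r} {k : ℂ} {x ξ : ℝ}
    (hP : ‖P - 1‖ ≤ 1 / 2) (hQ : ‖Q - 1‖ ≤ 1 / 2) (h : P * E = k • Q + Y)
    (hξ : ‖eval ω ξ E‖ ≤ x) : ‖E‖ ≤ 12 * x + 8 * ‖Y‖ := by
  obtain ⟨P', hPP', P'_norm⟩ := exists_mul_eq_one_of_norm_sub_one_le hP
  have P_norm := norm_le_one_add_of_norm_sub_one_le hP
  have Q_norm := norm_le_one_add_of_norm_sub_one_le hQ
  have half_le : 1 - 1 / 2 ≤ ‖eval ω ξ Q‖ := by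
    refine one_sub_le_norm_of_norm_sub_one_le ?_
    rw [← map_one (eval ω ξ), ← map_sub]
    exact (norm_eval_le _).trans hQ
  have k_mul_le : ‖k‖ * ‖eval ω ξ Q‖ ≤ (1 + 1 / 2) * x + ‖Y‖ := by
    rw [← norm_mul, show k * eval ω ξ Q = eval ω ξ P * eval ω ξ E - eval ω ξ Y by
      rw [← map_mul, h, map_add, map_smul, smul_eq_mul, add_sub_cancel_right]]
    exact norm_sub_le_of_le (norm_mul_le_of_le ((norm_eval_le _).trans P_norm) hξ)
      (norm_eval_le _)
  have k_norm : ‖k‖ ≤ 3 * x + 2 * ‖Y‖ := by nlinarith [norm_nonneg k]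
  rw [show E = P' * (k • Q + Y) by linear_combination P' * h - E * hPP']
  refine (norm_mul_le_of_le P'_norm (norm_add_le_of_le
    (norm_smul_le_mul_of_le k_norm Q_norm) le_rfl)).trans ?_
  linarith [norm_nonneg Y, (norm_nonneg _).trans hξ]

/-- The standing assumptions of the Newton iteration: the perturbation is given by small real germs
and, as a consequence of the intersection property, on no curve near `(ξ, 0)` does the second error
dominate the first one everywhere. -/
structure NewtonSetting (ω : Frequency G) (α : ℝ) (a b : Germ G) (R : ℝ≥0) (η c₀ : ℝ) (r₀ : ℝ≥0) :
    Prop where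
  small_a : a.IsSmall R η
  small_b : b.IsSmall R η
  crossing (r : ℝ≥0) (hr₀ : r₀ ≤ r) (hR : r + 3 * η ≤ R) (u w : WienerAlgebra G r)
    (hu : IsSelfAdjoint u) (hw : IsSelfAdjoint w) (hu_norm : ‖u‖ ≤ c₀) (hw_norm : ‖w‖ ≤ c₀) :
    ∃ ξ : ℝ, ‖eval ω ξ (conjugacyErr₂ ω α b u w)‖ ≤ ‖eval ω ξ (conjugacyErr₁ ω α a u w)‖
  c₀_le : c₀ ≤ 1 / 100
  c₀_le_η : c₀ ≤ η

lemma FramedCurve.IsApprox.exists_quadratic_correction (h : Γ.IsApprox ω α a b c e)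
    (S : NewtonSetting ω α a b R η c₀ r₀) (L : Loss ω α ρ Λ) (hR : r + 3 * η ≤ R)
    (hr : r' + 2 * ρ ≤ r) (hle : r' ≤ r) (hr₀ : r₀ ≤ r') (he : 0 < e) (hη : Λ ^ 3 * e < η)
    (hc : c + Λ ^ 3 * e ≤ c₀) :
    ∃ u' w' : WienerAlgebra G r', IsSelfAdjoint u' ∧ IsSelfAdjoint w' ∧
      ‖u'‖ ≤ Λ ^ 3 * e ∧ ‖w'‖ ≤ Λ ^ 3 * e ∧
      ‖conjugacyErr₁ ω α a (Γ.u.restrict hle + u') (Γ.w.restrict hle + w')‖ ≤ Λ ^ 8 * e ^ 2 ∧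
      ‖conjugacyErr₂ ω α b (Γ.u.restrict hle + u') (Γ.w.restrict hle + w')‖ ≤ Λ ^ 8 * e ^ 2 := by
  have Λ_pos : 0 < Λ := lt_of_lt_of_le (by norm_num) L.large
  have : 0 < Λ ^ 3 * e := by positivity
  have hc_le : c ≤ 1 / 100 := by linarith [S.c₀_le]
  obtain ⟨u', w', Y, k, u'_real, w'_real, u'_norm, w'_norm, Y_norm, err₁_norm, err₂_eq⟩ :=
    h.exists_correction S.small_a S.small_b (h.inDomain hR (by linarith [S.c₀_le_η])) L hc_le hr
      hle he hη
  have h' := h.toIsNearTrivial.restrict hle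
  have near_one {x : WienerAlgebra G r'} (hx : ‖x - 1‖ ≤ c) : ‖translate ω α x - 1‖ ≤ 1 / 2 := by
    rw [translate_sub_one]
    exact norm_translate_le_of_le (hx.trans (by linarith))
  obtain ⟨ξ, hξ⟩ := S.crossing r' hr₀ (by linarith [NNReal.coe_le_coe.2 hle])
    (Γ.u.restrict hle + u') (Γ.w.restrict hle + w') (h'.real_u.add u'_real)
    (h'.real_w.add w'_real) ((norm_add_le_of_le h'.norm_u u'_norm).trans hc)
    ((norm_add_le_of_le h'.norm_w w'_norm).trans hc)
  have err₂_norm := norm_le_of_mul_eq_smul_add (near_one h'.norm_U) (near_one h'.norm_q) err₂_eq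
    (hξ.trans ((norm_eval_le _).trans err₁_norm))
  have h₆ := L.mul_pow_mul_le (sq_nonneg e) (show 6 < 8 by norm_num)
  have h₇ := L.mul_pow_mul_le (sq_nonneg e) (show 7 < 8 by norm_num)
  have : 0 < Λ ^ 8 * e ^ 2 := by positivity
  exact ⟨u', w', u'_real, w'_real, u'_norm, w'_norm, err₁_norm.trans (by linarith),
    err₂_norm.trans (by linarith)⟩

lemma Loss.exists_normalErr_le (L : Loss ω α ρ Λ) (hr : r' + ρ ≤ r) (hle : r' ≤ r)
    (ha : a.IsSmall R η) (hb : b.IsSmall R η) {u w q : WienerAlgebra G r} (hd : InDomain R η u w)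
    (hu : IsSelfAdjoint u) (hw : IsSelfAdjoint w) (hq : IsSelfAdjoint q)
    (hq_one : ‖q - 1‖ ≤ 1 / 100) (hκ : |κ - 1| ≤ 1 / 100)
    (hm : ‖normalErr ω α a b u w q κ‖ ≤ m) :
    ∃ (q' : WienerAlgebra G r') (κ' : ℝ), IsSelfAdjoint q' ∧ ‖q' - q.restrict hle‖ ≤ 6 * (Λ * m) ∧
      |κ' - κ| ≤ 4 * m ∧
      ‖normalErr ω α a b (u.restrict hle) (w.restrict hle) q' κ'‖ ≤ 27 * (Λ * m ^ 2) := by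
  have M_real : IsSelfAdjoint (normalErr ω α a b u w q κ) :=
    ((isSelfAdjoint_jacobian hu hw ha.isReal hb.isReal).mul hq).sub
      (.smul (Complex.conj_ofReal κ) (hq.map _))
  obtain ⟨z, κ', z_real, z_norm, κ'_le, z_eq⟩ :=
    L.exists_update_multiplier hr hle hκ hq M_real hq_one hm
  have q_norm : ‖q.restrict hle‖ ≤ 2 := norm_restrict_le_of_le hle
    ((norm_le_one_add_of_norm_sub_one_le hq_one).trans (by norm_num))
  refine ⟨q.restrict hle * (1 + z), κ + κ', (hq.map _).mul ((IsSelfAdjoint.one _).add z_real),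
    ?_, by simpa using κ'_le, ?_⟩
  · rw [mul_add, mul_one, add_sub_cancel_left]
    exact (norm_mul_le_of_le q_norm z_norm).trans (by linarith)
  · have normalErr_eq : normalErr ω α a b (u.restrict hle) (w.restrict hle)
        (q.restrict hle * (1 + z)) (κ + κ') = WienerAlgebra.restrict hle
          (normalErr ω α a b u w q κ) * z -
            (κ' : ℂ) • (translate ω α (q.restrict hle) * translate ω α z) := by
      rw [restrict_normalErr hd hle ha hb] at z_eq ⊢
      simp only [normalErr, map_mul, map_add, map_one, Complex.ofReal_add, Algebra.smul_def]
        at z_eq ⊢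
      linear_combination z_eq
    have κ'_norm : ‖(κ' : ℂ)‖ ≤ 4 * m := by rwa [Complex.norm_real]
    rw [normalErr_eq]
    refine (norm_sub_le_of_le (norm_mul_le_of_le (norm_restrict_le_of_le hle hm) z_norm)
      (norm_smul_le_mul_of_le κ'_norm (norm_mul_le_of_le (norm_translate_le_of_le q_norm)
        (norm_translate_le_of_le z_norm)))).trans ?_
    linarith

lemma FramedCurve.IsNearTrivial.exists_add (h : Γ.IsNearTrivial ω c) (L : Loss ω α ρ Λ)
    (hr : r' + ρ ≤ r) (hle : r' ≤ r) {u' w' : WienerAlgebra G r} {q' : WienerAlgebra G r'} {κ' : ℝ}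
    (hu' : IsSelfAdjoint u') (hw' : IsSelfAdjoint w') (hq' : IsSelfAdjoint q')
    (hu'_norm : ‖u'‖ ≤ ν) (hw'_norm : ‖w'‖ ≤ ν) (hq'_norm : ‖q' - Γ.q.restrict hle‖ ≤ δ)
    (hκ' : |κ' - Γ.κ| ≤ δ) (hν : Λ * ν ≤ δ) :
    ∃ Γ' : FramedCurve G r', Γ'.IsNearTrivial ω (c + δ) ∧
      Γ'.u = WienerAlgebra.restrict hle (Γ.u + u') ∧
      Γ'.w = WienerAlgebra.restrict hle (Γ.w + w') ∧ Γ'.q = q' ∧ Γ'.κ = κ' := by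
  have ρ_pos : (0 : ℝ) < ρ := mod_cast L.pos
  have Λ_pos : 0 < Λ := lt_of_lt_of_le (by norm_num) L.large
  obtain ⟨du, hdu⟩ := exists_isDeriv (ω := ω) ρ_pos (mod_cast hr) u'
  obtain ⟨dw, hdw⟩ := exists_isDeriv (ω := ω) ρ_pos (mod_cast hr) w'
  have ν_nonneg := (norm_nonneg _).trans hu'_norm
  have ν_le : ν ≤ δ := le_trans (by nlinarith [L.large]) hν
  have deriv_norm {x : WienerAlgebra G r} {dx : WienerAlgebra G r'} (hx : ‖x‖ ≤ ν)
      (hdx : IsDeriv ω x dx) : ‖dx‖ ≤ δ :=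
    (hdx.norm_le ρ_pos (mod_cast hr)).trans
      ((mul_le_mul L.inv_le hx (norm_nonneg _) Λ_pos.le).trans hν)
  have h' := h.restrict hle
  have U_sub_one : Γ.U.restrict hle + du - 1 = WienerAlgebra.restrict hle (Γ.U - 1) + du := by
    rw [← restrict_sub_one]
    ring
  refine ⟨⟨WienerAlgebra.restrict hle (Γ.u + u'), WienerAlgebra.restrict hle (Γ.w + w'),
    Γ.U.restrict hle + du, Γ.W.restrict hle + dw, q', κ'⟩, ?_, rfl, rfl, rfl, rfl⟩
  exact
  { real_u := (h.real_u.add hu').map _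
    real_w := (h.real_w.add hw').map _
    real_q := hq'
    deriv_u l := by
      simpa only [U_sub_one, restrict_apply] using ((h.deriv_u.restrict hle).add hdu) l
    deriv_w l := by
      simpa using ((h.deriv_w.restrict hle).add hdw) l
    norm_u := norm_restrict_le_of_le hle
      (norm_add_le_of_le h.norm_u (hu'_norm.trans ν_le))
    norm_w := norm_restrict_le_of_le hle
      (norm_add_le_of_le h.norm_w (hw'_norm.trans ν_le))
    norm_U := by
      rw [U_sub_one]
      exact norm_add_le_of_le (norm_restrict_le_of_le hle h.norm_U) (deriv_norm hu'_norm hdu)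
    norm_W := norm_add_le_of_le h'.norm_W (deriv_norm hw'_norm hdw)
    norm_q := by
      rw [← sub_add_sub_cancel' (Γ.q.restrict hle)]
      exact norm_add_le_of_le h'.norm_q hq'_norm
    abs_κ := by
      rw [← sub_add_sub_cancel' Γ.κ]
      exact (abs_add_le _ _).trans (add_le_add h.abs_κ hκ') }

lemma FramedCurve.IsApprox.exists_step (h : Γ.IsApprox ω α a b c e)
    (S : NewtonSetting ω α a b R η c₀ r₀) (L : Loss ω α ρ Λ) (hR : r + 3 * η ≤ R)
    (hr : r' + 3 * ρ ≤ r) (hle : r' ≤ r) (hr₀ : r₀ ≤ r') (he : 0 < e) (hc : 0 ≤ c)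
    (hc₀ : c + Λ ^ 5 * e ≤ c₀) :
    ∃ Γ' : FramedCurve G r', Γ'.IsApprox ω α a b (c + Λ ^ 5 * e) (Λ ^ 8 * e ^ 2) ∧
      ‖Γ'.u - Γ.u.restrict hle‖ ≤ Λ ^ 5 * e ∧ ‖Γ'.w - Γ.w.restrict hle‖ ≤ Λ ^ 5 * e := by
  have Λ_pos : 0 < Λ := lt_of_lt_of_le (by norm_num) L.large
  have h₀ := L.mul_pow_mul_le he.le (show 0 < 3 by norm_num)
  have h₃ := L.mul_pow_mul_le he.le (show 3 < 5 by norm_num)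
  have h₄ := L.mul_pow_mul_le he.le (show 4 < 5 by norm_num)
  have h₇ := L.mul_pow_mul_le (sq_nonneg e) (show 7 < 8 by norm_num)
  have : 0 < Λ ^ 3 * e := by positivity
  have : 0 < Λ ^ 4 * e := by positivity
  have : 0 < Λ ^ 7 * e ^ 2 := by positivity
  have c₀_le := S.c₀_le
  have c₀_le_η := S.c₀_le_η
  have hmid : r' + ρ + 2 * ρ ≤ r := by convert hr using 1; ring
  have hle₁ : r' + ρ ≤ r := le_self_add.trans hmid
  have hle₂ : r' ≤ r' + ρ := le_self_add
  have hd := h.inDomain hR (by linarith)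
  obtain ⟨u', w', u'_real, w'_real, u'_norm, w'_norm, err₁_norm, err₂_norm⟩ :=
    h.exists_quadratic_correction S L hR hmid hle₁ (hr₀.trans hle₂) he (by linarith) (by linarith)
  have h' := h.restrict S.small_a S.small_b hd hle₁
  have hd' := hd.restrict hle₁
  have hd'' : InDomain R η (Γ.u.restrict hle₁ + u') (Γ.w.restrict hle₁ + w') :=
    ⟨hd'.add_le, (norm_add_le_of_le h'.norm_u u'_norm).trans (by linarith),
      (norm_add_le_of_le h'.norm_w w'_norm).trans (by linarith)⟩
  have q_one := h'.norm_q.trans (by linarith : c ≤ 1 / 100)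
  have normalErr_norm := h'.norm_normalErr_add_le S.small_a S.small_b hd' hd'' L he u'_norm w'_norm
    (by linarith) q_one
  obtain ⟨q', κ', q'_real, q'_norm, κ'_le, normalErr_norm'⟩ :=
    L.exists_normalErr_le le_rfl hle₂ S.small_a S.small_b hd'' (h'.real_u.add u'_real)
      (h'.real_w.add w'_real) h'.real_q q_one (h'.abs_κ.trans (by linarith)) normalErr_norm
  obtain ⟨Γ', hΓ', Γ'_u, Γ'_w, Γ'_q, Γ'_κ⟩ := h'.exists_add (δ := Λ ^ 5 * e) L le_rfl hle₂
    u'_real w'_real q'_real u'_norm w'_norm (q'_norm.trans (by linarith))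
    (κ'_le.trans (by linarith)) (by linarith)
  refine ⟨Γ', ⟨hΓ', ?_, ?_, ?_⟩, ?_, ?_⟩
  · rw [Γ'_u, Γ'_w, restrict_u, restrict_w, ← restrict_conjugacyErr₁ hd'' hle₂ S.small_a]
    exact norm_restrict_le_of_le hle₂ err₁_norm
  · rw [Γ'_u, Γ'_w, restrict_u, restrict_w, ← restrict_conjugacyErr₂ hd'' hle₂ S.small_b]
    exact norm_restrict_le_of_le hle₂ err₂_norm
  · rw [Γ'_u, Γ'_w, Γ'_q, Γ'_κ]
    exact normalErr_norm'.trans (by linarith)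
  · rw [Γ'_u, map_add, restrict_u, restrict_restrict, add_sub_cancel_left]
    exact norm_restrict_le_of_le hle₂ (u'_norm.trans (by linarith))
  · rw [Γ'_w, map_add, restrict_w, restrict_restrict, add_sub_cancel_left]
    exact norm_restrict_le_of_le hle₂ (w'_norm.trans (by linarith))

end NewtonStep

/-! ### The intersection property -/

section Reparametrization

open WienerAlgebra Germ

variable {G : Type*} [SeminormedAddCommGroup G] {r r' : ℝ≥0} {ω : Frequency G} {c : ℝ}

namespace WienerAlgebra

/-- The holomorphic function on the strip `|Im z| < r` with the given Fourier coefficients. -/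
def stripEval (ω : Frequency G) (x : WienerAlgebra G r) (z : ℂ) : ℂ :=
  ∑' l, x l * Complex.exp (I * ω l * z)

lemma stripEval_ofReal (x : WienerAlgebra G r) (ξ : ℝ) : stripEval ω x ξ = eval ω ξ x := rfl

lemma hasSum_stripEval (x : WienerAlgebra G r) {z : ℂ} (hz : |z.im| ≤ r) :
    HasSum (fun l => x l * Complex.exp (I * ω l * z)) (stripEval ω x z) := by
  refine (Summable.of_norm_bounded x.summable fun l => ?_).hasSum
  rw [norm_mul, Complex.norm_exp]
  refine mul_le_mul_of_nonneg_left (Real.exp_le_exp.2 ?_) (norm_nonneg _)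
  calc (I * ω l * z).re = -(ω l * z.im) := by simp
    _ ≤ |ω l| * |z.im| := by rw [← abs_mul]; exact neg_le_abs _
    _ ≤ ‖l‖ * r := by gcongr; exact ω.abs_le l
    _ = r * ‖l‖ := mul_comm _ _

lemma _root_.Frequency.norm_phase_sub_phase_le (ω : Frequency G) (s t : ℝ) (l : G) :
    ‖ω.phase s l - ω.phase t l‖ ≤ |ω l| * |s - t| := by
  have factor : ω.phase s l - ω.phase t l =
      ω.phase t l * (Complex.exp (I * (ω l * (s - t) : ℝ)) - 1) := by
    rw [mul_sub, mul_one, Frequency.phase_apply, Frequency.phase_apply, ← Complex.exp_add]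
    push_cast
    ring_nf
  rw [factor, norm_mul, Frequency.norm_phase, one_mul, ← abs_mul]
  exact Real.norm_exp_I_mul_ofReal_sub_one_le

lemma norm_eval_sub_eval_le (hr : 0 < r) (x : WienerAlgebra G r) (ξ ξ' : ℝ) :
    ‖eval ω ξ x - eval ω ξ' x‖ ≤ (r : ℝ)⁻¹ * ‖x‖ * |ξ - ξ'| := by
  have hs (ξ : ℝ) : HasSum (fun l => x l * ω.phase ξ l) (eval ω ξ x) :=
    hasSum_stripEval x (by simp)
  have bound := (x.summable.hasSum.mul_left (r : ℝ)⁻¹).mul_right |ξ - ξ'|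
  rw [← norm_def] at bound
  rw [← ((hs ξ).sub (hs ξ')).tsum_eq]
  refine tsum_of_norm_bounded bound fun l => ?_
  have frequency_le : |ω l| ≤ (r : ℝ)⁻¹ * expWeight r l := by
    simpa [expWeight] using ω.abs_mul_expWeight_le (r' := 0) (NNReal.coe_pos.2 hr) (by simp) l
  rw [← mul_sub, norm_mul]
  calc ‖x l‖ * ‖ω.phase ξ l - ω.phase ξ' l‖
      ≤ ‖x l‖ * ((r : ℝ)⁻¹ * expWeight r l * |ξ - ξ'|) := by
        gcongr
        exact (ω.norm_phase_sub_phase_le ξ ξ' l).trans (by gcongr)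
    _ = (r : ℝ)⁻¹ * (‖x l‖ * expWeight r l) * |ξ - ξ'| := by ring

end WienerAlgebra

namespace Germ

/-- A function of `x` as a germ that does not depend on `y`. -/
def const (x : WienerAlgebra G r) : Germ G := fun j => if j.2 = 0 then x j.1 else 0

lemma hasSum_iff_of_snd_ne_zero {ι E : Type*} [AddCommMonoid E] [TopologicalSpace E]
    {F : ι × ℕ → E} (hF : ∀ l k, k ≠ 0 → F (l, k) = 0) {y : E} :
    HasSum F y ↔ HasSum (fun l => F (l, 0)) y := by
  refine ((Prod.mk_left_injective (0 : ℕ)).hasSum_iff ?_).symm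
  rintro ⟨l, k⟩ hlk
  exact hF l k fun hk => hlk ⟨l, by rw [hk]⟩

lemma hasBound_const (x : WienerAlgebra G r) (s : ℝ) : (const x).HasBound r s ‖x‖ := by
  have hs : HasSum (fun j => ‖const x j‖ * (s ^ j.2 * expWeight r j.1)) ‖x‖ := by
    rw [hasSum_iff_of_snd_ne_zero fun l k hk => by simp [const, hk], norm_def]
    simpa [const] using x.summable.hasSum
  exact ⟨hs.summable, hs.tsum_eq.le⟩

lemma isReal_const {x : WienerAlgebra G r} (hx : IsSelfAdjoint x) : (const x).IsReal := by
  intro l k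
  have := conj_apply_neg hx (-l)
  by_cases hk : k = 0 <;> simp_all [const]

end Germ

namespace WienerAlgebra

/-- The function `ξ ↦ x (ξ + h ξ)`. -/
def compIdAdd (ω : Frequency G) (x : WienerAlgebra G r) (h : WienerAlgebra G r') :
    WienerAlgebra G r' :=
  subst ω (const x) h 0

variable (x : WienerAlgebra G r) {h : WienerAlgebra G r'}

lemma norm_compIdAdd_le (hh : r' + ‖h‖ ≤ r) : ‖compIdAdd ω x h‖ ≤ ‖x‖ :=
  norm_subst_le (hasBound_const x 0) ⟨by simpa using hh, by simp⟩

lemma isSelfAdjoint_compIdAdd {x : WienerAlgebra G r} (hx : IsSelfAdjoint x)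
    (hh : IsSelfAdjoint h) : IsSelfAdjoint (compIdAdd ω x h) :=
  isSelfAdjoint_subst (isReal_const hx) hh (.zero _)

lemma eval_compIdAdd (hh : r' + ‖h‖ ≤ r) (hh' : IsSelfAdjoint h) (ξ : ℝ) :
    eval ω ξ (compIdAdd ω x h) = eval ω (ξ + (eval ω ξ h).re) x := by
  have hs := hasSum_eval_subst (ω := ω) (w := (0 : WienerAlgebra G r')) (hasBound_const x 0)
    ⟨by simpa using hh, by simp⟩ ξ
  rw [hasSum_iff_of_snd_ne_zero fun l k hk => by simp [const, hk]] at hs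
  rw [compIdAdd, ← hs.tsum_eq, ← stripEval_ofReal x, stripEval]
  simp [const, ofReal_re_eval hh']

lemma norm_compIdAdd_sub_le {h' : WienerAlgebra G r'} {η : ℝ} (hh : r' + ‖h‖ + η ≤ r)
    (hη : ‖h' - h‖ < η) :
    ‖compIdAdd ω x h' - compIdAdd ω x h‖ ≤ 2 * ‖x‖ / η * ‖h' - h‖ := by
  rcases (norm_nonneg (h' - h)).eq_or_lt with h0 | hpos
  · rw [← h0, mul_zero, sub_eq_zero.1 (norm_eq_zero.1 h0.symm), sub_self, norm_zero]
  have lipschitz := norm_subst_add_sub_le (ω := ω) (w := (0 : WienerAlgebra G r')) (w' := 0)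
    (hasBound_const x η) ⟨hh, by simp⟩ hpos le_rfl (by simp) hη
  rw [add_sub_cancel, add_zero] at lipschitz
  exact lipschitz.trans_eq (by ring)

lemma exists_eq_neg_compIdAdd {u : WienerAlgebra G r} (hr : 0 < r) (hu : IsSelfAdjoint u)
    (hc : 64 * c ≤ r) (hu_norm : ‖u‖ ≤ c) :
    ∃ h : WienerAlgebra G (r / 2), IsSelfAdjoint h ∧ ‖h‖ ≤ c ∧ h = -compIdAdd ω u h := by
  have : (0 : ℝ) < r := hr
  have half_add : ((r / 2 : ℝ≥0) : ℝ) + c + r / 4 ≤ r := by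
    push_cast
    linarith
  set S : Set (WienerAlgebra G (r / 2)) := {h | ‖h‖ ≤ c ∧ IsSelfAdjoint h}
  have complete : IsComplete S :=
    ((isClosed_le continuous_norm continuous_const).inter
      (isClosed_eq continuous_star continuous_id)).isComplete
  have maps_to : Set.MapsTo (fun h => -compIdAdd ω u h) S S := fun h hh => by
    refine ⟨?_, (isSelfAdjoint_compIdAdd hu hh.2).neg⟩
    rw [norm_neg]
    exact (norm_compIdAdd_le u (by linarith [hh.1])).trans hu_norm
  have contracting : ContractingWith (1 / 2) (maps_to.restrict _ S S) := by
    refine ⟨by rw [← NNReal.coe_lt_coe]; norm_num, LipschitzWith.of_dist_le_mul ?_⟩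
    rintro ⟨x, hx⟩ ⟨y, hy⟩
    have x_sub_y := norm_sub_le_of_le hx.1 hy.1
    have lipschitz := norm_compIdAdd_sub_le (ω := ω) u (h := y) (h' := x) (η := r / 4)
      (by linarith [hy.1]) (by linarith)
    have coeff_le : 2 * ‖u‖ / (r / 4) ≤ 1 / 2 := by
      rw [div_le_iff₀ (by positivity)]
      linarith
    simp only [Set.MapsTo.restrict, Subtype.map, Subtype.dist_eq, dist_eq_norm, neg_sub_neg]
    rw [norm_sub_rev]
    exact lipschitz.trans (by push_cast; gcongr)
  obtain ⟨h, hS, fixed, -⟩ := contracting.exists_fixedPoint' complete maps_to (x := 0)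
    ⟨by simpa using (norm_nonneg u).trans hu_norm, .zero _⟩ (edist_ne_top _ _)
  exact ⟨h, hS.2, hS.1, fixed.symm⟩

lemma exists_graph {u w : WienerAlgebra G r} (hr : 0 < r) (hu : IsSelfAdjoint u)
    (hw : IsSelfAdjoint w) (hc : 64 * c ≤ r) (hu_norm : ‖u‖ ≤ c) (α : ℝ) :
    ∃ (ψ : WienerAlgebra G (r / 2)) (Ξ : ℝ → ℝ), IsSelfAdjoint ψ ∧ ∀ x : ℝ,
      eval ω x ψ = α + eval ω (Ξ x) w ∧ Ξ x + eval ω (Ξ x) u = x := by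
  obtain ⟨h, h_real, h_norm, h_eq⟩ := exists_eq_neg_compIdAdd (ω := ω) hr hu hc hu_norm
  have hh : ((r / 2 : ℝ≥0) : ℝ) + ‖h‖ ≤ r := by
    push_cast
    linarith [(norm_nonneg u).trans hu_norm]
  refine ⟨(α : ℂ) • 1 + compIdAdd ω w h, fun x => x + (eval ω x h).re,
    (IsSelfAdjoint.smul (Complex.conj_ofReal α) (.one _)).add (isSelfAdjoint_compIdAdd hw h_real),
    fun x => ⟨?_, ?_⟩⟩
  · rw [map_add, map_smul, map_one, smul_eq_mul, mul_one, eval_compIdAdd w hh h_real]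
  · rw [← eval_compIdAdd u hh h_real, Complex.ofReal_add, ofReal_re_eval h_real]
    nth_rw 1 [h_eq]
    rw [map_neg, neg_add_cancel_right]

end WienerAlgebra

end Reparametrization

section Crossing

open WienerAlgebra Germ

variable {G : Type*} [SeminormedAddCommGroup G] {r R : ℝ≥0} {ω : Frequency G} {α s c η : ℝ}
  {a b : Germ G} {f g : ℂ → ℂ → ℂ} {u w : WienerAlgebra G r}

/-- The map `(x, y) ↦ (x + y + f(x, y), y + g(x, y))` moves no real graph `y = ψ x` off itself as
long as `|ψ - α| < s`. -/
def IntersectsGraphs (ω : Frequency G) (α s : ℝ) (f g : ℂ → ℂ → ℂ) : Prop :=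
  ∀ (r : ℝ≥0) (ψ : WienerAlgebra G r), 0 < r → IsSelfAdjoint ψ →
    (∀ x : ℝ, ‖eval ω x ψ - α‖ < s) → ∃ x x' : ℝ,
      x + eval ω x ψ + f x (eval ω x ψ) = x' ∧ eval ω x ψ + g x (eval ω x ψ) = eval ω x' ψ

/-- The series with coefficients `a` represents `f` at the real points near the line `y = α`. -/
def Germ.Represents (ω : Frequency G) (α s : ℝ) (a : Germ G) (f : ℂ → ℂ → ℂ) : Prop :=
  ∀ x y : ℝ, |y| ≤ s →
    HasSum (fun j => a j * (y : ℂ) ^ j.2 * Complex.exp (I * ω j.1 * x)) (f x (α + y : ℝ))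

lemma Germ.Represents.eval_subst (hf : a.Represents ω α (3 * η) f) (ha : a.IsSmall R η)
    (hd : InDomain R η u w) (hu : IsSelfAdjoint u) (hw : IsSelfAdjoint w) (ξ : ℝ) :
    eval ω ξ (subst ω a u w) = f (ξ + eval ω ξ u) (α + eval ω ξ w) := by
  have w_norm : ‖w‖ ≤ 3 * η := by linarith [hd.norm_right_le, ha.pos]
  have value := hf (ξ + (eval ω ξ u).re) (eval ω ξ w).re
    ((Complex.abs_re_le_norm _).trans ((norm_eval_le w).trans w_norm))
  push_cast [ofReal_re_eval hu, ofReal_re_eval hw] at value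
  exact (hasSum_eval_subst ha.bound
    ⟨by linarith [hd.add_le, hd.norm_left_le, ha.pos], by simpa using w_norm⟩ ξ).unique value

lemma IntersectsGraphs.exists_norm_eval_conjugacyErr_le (h : IntersectsGraphs ω α s f g)
    (ha : a.IsSmall R η) (hb : b.IsSmall R η) (hf : a.Represents ω α (3 * η) f)
    (hg : b.Represents ω α (3 * η) g) (hs : η < s) (hr : 0 < r) (hd : InDomain R η u w)
    (hcr : 64 * c ≤ r) (hu : IsSelfAdjoint u) (hw : IsSelfAdjoint w) (hu_norm : ‖u‖ ≤ c)
    (hw_norm : ‖w‖ ≤ c) :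
    ∃ ξ : ℝ, ‖eval ω ξ (conjugacyErr₂ ω α b u w)‖ ≤ ‖eval ω ξ (conjugacyErr₁ ω α a u w)‖ := by
  obtain ⟨ψ, Ξ, ψ_real, graph⟩ := exists_graph (ω := ω) hr hu hw hcr hu_norm α
  obtain ⟨x, x', fst_eq, snd_eq⟩ := h _ ψ (half_pos hr) ψ_real fun x => by
    rw [(graph x).1, add_sub_cancel_left]
    exact (norm_eval_le w).trans_lt (hd.norm_right_le.trans_lt hs)
  obtain ⟨ψ_eq, Ξ_eq⟩ := graph x
  obtain ⟨ψ_eq', Ξ_eq'⟩ := graph x'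
  set ξ := Ξ x
  set ξ' := Ξ x'
  have f_eq := hf.eval_subst ha hd hu hw ξ
  have g_eq := hg.eval_subst hb hd hu hw ξ
  rw [Ξ_eq, ← ψ_eq] at f_eq g_eq
  have err₁_eq : eval ω ξ (conjugacyErr₁ ω α a u w) =
      ((ξ' - (ξ + α) : ℝ) : ℂ) - (eval ω (ξ + α) u - eval ω ξ' u) := by
    simp only [conjugacyErr₁, map_add, map_sub, eval_translate, f_eq]
    push_cast
    linear_combination fst_eq - ψ_eq + Ξ_eq - Ξ_eq'
  have err₂_eq : eval ω ξ (conjugacyErr₂ ω α b u w) = eval ω ξ' w - eval ω (ξ + α) w := by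
    simp only [conjugacyErr₂, map_add, map_sub, eval_translate, g_eq]
    linear_combination snd_eq - ψ_eq + ψ_eq'
  have lipschitz {x : WienerAlgebra G r} (hx : ‖x‖ ≤ c) (s t : ℝ) :
      ‖eval ω s x - eval ω t x‖ ≤ 1 / 2 * |s - t| := by
    refine (norm_eval_sub_eval_le hr x s t).trans ?_
    gcongr
    rw [inv_mul_le_iff₀ (NNReal.coe_pos.2 hr)]
    linarith [norm_nonneg x]
  refine ⟨ξ, ?_⟩
  rw [err₁_eq, err₂_eq]
  have triangle := norm_sub_norm_le ((ξ' - (ξ + α) : ℝ) : ℂ) (eval ω (ξ + α) u - eval ω ξ' u)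
  rw [Complex.norm_real, Real.norm_eq_abs] at triangle
  linarith [lipschitz hu_norm (ξ + α) ξ', lipschitz hw_norm ξ' (ξ + α), abs_sub_comm ξ' (ξ + α)]

end Crossing

/-! ### Convergence of the iteration -/

section Convergence

open WienerAlgebra Germ FramedCurve Filter
open scoped Topology

variable {G : Type*} [SeminormedAddCommGroup G] {r r₀ R ρ ρ' ρ₀ : ℝ≥0} {ω : Frequency G}
  {α c c' c₀ d e e' η K : ℝ} {a b : Germ G} {u w : WienerAlgebra G r}

namespace Germ.IsSmall

lemma continuousAt_subst (ha : a.IsSmall R η) (hd : InDomain R η u w) :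
    ContinuousAt (fun p : WienerAlgebra G r × WienerAlgebra G r => subst ω a p.1 p.2) (u, w) := by
  have hη := ha.pos
  refine Metric.continuousAt_iff.2 fun ε hε => ⟨min ε (η / 4), by positivity, fun {p} hp => ?_⟩
  obtain ⟨hp₁, hp₂⟩ := max_lt_iff.1 hp
  rw [dist_eq_norm] at hp₁ hp₂
  have lipschitz := (ha.hasBoundNear hd).norm_subst_add_sub_le (ω := ω)
    (lt_min hε (by positivity)) hp₁.le hp₂.le (by linarith [min_le_right ε (η / 4)])
  rw [add_sub_cancel, add_sub_cancel,
    show 2 * (η ^ 2 / 1600) * min ε (η / 4) / η = η / 800 * min ε (η / 4) by field_simp; norm_num]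
    at lipschitz
  rw [dist_eq_norm]
  nlinarith [ha.le_one, min_le_left ε (η / 4)]

variable {x y : ℕ → WienerAlgebra G r}

lemma tendsto_conjugacyErr₁ (ha : a.IsSmall R η) (hd : InDomain R η u w)
    (hx : Tendsto x atTop (𝓝 u)) (hy : Tendsto y atTop (𝓝 w)) :
    Tendsto (fun n => conjugacyErr₁ ω α a (x n) (y n)) atTop (𝓝 (conjugacyErr₁ ω α a u w)) :=
  ((hx.add hy).add ((ha.continuousAt_subst hd).tendsto.comp (hx.prodMk_nhds hy))).sub
    ((continuous_translate.tendsto u).comp hx)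

lemma tendsto_conjugacyErr₂ (hb : b.IsSmall R η) (hd : InDomain R η u w)
    (hx : Tendsto x atTop (𝓝 u)) (hy : Tendsto y atTop (𝓝 w)) :
    Tendsto (fun n => conjugacyErr₂ ω α b (x n) (y n)) atTop (𝓝 (conjugacyErr₂ ω α b u w)) :=
  (hy.add ((hb.continuousAt_subst hd).tendsto.comp (hx.prodMk_nhds hy))).sub
    ((continuous_translate.tendsto w).comp hy)

end Germ.IsSmall

namespace FramedCurve

lemma IsNearTrivial.mono {Γ : FramedCurve G r} (h : Γ.IsNearTrivial ω c) (hc : c ≤ c') :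
    Γ.IsNearTrivial ω c' :=
  { h with
    norm_u := h.norm_u.trans hc
    norm_w := h.norm_w.trans hc
    norm_U := h.norm_U.trans hc
    norm_W := h.norm_W.trans hc
    norm_q := h.norm_q.trans hc
    abs_κ := h.abs_κ.trans hc }

lemma IsApprox.mono {Γ : FramedCurve G r} (h : Γ.IsApprox ω α a b c e) (hc : c ≤ c')
    (he : e ≤ e') : Γ.IsApprox ω α a b c' e' where
  toIsNearTrivial := h.toIsNearTrivial.mono hc
  norm_err₁ := h.norm_err₁.trans he
  norm_err₂ := h.norm_err₂.trans he
  norm_normalErr := h.norm_normalErr.trans he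

/-- The curve `(ξ, 0)` with its standard frame. -/
@[simps]
def trivial (G : Type*) [SeminormedAddCommGroup G] (r : ℝ≥0) : FramedCurve G r where
  u := 0
  w := 0
  U := 1
  W := 0
  q := 1
  κ := 1

lemma isNearTrivial_trivial : (trivial G r).IsNearTrivial ω 0 where
  real_u := .zero _
  real_w := .zero _
  real_q := .one _
  deriv_u l := by simp
  deriv_w l := by simp
  norm_u := by simp
  norm_w := by simp
  norm_U := by simp
  norm_W := by simp
  norm_q := by simp
  abs_κ := by simp

lemma isApprox_trivial (hη : 0 < η) (hη₁ : η ≤ 1) (ha : a.HasBound R (3 * η) d)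
    (hb : b.HasBound R (3 * η) d) (hr : r + 3 * η ≤ R) (hd : 5 * d ≤ η * e) (he : e ≤ 1) :
    (trivial G r).IsApprox ω α a b 0 e := by
  have d_nonneg : 0 ≤ d := ha.nonneg (by positivity)
  have deriv_le : 5 * (η⁻¹ * d) ≤ e := by
    rwa [mul_left_comm, inv_mul_le_iff₀ hη]
  have hdη : 0 ≤ η⁻¹ * d := by positivity
  have d_le : d ≤ e := by nlinarith
  have domain {R' : ℝ≥0} {s : ℝ} (hR' : r ≤ R') (hs : 0 ≤ s) :
      InPolydisc R' s 0 (0 : WienerAlgebra G r) 0 := ⟨by simpa using hR', by simpa using hs⟩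
  have hrR : r ≤ R := NNReal.coe_le_coe.1 (by linarith)
  have norm_subst_le' {a : Germ G} (h : a.HasBound R (3 * η) d) :
      ‖subst ω a (0 : WienerAlgebra G r) 0‖ ≤ d := norm_subst_le h (domain hrR (by positivity))
  have norm_dx_le {a : Germ G} (h : a.HasBound R (3 * η) d) :
      ‖subst ω (a.dx ω) (0 : WienerAlgebra G r) 0‖ ≤ η⁻¹ * d :=
    norm_subst_le (h.dx (R' := r) (by positivity) hη (by linarith)) (domain le_rfl (by positivity))
  have norm_dy_le {a : Germ G} (h : a.HasBound R (3 * η) d) :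
      ‖subst ω a.dy (0 : WienerAlgebra G r) 0‖ ≤ η⁻¹ * d :=
    norm_subst_le (h.dy (s' := 2 * η) (by positivity) hη (by linarith))
      (domain hrR (by positivity))
  refine ⟨isNearTrivial_trivial, ?_, ?_, ?_⟩
  · simpa [conjugacyErr₁] using (norm_subst_le' ha).trans d_le
  · simpa [conjugacyErr₂] using (norm_subst_le' hb).trans d_le
  · have normalErr_eq : normalErr ω α a b (0 : WienerAlgebra G r) 0 1 1 =
        subst ω (a.dx ω) 0 0 + subst ω b.dy 0 0 + subst ω (a.dx ω) 0 0 * subst ω b.dy 0 0 -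
          (subst ω (b.dx ω) 0 0 + subst ω a.dy 0 0 * subst ω (b.dx ω) 0 0) := by
      simp only [normalErr, jacobian, map_one, Complex.ofReal_one, one_smul, mul_one]
      ring
    refine (congrArg _ normalErr_eq).trans_le ((norm_sub_le_of_le
      (norm_add_le_of_le (norm_add_le_of_le (norm_dx_le ha) (norm_dy_le hb))
        (norm_mul_le_of_le (norm_dx_le ha) (norm_dy_le hb)))
      (norm_add_le_of_le (norm_dx_le hb)
        (norm_mul_le_of_le (norm_dy_le ha) (norm_dx_le hb)))).trans ?_)
    nlinarith

end FramedCurve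

/-- The error allowed when the remaining loss of radius is proportional to `ρ`: a loss `ρ` costs a
factor `exp (K / ρ ^ 5)`, and the fortieth power makes Newton's quadratic gain
`Λ ^ 8 * e ^ 2 ≤ e'` compatible with replacing `ρ` by `9 / 10 * ρ`. -/
def newtonError (K ρ : ℝ) : ℝ := Real.exp (-(40 * (K / ρ ^ 5)))

lemma newtonError_pos (K ρ : ℝ) : 0 < newtonError K ρ := Real.exp_pos _

lemma Loss.exp_neg_le (L : Loss ω α ρ (Real.exp K)) : Real.exp (-K) ≤ ρ := by
  rw [Real.exp_neg]
  exact (inv_le_comm₀ (Real.exp_pos _) L.pos).2 L.inv_le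

lemma Loss.newtonError_le (hK : 0 < K) (L : Loss ω α ρ (Real.exp (K / ρ ^ 5))) :
    newtonError K ρ ≤ ρ := by
  have : 0 < K / (ρ : ℝ) ^ 5 := div_pos hK (pow_pos L.pos 5)
  exact (Real.exp_le_exp.2 (by linarith)).trans L.exp_neg_le

lemma Loss.exp_pow_mul_newtonError_le (hK : 0 < K) (L : Loss ω α ρ (Real.exp (K / ρ ^ 5))) :
    Real.exp (K / ρ ^ 5) ^ 5 * newtonError K ρ ≤ ρ := by
  have : 0 < K / (ρ : ℝ) ^ 5 := div_pos hK (pow_pos L.pos 5)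
  rw [newtonError, ← Real.exp_nat_mul, ← Real.exp_add]
  exact (Real.exp_le_exp.2 (by push_cast; linarith)).trans L.exp_neg_le

lemma exp_pow_mul_newtonError_sq_le (hK : 0 < K) {ρ : ℝ} (hρ : 0 < ρ) :
    Real.exp (K / ρ ^ 5) ^ 8 * newtonError K ρ ^ 2 ≤ newtonError K (9 / 10 * ρ) := by
  have : 0 < K / ρ ^ 5 := by positivity
  have scale : K / (9 / 10 * ρ) ^ 5 = (10 / 9) ^ 5 * (K / ρ ^ 5) := by field_simp
  simp only [newtonError, ← Real.exp_nat_mul, ← Real.exp_add, scale]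
  exact Real.exp_le_exp.2 (by push_cast; linarith)

lemma exists_dependent_sequence {S : ℕ → Type*} {P : ∀ n, S n → S (n + 1) → Prop} (s₀ : S 0)
    (h : ∀ n s, ∃ s', P n s s') : ∃ s : ∀ n, S n, ∀ n, P n (s n) (s (n + 1)) := by
  choose f hf using h
  exact ⟨fun n => Nat.rec s₀ f n, fun n => hf n _⟩

namespace NewtonSetting

variable (S : NewtonSetting ω α a b R η c₀ r₀) (hK : 0 < K)

include S hK

lemma exists_next (L : Loss ω α ρ (Real.exp (K / ρ ^ 5))) (hρc : 10 * ρ ≤ c₀)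
    (hR : r₀ + 30 * ρ + 3 * η ≤ R) (hρ' : ρ' = 9 / 10 * ρ) {Γ : FramedCurve G (r₀ + 30 * ρ)}
    (h : Γ.IsApprox ω α a b (c₀ - 10 * ρ) (newtonError K ρ)) :
    ∃ Γ' : FramedCurve G (r₀ + 30 * ρ'),
      Γ'.IsApprox ω α a b (c₀ - 10 * ρ') (newtonError K ρ') ∧
        ‖Γ'.u.restrict (le_self_add : r₀ ≤ _) - Γ.u.restrict le_self_add‖ ≤ ρ ∧
        ‖Γ'.w.restrict (le_self_add : r₀ ≤ _) - Γ.w.restrict le_self_add‖ ≤ ρ := by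
  have hρ'_coe : (ρ' : ℝ) = 9 / 10 * ρ := by rw [hρ']; push_cast; rfl
  have hr : r₀ + 30 * ρ' + 3 * ρ ≤ r₀ + 30 * ρ := by
    rw [← NNReal.coe_le_coe]
    push_cast
    linarith
  have hle : r₀ + 30 * ρ' ≤ r₀ + 30 * ρ := le_self_add.trans hr
  have step_le := L.exp_pow_mul_newtonError_le hK
  obtain ⟨Γ', h', u_norm, w_norm⟩ := h.exists_step S L (by push_cast; exact hR) hr hle le_self_add
    (newtonError_pos _ _) (by linarith) (by linarith [ρ.coe_nonneg])
  refine ⟨Γ', h'.mono (by linarith) (hρ'_coe ▸ exp_pow_mul_newtonError_sq_le hK L.pos), ?_, ?_⟩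
  · simpa only [map_sub, restrict_restrict] using
      norm_restrict_le_of_le le_self_add (u_norm.trans step_le)
  · simpa only [map_sub, restrict_restrict] using
      norm_restrict_le_of_le le_self_add (w_norm.trans step_le)

lemma exists_sequence (hρ₀ : 0 < ρ₀)
    (hL : ∀ ρ : ℝ≥0, 0 < ρ → ρ ≤ ρ₀ → Loss ω α ρ (Real.exp (K / ρ ^ 5))) (hρc : 10 * ρ₀ ≤ c₀)
    (hR : r₀ + 30 * ρ₀ + 3 * η ≤ R) (ha : a.HasBound R (3 * η) d) (hb : b.HasBound R (3 * η) d)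
    (hd : 5 * d ≤ η * newtonError K ρ₀) :
    ∃ u w : ℕ → WienerAlgebra G r₀, ∀ n,
      (IsSelfAdjoint (u n) ∧ IsSelfAdjoint (w n) ∧ ‖u n‖ ≤ c₀ ∧ ‖w n‖ ≤ c₀) ∧
      (‖conjugacyErr₁ ω α a (u n) (w n)‖ ≤ ρ₀ * (9 / 10) ^ n ∧
        ‖conjugacyErr₂ ω α b (u n) (w n)‖ ≤ ρ₀ * (9 / 10) ^ n) ∧
      ‖u (n + 1) - u n‖ ≤ ρ₀ * (9 / 10) ^ n ∧ ‖w (n + 1) - w n‖ ≤ ρ₀ * (9 / 10) ^ n := by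
  let ρ (n : ℕ) : ℝ≥0 := ρ₀ * (9 / 10) ^ n
  have ρ_coe (n : ℕ) : (ρ n : ℝ) = ρ₀ * (9 / 10) ^ n := by simp [ρ]
  have ρ_le (n : ℕ) : ρ n ≤ ρ₀ := mul_le_of_le_one_right hρ₀.le
    (pow_le_one₀ (by positivity) (by rw [← NNReal.coe_le_coe]; norm_num))
  have ρ_le' (n : ℕ) : (ρ n : ℝ) ≤ ρ₀ := ρ_le n
  have loss (n : ℕ) : Loss ω α (ρ n) (Real.exp (K / ρ n ^ 5)) := hL _ (by positivity) (ρ_le n)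
  have start : (trivial G (r₀ + 30 * ρ 0)).IsApprox ω α a b (c₀ - 10 * ρ 0)
      (newtonError K (ρ 0)) := by
    refine (isApprox_trivial S.small_a.pos S.small_a.le_one ha hb ?_ ?_ ?_).mono
      (by linarith [ρ_le' 0]) le_rfl
    · push_cast
      linarith [ρ_le' 0]
    · simpa [ρ] using hd
    · have := (loss 0).pos
      exact Real.exp_le_one_iff.2 (neg_nonpos.2 (by positivity))
  obtain ⟨Γ, increment⟩ := exists_dependent_sequence
    (S := fun n => {Γ : FramedCurve G (r₀ + 30 * ρ n) //
      Γ.IsApprox ω α a b (c₀ - 10 * ρ n) (newtonError K (ρ n))})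
    (P := fun n Γ Γ' =>
      ‖Γ'.1.u.restrict (le_self_add : r₀ ≤ _) - Γ.1.u.restrict le_self_add‖ ≤ ρ n ∧
      ‖Γ'.1.w.restrict (le_self_add : r₀ ≤ _) - Γ.1.w.restrict le_self_add‖ ≤ ρ n)
    ⟨_, start⟩ fun n Γ => by
      obtain ⟨Γ', h', hu, hw⟩ := S.exists_next hK (loss n) (by linarith [ρ_le' n])
        (by linarith [ρ_le' n]) (show ρ (n + 1) = 9 / 10 * ρ n by simp only [ρ]; ring) Γ.2
      exact ⟨⟨Γ', h'⟩, hu, hw⟩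
  refine ⟨fun n => (Γ n).1.u.restrict le_self_add, fun n => (Γ n).1.w.restrict le_self_add,
    fun n => ?_⟩
  have approx := (Γ n).2.mono (sub_le_self c₀ (by positivity)) ((loss n).newtonError_le hK)
  have near := approx.restrict S.small_a S.small_b
    (approx.inDomain (by push_cast; linarith [ρ_le' n]) S.c₀_le_η) (le_self_add : r₀ ≤ _)
  simp only [← ρ_coe]
  exact ⟨⟨near.real_u, near.real_w, near.norm_u, near.norm_w⟩, ⟨near.norm_err₁, near.norm_err₂⟩,
    increment n⟩

theorem exists_conjugacy (hρ₀ : 0 < ρ₀)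
    (hL : ∀ ρ : ℝ≥0, 0 < ρ → ρ ≤ ρ₀ → Loss ω α ρ (Real.exp (K / ρ ^ 5))) (hρc : 10 * ρ₀ ≤ c₀)
    (hR : r₀ + 30 * ρ₀ + 3 * η ≤ R) (ha : a.HasBound R (3 * η) d) (hb : b.HasBound R (3 * η) d)
    (hd : 5 * d ≤ η * newtonError K ρ₀) :
    ∃ u w : WienerAlgebra G r₀, IsSelfAdjoint u ∧ IsSelfAdjoint w ∧ ‖u‖ ≤ c₀ ∧ ‖w‖ ≤ c₀ ∧
      conjugacyErr₁ ω α a u w = 0 ∧ conjugacyErr₂ ω α b u w = 0 := by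
  obtain ⟨x, y, h⟩ := S.exists_sequence hK hρ₀ hL hρc hR ha hb hd
  choose properties errors increments using h
  have bound_tendsto : Tendsto (fun n : ℕ => (ρ₀ : ℝ) * (9 / 10) ^ n) atTop (𝓝 0) := by
    simpa using (tendsto_pow_atTop_nhds_zero_of_lt_one (r := (9 / 10 : ℝ)) (by norm_num)
      (by norm_num)).const_mul (ρ₀ : ℝ)
  have exists_limit {x : ℕ → WienerAlgebra G r₀}
      (hx : ∀ n, ‖x (n + 1) - x n‖ ≤ ρ₀ * (9 / 10) ^ n) : ∃ u, Tendsto x atTop (𝓝 u) :=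
    cauchySeq_tendsto_of_complete <| cauchySeq_of_le_geometric (9 / 10) ρ₀ (by norm_num) fun n => by
      rw [dist_comm, dist_eq_norm]
      exact hx n
  obtain ⟨u, hu⟩ := exists_limit fun n => (increments n).1
  obtain ⟨w, hw⟩ := exists_limit fun n => (increments n).2
  have real_of_tendsto {x : ℕ → WienerAlgebra G r₀} {u} (hx : Tendsto x atTop (𝓝 u))
      (real : ∀ n, IsSelfAdjoint (x n)) : IsSelfAdjoint u :=
    (isClosed_eq continuous_star continuous_id).mem_of_tendsto hx (.of_forall real)
  have u_norm : ‖u‖ ≤ c₀ := le_of_tendsto' hu.norm fun n => (properties n).2.2.1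
  have w_norm : ‖w‖ ≤ c₀ := le_of_tendsto' hw.norm fun n => (properties n).2.2.2
  have domain : InDomain R η u w :=
    ⟨by linarith [ρ₀.coe_nonneg], u_norm.trans S.c₀_le_η, w_norm.trans S.c₀_le_η⟩
  exact ⟨u, w, real_of_tendsto hu fun n => (properties n).1,
    real_of_tendsto hw fun n => (properties n).2.1, u_norm, w_norm,
    tendsto_nhds_unique (S.small_a.tendsto_conjugacyErr₁ domain hu hw)
      (squeeze_zero_norm (fun n => (errors n).1) bound_tendsto),
    tendsto_nhds_unique (S.small_b.tendsto_conjugacyErr₂ domain hu hw)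
      (squeeze_zero_norm (fun n => (errors n).2) bound_tendsto)⟩

end NewtonSetting

end Convergence

/-! ### Germs of almost periodic functions -/

section AnalyticCoefficients

open Metric

lemma exists_hasSum_taylor {φ : ℂ → ℂ} {z : ℂ} {s m : ℝ} (hs : 0 < s)
    (hφ : AnalyticOnNhd ℂ φ (ball z s)) (hm : ∀ y ∈ ball z s, ‖φ y‖ ≤ m) :
    ∃ p : ℕ → ℂ, (∀ k, ‖p k‖ * (s / 2) ^ k ≤ m) ∧
      ∀ y : ℂ, ‖y‖ < s → HasSum (fun k => p k * y ^ k) (φ (z + y)) := by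
  refine ⟨fun k => (k.factorial : ℂ)⁻¹ * iteratedDeriv k φ z, fun k => ?_, fun y hy => ?_⟩
  · have closedBall_subset : closedBall z (s / 2) ⊆ ball z s :=
      closedBall_subset_ball (half_lt_self hs)
    have cauchy := Complex.norm_iteratedDeriv_le_of_forall_mem_sphere_norm_le k (half_pos hs)
      ((hφ.differentiableOn.mono closedBall_subset).diffContOnCl_ball subset_rfl)
      fun y hy => hm y (closedBall_subset (sphere_subset_closedBall hy))
    rw [le_div_iff₀ (by positivity)] at cauchy
    rwa [norm_mul, norm_inv, Complex.norm_natCast, mul_assoc,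
      inv_mul_le_iff₀ (by exact_mod_cast k.factorial_pos)]
  · have taylor := Complex.hasSum_taylorSeries_on_ball (c := z) (r := s.toNNReal) (z := z + y)
      (by rw [Real.coe_toNNReal s hs.le]; exact hφ.differentiableOn)
      (by rw [Real.coe_toNNReal s hs.le]; simpa using hy)
    refine taylor.congr_fun fun k => ?_
    rw [add_sub_cancel_left, smul_eq_mul, smul_eq_mul]
    ring

variable {G : Type*} [SeminormedAddCommGroup G] {R : ℝ≥0} {ω : Frequency G} {α s d : ℝ}
  {a : Germ G} {f : ℂ → ℂ → ℂ}

namespace Germ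

lemma exists_hasBound_hasSum {c : G → ℂ → ℂ} {z : ℂ} {m : G → ℝ} (hs : 0 < s)
    (hc : ∀ l, AnalyticOnNhd ℂ (c l) (ball z s)) (hm : ∀ l, ∀ y ∈ ball z s, ‖c l y‖ ≤ m l)
    (hsum : Summable fun l => m l * expWeight R l) (hd : ∑' l, m l * expWeight R l ≤ d) :
    ∃ a : Germ G, a.HasBound R (s / 4) (2 * d) ∧
      ∀ l y, ‖y‖ < s → HasSum (fun k => a (l, k) * y ^ k) (c l (z + y)) := by
  choose p p_le p_hasSum using fun l => exists_hasSum_taylor hs (hc l) (hm l)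
  have m_nonneg (l : G) : 0 ≤ m l := (norm_nonneg _).trans (hm l z (mem_ball_self hs))
  have majorant : HasSum (fun j : G × ℕ => m j.1 * expWeight R j.1 * (1 / 2) ^ j.2)
      ((∑' l, m l * expWeight R l) * 2) :=
    hsum.hasSum.mul hasSum_geometric_two (hsum.mul_of_nonneg summable_geometric_two
      (fun l => mul_nonneg (m_nonneg l) (expWeight_pos R l).le) fun k => by positivity)
  have le_majorant (j : G × ℕ) : ‖p j.1 j.2‖ * ((s / 4) ^ j.2 * expWeight R j.1) ≤
      m j.1 * expWeight R j.1 * (1 / 2) ^ j.2 := by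
    have := expWeight_pos R j.1
    calc ‖p j.1 j.2‖ * ((s / 4) ^ j.2 * expWeight R j.1)
        = ‖p j.1 j.2‖ * (s / 2) ^ j.2 * (expWeight R j.1 * (1 / 2) ^ j.2) := by
          rw [show s / 4 = s / 2 * (1 / 2) by ring, mul_pow]
          ring
      _ ≤ m j.1 * (expWeight R j.1 * (1 / 2) ^ j.2) := by gcongr; exact p_le _ _
      _ = _ := by ring
  have summable : Summable fun j : G × ℕ => ‖p j.1 j.2‖ * ((s / 4) ^ j.2 * expWeight R j.1) :=
    .of_nonneg_of_le (fun j => by have := expWeight_pos R j.1; positivity) le_majorant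
      majorant.summable
  refine ⟨fun j => p j.1 j.2, ⟨summable, ?_⟩, p_hasSum⟩
  refine (summable.tsum_le_tsum le_majorant majorant.summable).trans ?_
  rw [majorant.tsum_eq]
  linarith

lemma HasBound.represents {c : G → ℂ → ℂ} (ha : a.HasBound R s d)
    (hc : ∀ l, ∀ y : ℝ, |y| ≤ s → HasSum (fun k => a (l, k) * (y : ℂ) ^ k) (c l (α + y : ℝ)))
    (hf : ∀ x y : ℝ, |y| ≤ s →
      HasSum (fun l => c l (α + y : ℝ) * Complex.exp (I * ω l * x)) (f x (α + y : ℝ))) :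
    a.Represents ω α s f := fun x y hy => by
  have summable : Summable fun j => a j * (y : ℂ) ^ j.2 * Complex.exp (I * ω j.1 * x) := by
    refine .of_norm_bounded ha.summable fun j => ?_
    rw [norm_mul, norm_mul, ← Frequency.phase_apply, Frequency.norm_phase, mul_one, norm_pow,
      Complex.norm_real, Real.norm_eq_abs]
    gcongr
    exact (pow_le_pow_left₀ (abs_nonneg _) hy _).trans
      (le_mul_of_one_le_right (pow_nonneg ((abs_nonneg y).trans hy) _) (one_le_expWeight R j.1))
  rw [(hf x y hy).unique (summable.hasSum.prod_fiberwise fun l => (hc l y hy).mul_right _)]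
  exact summable.hasSum

lemma Represents.mono {s' : ℝ} (hf : a.Represents ω α s f) (hs : s' ≤ s) :
    a.Represents ω α s' f :=
  fun x y hy => hf x y (hy.trans hs)

end Germ

end AnalyticCoefficients

section RealPart

variable {G : Type*} [SeminormedAddCommGroup G] {R : ℝ≥0} {ω : Frequency G} {α s d : ℝ}
  {a : Germ G} {f : ℂ → ℂ → ℂ}

namespace Germ

/-- The germ of `(f(x, y) + conj f(x, y)) / 2` for real `x` and `y`. -/
def realPart (a : Germ G) : Germ G := fun j => (a j + conj (a (-j.1, j.2))) / 2

/-- The reflection `l ↦ -l` of the Fourier modes. -/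
def reflection (G : Type*) [SeminormedAddCommGroup G] : G × ℕ ≃ G × ℕ :=
  (Equiv.neg G).prodCongr (Equiv.refl ℕ)

lemma reflection_apply (j : G × ℕ) : reflection G j = (-j.1, j.2) := rfl

lemma isReal_realPart (a : Germ G) : a.realPart.IsReal := fun l k => by
  simp only [realPart, neg_neg, map_div₀, map_add, Complex.conj_conj, Complex.conj_ofNat]
  rw [add_comm]

lemma HasBound.realPart (ha : a.HasBound R s d) (hs : 0 ≤ s) : a.realPart.HasBound R s d := by
  have reflected : HasSum (fun j : G × ℕ => ‖a (-j.1, j.2)‖ * (s ^ j.2 * expWeight R j.1))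
      (∑' j, ‖a j‖ * (s ^ j.2 * expWeight R j.1)) := by
    simpa only [Function.comp_def, reflection_apply, expWeight_neg] using
      (reflection G).hasSum_iff.2 ha.summable.hasSum
  have majorant := (ha.summable.hasSum.add reflected).div_const 2
  have le_majorant (j : G × ℕ) : ‖a.realPart j‖ * (s ^ j.2 * expWeight R j.1) ≤
      (‖a j‖ * (s ^ j.2 * expWeight R j.1) +
        ‖a (-j.1, j.2)‖ * (s ^ j.2 * expWeight R j.1)) / 2 := by
    have := expWeight_pos R j.1
    rw [← add_mul, mul_div_right_comm, Germ.realPart, norm_div, Complex.norm_ofNat]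
    gcongr
    simpa only [RCLike.norm_conj] using norm_add_le (a j) (conj (a (-j.1, j.2)))
  have summable : Summable fun j => ‖a.realPart j‖ * (s ^ j.2 * expWeight R j.1) :=
    .of_nonneg_of_le (fun j => by have := expWeight_pos R j.1; positivity) le_majorant
      majorant.summable
  refine ⟨summable, (summable.tsum_le_tsum le_majorant majorant.summable).trans ?_⟩
  rw [majorant.tsum_eq, add_self_div_two]
  exact ha.le

lemma Represents.realPart (hf : a.Represents ω α s f)
    (hreal : ∀ x y : ℝ, |y| ≤ s → (f x (α + y : ℝ)).im = 0) :
    a.realPart.Represents ω α s f := fun x y hy => by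
  have conjugate := (reflection G).hasSum_iff.2 (Complex.hasSum_conj'.2 (hf x y hy))
  have average := ((hf x y hy).add conjugate).div_const 2
  rw [Complex.conj_eq_iff_im.2 (hreal x y hy), add_self_div_two] at average
  refine average.congr_fun fun j => ?_
  simp only [Germ.realPart, Function.comp_apply, reflection_apply, map_neg, map_mul, map_pow,
    Complex.conj_ofReal, ← Complex.exp_conj, Complex.conj_I, Complex.ofReal_neg, neg_mul_neg]
  ring

end Germ

end RealPart

section InvariantCurve

open WienerAlgebra Germ

variable {G : Type*} [SeminormedAddCommGroup G] {r₀ R : ℝ≥0} {ω : Frequency G} {α s η c₀ : ℝ}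
  {a b : Germ G} {f g : ℂ → ℂ → ℂ}

lemma IntersectsGraphs.newtonSetting (h : IntersectsGraphs ω α s f g) (ha : a.IsSmall R η)
    (hb : b.IsSmall R η) (hf : a.Represents ω α (3 * η) f) (hg : b.Represents ω α (3 * η) g)
    (hs : η < s) (hr₀ : 0 < r₀) (hc : 100 * c₀ ≤ η) (hcr : 64 * c₀ ≤ r₀) :
    NewtonSetting ω α a b R η c₀ r₀ where
  small_a := ha
  small_b := hb
  crossing r hr hR u w hu hw hu_norm hw_norm :=
    have c₀_le : c₀ ≤ η := by linarith [ha.pos]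
    h.exists_norm_eval_conjugacyErr_le ha hb hf hg hs (hr₀.trans_le hr)
      ⟨hR, hu_norm.trans c₀_le, hw_norm.trans c₀_le⟩
      (hcr.trans (NNReal.coe_le_coe.2 hr)) hu hw hu_norm hw_norm
  c₀_le := by linarith [ha.le_one]
  c₀_le_η := by linarith [ha.pos]

lemma twistMap_eq_of_conjugacyErr_eq_zero {u w : WienerAlgebra G r₀} (ha : a.IsSmall R η)
    (hb : b.IsSmall R η) (hf : a.Represents ω α (3 * η) f) (hg : b.Represents ω α (3 * η) g)
    (hd : InDomain R η u w) (hu : IsSelfAdjoint u) (hw : IsSelfAdjoint w)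
    (h₁ : conjugacyErr₁ ω α a u w = 0) (h₂ : conjugacyErr₂ ω α b u w = 0) (ξ : ℝ) :
    twistMap f g (ξ + eval ω ξ u, α + eval ω ξ w) =
      ((ξ + α : ℝ) + eval ω (ξ + α) u, α + eval ω (ξ + α) w) := by
  have fst_eq := congrArg (eval ω ξ) h₁
  have snd_eq := congrArg (eval ω ξ) h₂
  simp only [conjugacyErr₁, conjugacyErr₂, map_add, map_sub, map_zero, eval_translate,
    hf.eval_subst ha hd hu hw, hg.eval_subst hb hd hu hw] at fst_eq snd_eq
  simp only [twistMap, Prod.mk.injEq, Complex.ofReal_add]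
  exact ⟨by linear_combination fst_eq, by linear_combination snd_eq⟩

theorem exists_invariant_curve {r : ℝ≥0} {s K ε : ℝ} {ρ₁ : ℝ≥0} (hr : 0 < r) (hs : 0 < s)
    (hK : 0 < K) (hρ₁ : 0 < ρ₁) (hε : 0 < ε) :
    ∃ δ : ℝ, 0 < δ ∧ ∀ (ω : Frequency G) (α : ℝ),
      (∀ ρ : ℝ≥0, 0 < ρ → ρ ≤ ρ₁ → Loss ω α ρ (Real.exp (K / ρ ^ 5))) →
      ∀ (a b : Germ G) (f g : ℂ → ℂ → ℂ), a.IsReal → b.IsReal → a.HasBound r s δ →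
        b.HasBound r s δ → a.Represents ω α s f → b.Represents ω α s g →
        IntersectsGraphs ω α s f g →
        ∃ u w : WienerAlgebra G (r / 2), IsSelfAdjoint u ∧ IsSelfAdjoint w ∧ ‖u‖ < ε ∧ ‖w‖ < ε ∧
          ∀ ξ : ℝ, twistMap f g (ξ + eval ω ξ u, α + eval ω ξ w) =
            ((ξ + α : ℝ) + eval ω (ξ + α) u, α + eval ω (ξ + α) w) := by
  have : (0 : ℝ) < r := hr
  obtain ⟨η, η_pos, η_le⟩ := exists_between (show 0 < min 1 (min (r / 8 : ℝ) (s / 3)) by positivity)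
  simp only [lt_min_iff] at η_le
  obtain ⟨η_lt_one, hηr, hηs⟩ := η_le
  obtain ⟨c₀, c₀_pos, c₀_lt⟩ := exists_between (show 0 < min (η / 100) ε by positivity)
  obtain ⟨hc₀η, hc₀ε⟩ := lt_min_iff.1 c₀_lt
  obtain ⟨ρ₀, ρ₀_pos, ρ₀_lt⟩ := exists_between
    (show 0 < min ρ₁ (c₀ / 10).toNNReal from lt_min hρ₁ (Real.toNNReal_pos.2 (by positivity)))
  obtain ⟨hρ₀ρ₁, hρ₀c₀⟩ := lt_min_iff.1 ρ₀_lt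
  replace hρ₀c₀ := Real.lt_toNNReal_iff_coe_lt.1 hρ₀c₀
  have := newtonError_pos K ρ₀
  obtain ⟨δ, δ_pos, δ_lt⟩ := exists_between
    (show 0 < min (η ^ 2 / 1600) (η * newtonError K ρ₀ / 5) by positivity)
  obtain ⟨hδη, hδ⟩ := lt_min_iff.1 δ_lt
  refine ⟨δ, δ_pos, fun ω α hL a b f g a_real b_real ha hb hf hg intersects => ?_⟩
  replace ha := ha.mono le_rfl (show 3 * η ≤ s by linarith) (by positivity)
  replace hb := hb.mono le_rfl (show 3 * η ≤ s by linarith) (by positivity)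
  replace hf := hf.mono (show 3 * η ≤ s by linarith)
  replace hg := hg.mono (show 3 * η ≤ s by linarith)
  have small_a : a.IsSmall r η :=
    ⟨η_pos, η_lt_one.le, a_real, ha.summable, ha.le.trans hδη.le⟩
  have small_b : b.IsSmall r η :=
    ⟨η_pos, η_lt_one.le, b_real, hb.summable, hb.le.trans hδη.le⟩
  have half_coe : ((r / 2 : ℝ≥0) : ℝ) = r / 2 := by simp
  have setting : NewtonSetting ω α a b r η c₀ (r / 2) :=
    intersects.newtonSetting small_a small_b hf hg (by linarith) (half_pos hr) (by linarith)
      (by linarith)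
  obtain ⟨u, w, hu, hw, hu_norm, hw_norm, h₁, h₂⟩ := setting.exists_conjugacy hK ρ₀_pos
    (fun ρ hρ hρ' => hL ρ hρ (hρ'.trans hρ₀ρ₁.le)) (by linarith) (by linarith) ha hb
    (by linarith)
  exact ⟨u, w, hu, hw, hu_norm.trans_lt hc₀ε, hw_norm.trans_lt hc₀ε,
    twistMap_eq_of_conjugacyErr_eq_zero small_a small_b hf hg
      ⟨by linarith, by linarith, by linarith⟩ hu hw h₁ h₂⟩

end InvariantCurve

/-! ### The arithmetic conditions -/

section ArithmeticOfDivisors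

lemma one_add_rpow_le_exp {p t : ℝ} (hp : 0 < p) (ht : 1 ≤ t) :
    1 + t ^ p ≤ Real.exp ((1 + 2 * p) * √t) := by
  have one_le_sqrt : 1 ≤ √t := Real.one_le_sqrt.2 ht
  have log_le : Real.log t ≤ 2 * √t := by
    have := Real.log_le_sub_one_of_pos (one_pos.trans_le one_le_sqrt)
    rw [Real.log_sqrt (by linarith)] at this
    linarith
  have rpow_le : t ^ p ≤ Real.exp (2 * p * √t) := by
    rw [Real.rpow_def_of_pos (by linarith)]
    exact Real.exp_le_exp.2 (by nlinarith)
  have one_le_exp : 1 ≤ Real.exp (2 * p * √t) := Real.one_le_exp (by positivity)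
  calc 1 + t ^ p ≤ 2 * Real.exp (2 * p * √t) := by linarith
    _ ≤ Real.exp √t * Real.exp (2 * p * √t) := by gcongr; linarith [Real.add_one_le_exp √t]
    _ = _ := by rw [← Real.exp_add]; congr 1; ring

/-- If the first term on the right is too small, then `ρ √t ≤ C`, so that the second one is at least
`C (C / (ρ √t)) ^ 5 √t`. -/
lemma mul_sqrt_le {C ρ t : ℝ} (hC : 0 < C) (hρ : 0 < ρ) (ht : 0 < t) :
    C * √t ≤ ρ * t + C ^ 6 / ρ ^ 5 * (t ^ 2)⁻¹ := by
  obtain ⟨x, hx, rfl⟩ : ∃ x, 0 < x ∧ t = x ^ 2 :=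
    ⟨√t, Real.sqrt_pos.2 ht, (Real.sq_sqrt ht.le).symm⟩
  rw [Real.sqrt_sq hx.le]
  rcases le_or_gt C (ρ * x) with h | h
  · have : 0 ≤ C ^ 6 / ρ ^ 5 * ((x ^ 2) ^ 2)⁻¹ := by positivity
    nlinarith
  · have : 0 ≤ ρ * x ^ 2 := by positivity
    have : C * x ≤ C ^ 6 / ρ ^ 5 * ((x ^ 2) ^ 2)⁻¹ := by
      rw [← div_eq_mul_inv, div_div, le_div_iff₀ (by positivity)]
      calc C * x * (ρ ^ 5 * (x ^ 2) ^ 2) = C * (ρ * x) ^ 5 := by ring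
        _ ≤ C * C ^ 5 := by gcongr
        _ = _ := by ring
    linarith

lemma summable_inv_sq_pnat : Summable fun i : ℕ+ => (((i : ℕ) : ℝ) ^ 2)⁻¹ :=
  (Real.summable_nat_pow_inv.2 one_lt_two).comp_injective PNat.coe_injective

lemma divisorProd_pos (p : ℝ) (l : ℕ+ →₀ ℤ) : 0 < divisorProd p l :=
  Finset.prod_pos fun i _ => by positivity

lemma one_add_rpow_mul_rpow_le {p ρ : ℝ} (hp : 0 < p) (hρ : 0 < ρ) {i : ℕ+} {k : ℤ} (hk : k ≠ 0) :
    1 + ((i : ℕ) : ℝ) ^ p * |(k : ℝ)| ^ p ≤ Real.exp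
      (ρ * (|(k : ℝ)| * (i : ℕ)) + (1 + 2 * p) ^ 6 / ρ ^ 5 * (((i : ℕ) : ℝ) ^ 2)⁻¹) := by
  have one_le_i : (1 : ℝ) ≤ (i : ℕ) := by exact_mod_cast i.pos
  have one_le_k : (1 : ℝ) ≤ |(k : ℝ)| := by exact_mod_cast Int.one_le_abs hk
  have i_le : ((i : ℕ) : ℝ) ≤ |(k : ℝ)| * (i : ℕ) := le_mul_of_one_le_left (by linarith) one_le_k
  rw [mul_comm, ← Real.mul_rpow (by positivity) (by positivity)]
  refine (one_add_rpow_le_exp hp (one_le_i.trans i_le)).trans (Real.exp_le_exp.2 ?_)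
  exact (mul_sqrt_le (by positivity) hρ (by positivity)).trans (by gcongr)

lemma exists_divisorProd_le {p : ℝ} (hp : 0 < p) : ∃ K, 0 < K ∧ ∀ ρ, 0 < ρ → ∀ l : ℕ+ →₀ ℤ,
    divisorProd p l ≤ Real.exp (K / ρ ^ 5) * Real.exp (ρ * indexWeight l) := by
  set S := ∑' i : ℕ+, (((i : ℕ) : ℝ) ^ 2)⁻¹
  have : 0 < S := summable_inv_sq_pnat.tsum_pos (fun i => by positivity) 1 (by simp)
  refine ⟨(1 + 2 * p) ^ 6 * S, by positivity, fun ρ hρ l => ?_⟩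
  have sum_le : ∑ i ∈ l.support, (((i : ℕ) : ℝ) ^ 2)⁻¹ ≤ S :=
    summable_inv_sq_pnat.sum_le_tsum _ fun i _ => by positivity
  calc divisorProd p l
      ≤ ∏ i ∈ l.support, Real.exp (ρ * (|(l i : ℝ)| * (i : ℕ)) +
          (1 + 2 * p) ^ 6 / ρ ^ 5 * (((i : ℕ) : ℝ) ^ 2)⁻¹) :=
        Finset.prod_le_prod (fun i _ => by positivity) fun i hi =>
          one_add_rpow_mul_rpow_le hp hρ (Finsupp.mem_support_iff.1 hi)
    _ = Real.exp (ρ * indexWeight l +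
          (1 + 2 * p) ^ 6 / ρ ^ 5 * ∑ i ∈ l.support, (((i : ℕ) : ℝ) ^ 2)⁻¹) := by
        rw [← Real.exp_sum, Finset.sum_add_distrib, ← Finset.mul_sum, ← Finset.mul_sum]
        rfl
    _ ≤ Real.exp (ρ * indexWeight l + (1 + 2 * p) ^ 6 / ρ ^ 5 * S) := by gcongr
    _ = _ := by rw [← Real.exp_add]; congr 1; ring

end ArithmeticOfDivisors

section IntegerVectors

lemma indexWeight_eq_sum {l : ℕ+ →₀ ℤ} {s : Finset ℕ+} (hs : l.support ⊆ s) :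
    indexWeight l = ∑ i ∈ s, |(l i : ℝ)| * (i : ℕ) :=
  Finsupp.sum_of_support_subset l hs _ (by simp)

lemma indexWeight_add_le (l m : ℕ+ →₀ ℤ) :
    indexWeight (l + m) ≤ indexWeight l + indexWeight m := by
  classical
  rw [indexWeight_eq_sum (Finsupp.support_add (g₁ := l) (g₂ := m)),
    indexWeight_eq_sum (Finset.subset_union_left (s₂ := m.support)),
    indexWeight_eq_sum (Finset.subset_union_right (s₁ := l.support)), ← Finset.sum_add_distrib]
  refine Finset.sum_le_sum fun i _ => ?_
  rw [← add_mul, Finsupp.add_apply, Int.cast_add]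
  gcongr
  exact abs_add_le _ _

/-- The weight `‖l‖ = ∑ i, |l i| * i` as a seminorm, so that the Wiener algebras of this index group
are the spaces `AP_r`. -/
def indexSeminorm : AddGroupSeminorm (ℕ+ →₀ ℤ) where
  toFun := indexWeight
  map_zero' := Finsupp.sum_zero_index
  add_le' := indexWeight_add_le
  neg' l := by
    rw [indexWeight, Finsupp.sum_neg_index (by simp)]
    simp [indexWeight]

local instance indexSeminormedAddCommGroup : SeminormedAddCommGroup (ℕ+ →₀ ℤ) :=
  indexSeminorm.toSeminormedAddCommGroup

lemma norm_eq_indexWeight (l : ℕ+ →₀ ℤ) : ‖l‖ = indexWeight l := rfl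

lemma abs_freqPairing_le {ω : ℕ+ → ℝ} (hω : ∀ i, |ω i| ≤ 1) (l : ℕ+ →₀ ℤ) :
    |freqPairing ω l| ≤ indexWeight l := by
  refine (Finset.abs_sum_le_sum_abs _ _).trans (Finset.sum_le_sum fun i _ => ?_)
  rw [abs_mul]
  exact mul_le_mul_of_nonneg_left ((hω i).trans (Nat.one_le_cast.2 i.pos)) (abs_nonneg _)

/-- The frequency functional `l ↦ (ω, l)`. -/
def frequency (ω : ℕ+ → ℝ) (hω : ∀ i, |ω i| ≤ 1) : Frequency (ℕ+ →₀ ℤ) where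
  toFun := freqPairing ω
  map_zero' := Finsupp.sum_zero_index
  map_add' _ _ := Finsupp.sum_add_index' (by simp) fun _ _ _ => by push_cast; ring
  abs_le' := abs_freqPairing_le hω

variable {ω : ℕ+ → ℝ} (hω : ∀ i, |ω i| ≤ 1) {α γ μ : ℝ}

lemma frequency_apply (l : ℕ+ →₀ ℤ) : frequency ω hω l = freqPairing ω l := rfl

lemma SmallDivisors.mono {G : Type*} [SeminormedAddCommGroup G] {ω : Frequency G}
    {α ρ Λ Λ' : ℝ} (h : SmallDivisors ω α ρ Λ) (hΛ : Λ ≤ Λ') : SmallDivisors ω α ρ Λ' :=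
  fun κ hκ l hl => (h κ hκ l hl).trans (by gcongr)

lemma IsNonresonant.div_divisorProd_le (hα : IsNonresonant ω γ μ α) {κ : ℝ} (hκ : 1 / 4 ≤ κ)
    {l : ℕ+ →₀ ℤ} (hl : l ≠ 0) :
    γ / divisorProd (2 + 2 * μ) l ≤ ‖(κ : ℂ) - (frequency ω hω).phase α l‖ := by
  have phase_eq : (frequency ω hω).phase α l =
      Complex.exp (I * (freqPairing ω l * α : ℝ)) := by
    rw [Frequency.phase_apply, frequency_apply, Complex.ofReal_mul, mul_assoc]
  have away_from_one : 4 * (γ / divisorProd (2 + 2 * μ) l) ≤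
      ‖Complex.exp (I * (freqPairing ω l * α : ℝ)) - 1‖ :=
    le_norm_exp_mul_I_sub_one fun n => by
      rw [mul_div_assoc, ← mul_one_div]
      exact (hα l hl n).le
  rw [phase_eq]
  linarith [norm_exp_mul_I_sub_one_le (θ := freqPairing ω l * α) hκ,
    norm_nonneg ((κ : ℂ) - Complex.exp (I * (freqPairing ω l * α : ℝ)))]

lemma exists_smallDivisors (hγ : 0 < γ) (hμ : 0 < μ) : ∃ K, 0 < K ∧
    ∀ (ω : ℕ+ → ℝ) (hω : ∀ i, |ω i| ≤ 1) (α : ℝ), IsNonresonant ω γ μ α → ∀ ρ, 0 < ρ →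
      SmallDivisors (frequency ω hω) α ρ (γ⁻¹ * Real.exp (K / ρ ^ 5)) := by
  obtain ⟨K, hK, divisorProd_le⟩ := exists_divisorProd_le (p := 2 + 2 * μ) (by positivity)
  refine ⟨K, hK, fun ω hω α hα ρ hρ κ hκ l hl => ?_⟩
  have := divisorProd_pos (2 + 2 * μ) l
  rw [norm_eq_indexWeight]
  calc 1 = γ⁻¹ * divisorProd (2 + 2 * μ) l * (γ / divisorProd (2 + 2 * μ) l) := by
        generalize divisorProd (2 + 2 * μ) l = P at *
        field_simp
    _ ≤ γ⁻¹ * (Real.exp (K / ρ ^ 5) * Real.exp (ρ * indexWeight l)) *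
        ‖(κ : ℂ) - (frequency ω hω).phase α l‖ := by
      gcongr
      · exact divisorProd_le ρ hρ l
      · exact hα.div_divisorProd_le hω hκ hl
    _ = _ := by ring

lemma exists_loss (hγ : 0 < γ) (hμ : 0 < μ) : ∃ K : ℝ, 0 < K ∧ ∃ ρ₁ : ℝ≥0, 0 < ρ₁ ∧
    ∀ (ω : ℕ+ → ℝ) (hω : ∀ i, |ω i| ≤ 1) (α : ℝ), IsNonresonant ω γ μ α →
      ∀ ρ : ℝ≥0, 0 < ρ → ρ ≤ ρ₁ → Loss (frequency ω hω) α ρ (Real.exp (K / ρ ^ 5)) := by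
  obtain ⟨K, hK, smallDivisors⟩ := exists_smallDivisors hγ hμ
  lift γ to ℝ≥0 using hγ.le
  refine ⟨K + 1, by linarith, min (1 / 10) γ, lt_min (by norm_num) hγ,
    fun ω hω α hα ρ hρ hρ₁ => ?_⟩
  have : (0 : ℝ) < ρ := hρ
  have ρ_le : (ρ : ℝ) ≤ 1 / 10 := NNReal.coe_le_coe.2 (hρ₁.trans (min_le_left _ _))
  have ρ_le_γ : (ρ : ℝ) ≤ γ := NNReal.coe_le_coe.2 (hρ₁.trans (min_le_right _ _))
  have inv_le_inv_pow : (ρ : ℝ)⁻¹ ≤ ((ρ : ℝ) ^ 5)⁻¹ := by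
    gcongr
    exact pow_le_of_le_one ρ.2 (by linarith) (by norm_num)
  have inv_pow_le_exp : ((ρ : ℝ) ^ 5)⁻¹ ≤ Real.exp ((ρ : ℝ) ^ 5)⁻¹ := by
    linarith [Real.add_one_le_exp ((ρ : ℝ) ^ 5)⁻¹]
  have exp_eq : Real.exp ((K + 1) / ρ ^ 5) = Real.exp ((ρ : ℝ) ^ 5)⁻¹ * Real.exp (K / ρ ^ 5) := by
    rw [← Real.exp_add]
    ring_nf
  have exp_le : Real.exp ((ρ : ℝ) ^ 5)⁻¹ ≤ Real.exp ((K + 1) / ρ ^ 5) := by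
    rw [exp_eq]
    exact le_mul_of_one_le_right (Real.exp_pos _).le (Real.one_le_exp (by positivity))
  refine ⟨hρ, by linarith, ?_, (smallDivisors ω hω α hα ρ hρ).mono ?_⟩
  · refine le_trans ?_ (inv_pow_le_exp.trans exp_le)
    calc (10 : ℝ) ^ 5 = ((1 / 10) ^ 5)⁻¹ := by norm_num
      _ ≤ _ := by gcongr
  · rw [exp_eq]
    gcongr
    exact (inv_anti₀ this ρ_le_γ).trans (inv_le_inv_pow.trans inv_pow_le_exp)

end IntegerVectors

/-! ### The spaces `AP_r` and `AP_{r, s}` -/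

section AlmostPeriodic

open WienerAlgebra

attribute [local instance] indexSeminormedAddCommGroup

variable {ω : ℕ+ → ℝ} (hω : ∀ i, |ω i| ≤ 1) {r : ℝ≥0} {α s d : ℝ} {f g : ℂ → ℂ → ℂ}

lemma coeffNorm_eq (x : WienerAlgebra (ℕ+ →₀ ℤ) r) : coeffNorm r x = ENNReal.ofReal ‖x‖ := by
  rw [norm_def, ENNReal.ofReal_tsum_of_nonneg
    (fun l => mul_nonneg (norm_nonneg _) (expWeight_pos r l).le) x.summable]
  refine tsum_congr fun l => ?_
  rw [ENNReal.ofReal_mul (norm_nonneg _), ofReal_norm]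
  rfl

lemma hasFourierSeries_stripEval (x : WienerAlgebra (ℕ+ →₀ ℤ) r) :
    HasFourierSeries ω r x (stripEval (frequency ω hω) x) :=
  fun _ hz => by
    simpa only [frequency_apply] using hasSum_stripEval (ω := frequency ω hω) x hz.le

lemma stripEval_mem_AP (x : WienerAlgebra (ℕ+ →₀ ℤ) r) :
    stripEval (frequency ω hω) x ∈ AP ω r :=
  ⟨x, hasFourierSeries_stripEval hω x, by rw [coeffNorm_eq]; exact ENNReal.ofReal_lt_top⟩

lemma apNorm_stripEval_le (x : WienerAlgebra (ℕ+ →₀ ℤ) r) :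
    apNorm ω r (stripEval (frequency ω hω) x) ≤ ENNReal.ofReal ‖x‖ :=
  (iInf₂_le (x : (ℕ+ →₀ ℤ) → ℂ) (hasFourierSeries_stripEval hω x)).trans_eq (coeffNorm_eq x)

lemma realOnReals_stripEval {x : WienerAlgebra (ℕ+ →₀ ℤ) r} (hx : IsSelfAdjoint x) :
    RealOnReals (stripEval (frequency ω hω) x) := fun ξ => by
  rw [stripEval_ofReal, ← ofReal_re_eval hx, Complex.ofReal_im]

lemma const_add_mem_AP {r : ℝ} {φ : ℂ → ℂ} (hφ : φ ∈ AP ω r) (c : ℂ) :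
    (fun z => c + φ z) ∈ AP ω r := by
  obtain ⟨a, series, ha⟩ := hφ
  refine ⟨fun l => (if l = 0 then c else 0) + a l, fun z hz => ?_, ?_⟩
  · refine ((hasSum_ite_eq 0 c).add (series z hz)).congr_fun fun l => ?_
    rcases eq_or_ne l 0 with rfl | hl
    · simp [freqPairing]
    · simp [hl]
  · have coeffNorm_const : coeffNorm r (fun l => if l = 0 then c else 0) = ‖c‖ₑ := by
      rw [coeffNorm, tsum_eq_single 0 fun l hl => by simp [hl]]
      simp [indexWeight]
    calc coeffNorm r (fun l => (if l = 0 then c else 0) + a l)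
        ≤ coeffNorm r (fun l => if l = 0 then c else 0) + coeffNorm r a := by
          rw [coeffNorm, coeffNorm, coeffNorm, ← ENNReal.tsum_add]
          refine ENNReal.tsum_le_tsum fun l => ?_
          rw [← add_mul]
          gcongr
          exact enorm_add_le _ _
      _ < ⊤ := by
          rw [coeffNorm_const]
          exact ENNReal.add_lt_top.2 ⟨enorm_lt_top, ha⟩

lemma HasIntersectionProperty.intersectsGraphs {s' : ℝ} (h : HasIntersectionProperty ω α s f g)
    (hs : s' ≤ s) : IntersectsGraphs (frequency ω hω) α s' f g := by
  intro r ψ hr hψ hψ_near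
  obtain ⟨p, ⟨_, ⟨x, rfl⟩, image_eq⟩, x', rfl⟩ := h (stripEval (frequency ω hω) ψ)
    ⟨r, hr, stripEval_mem_AP hω ψ⟩ (realOnReals_stripEval hω hψ)
    fun x => mem_ball_iff_norm.2 ((hψ_near x).trans_le hs)
  exact ⟨x, x', Prod.mk.inj image_eq⟩

lemma image_curveSet_eq {X Y : ℂ → ℂ} (h : ∀ ξ : ℝ,
    twistMap f g (X ξ, Y ξ) = (X ((ξ + α : ℝ) : ℂ), Y ((ξ + α : ℝ) : ℂ))) :
    twistMap f g '' curveSet X Y = curveSet X Y := by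
  rw [curveSet, ← Set.range_comp]
  exact (congrArg Set.range (funext h)).trans
    ((Equiv.addRight α).surjective.range_comp fun ξ : ℝ => (X ξ, Y ξ))

lemma exists_majorant {c : (ℕ+ →₀ ℤ) → ℂ → ℂ}
    (hc : coeffNorm₂ α r s c ≤ ENNReal.ofReal d) (hd : 0 ≤ d) :
    ∃ m : (ℕ+ →₀ ℤ) → ℝ, (∀ l, ∀ y ∈ Metric.ball (α : ℂ) s, ‖c l y‖ ≤ m l) ∧
      (Summable fun l => m l * expWeight r l) ∧ ∑' l, m l * expWeight r l ≤ d := by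
  set M : (ℕ+ →₀ ℤ) → ℝ≥0∞ := fun l => ⨆ y ∈ Metric.ball (α : ℂ) s, ‖c l y‖ₑ
  have weight_pos (l : ℕ+ →₀ ℤ) : 0 < ENNReal.ofReal (expWeight r l) :=
    ENNReal.ofReal_pos.2 (expWeight_pos r l)
  have tsum_ne_top : ∑' l, M l * ENNReal.ofReal (expWeight r l) ≠ ⊤ :=
    ne_top_of_le_ne_top ENNReal.ofReal_ne_top hc
  have term_ne_top (l) : M l * ENNReal.ofReal (expWeight r l) ≠ ⊤ :=
    ENNReal.ne_top_of_tsum_ne_top tsum_ne_top l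
  have M_ne_top (l) : M l ≠ ⊤ := fun h =>
    term_ne_top l (by rw [h, ENNReal.top_mul (weight_pos l).ne'])
  have toReal_term (l) :
      (M l * ENNReal.ofReal (expWeight r l)).toReal = (M l).toReal * expWeight r l := by
    rw [ENNReal.toReal_mul, ENNReal.toReal_ofReal (expWeight_pos r l).le]
  refine ⟨fun l => (M l).toReal, fun l y hy => ?_, ?_, ?_⟩
  · rw [← toReal_enorm]
    exact ENNReal.toReal_mono (M_ne_top l) (le_iSup₂ (f := fun y _ => ‖c l y‖ₑ) y hy)
  · simpa only [toReal_term] using ENNReal.summable_toReal tsum_ne_top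
  · simp only [← toReal_term]
    rw [← ENNReal.tsum_toReal_eq term_ne_top]
    exact ENNReal.toReal_le_of_le_ofReal hd hc

lemma exists_germ_of_apNorm₂_lt (hr : 0 < r) (hs : 0 < s) (hd : 0 ≤ d)
    (hf : apNorm₂ ω α r s f < ENNReal.ofReal d) (hreal : RealOnStrip α s f) :
    ∃ a : Germ (ℕ+ →₀ ℤ), a.IsReal ∧ a.HasBound r (s / 4) (2 * d) ∧
      a.Represents (frequency ω hω) α (s / 4) f := by
  simp only [apNorm₂, iInf_lt_iff] at hf
  obtain ⟨c, series, hc⟩ := hf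
  obtain ⟨m, hm, summable, hmd⟩ := exists_majorant hc.le hd
  obtain ⟨a, ha, ha_series⟩ := Germ.exists_hasBound_hasSum hs series.analytic hm summable hmd
  have norm_lt {y : ℝ} (hy : |y| ≤ s / 4) : ‖(y : ℂ)‖ < s := by
    rw [Complex.norm_real, Real.norm_eq_abs]
    linarith
  refine ⟨a.realPart, a.isReal_realPart, ha.realPart (by positivity), (ha.represents (c := c)
    (fun l y hy => ?_) fun x y hy => ?_).realPart fun x y hy => hreal x _ ?_⟩
  · simpa only [Complex.ofReal_add] using ha_series l y (norm_lt hy)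
  · exact series.hasSum x (by simpa using hr) _ (by simpa using norm_lt hy)
  · rw [add_sub_cancel_left]
    linarith

theorem theorem2p1_general (r₀ s₀ γ μ ε : ℝ) (hr₀ : 0 < r₀) (hs₀ : 0 < s₀) (hγ : 0 < γ)
    (hμ : 0 < μ) (hε : 0 < ε) :
    ∃ δ : ℝ, 0 < δ ∧
      ∀ (ω : ℕ+ → ℝ) (α : ℝ), (∀ i, |ω i| ≤ 1) → IsNonresonant ω γ μ α →
      ∀ f g : ℂ → ℂ → ℂ,
        RealOnStrip α s₀ f → RealOnStrip α s₀ g →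
        HasIntersectionProperty ω α s₀ f g →
        apNorm₂ ω α r₀ s₀ f + apNorm₂ ω α r₀ s₀ g < ENNReal.ofReal δ →
        ∃ u ∈ AP ω (r₀ / 2), ∃ v ∈ AP ω (r₀ / 2),
          RealOnReals u ∧ RealOnReals v ∧
          apNorm ω (r₀ / 2) u + apNorm ω (r₀ / 2) (fun z => v z - (α : ℂ)) < ENNReal.ofReal ε ∧
          (∀ ξ : ℝ, v ξ ∈ Metric.ball (α : ℂ) s₀) ∧
          twistMap f g '' curveSet (fun ξ => ξ + u ξ) v = curveSet (fun ξ => ξ + u ξ) v ∧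
          ∀ ξ : ℝ, twistMap f g ((ξ : ℂ) + u ξ, v ξ) =
            (((ξ + α : ℝ) : ℂ) + u ((ξ + α : ℝ) : ℂ), v ((ξ + α : ℝ) : ℂ)) := by
  lift r₀ to ℝ≥0 using hr₀.le
  obtain ⟨K, hK, ρ₁, hρ₁, loss⟩ := exists_loss hγ hμ
  obtain ⟨δ, hδ, exists_curve⟩ := exists_invariant_curve (G := ℕ+ →₀ ℤ) hr₀ (s := s₀ / 4)
    (ε := min (ε / 2) s₀) (by positivity) hK hρ₁ (by positivity)
  refine ⟨δ / 2, half_pos hδ, fun ω α hω hα f g f_real g_real intersects hfg => ?_⟩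
  obtain ⟨a, a_real, ha, hf⟩ := exists_germ_of_apNorm₂_lt hω hr₀ hs₀ (half_pos hδ).le
    (le_self_add.trans_lt hfg) f_real
  obtain ⟨b, b_real, hb, hg⟩ := exists_germ_of_apNorm₂_lt hω hr₀ hs₀ (half_pos hδ).le
    (le_add_self.trans_lt hfg) g_real
  rw [mul_div_cancel₀ δ two_ne_zero] at ha hb
  obtain ⟨u, w, hu, hw, u_norm, w_norm, conjugacy⟩ := exists_curve (frequency ω hω) α
    (loss ω hω α hα) a b f g a_real b_real ha hb hf hg
    (intersects.intersectsGraphs hω (by linarith))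
  rw [lt_min_iff] at u_norm w_norm
  rw [show (r₀ : ℝ) / 2 = (r₀ / 2 : ℝ≥0) by simp]
  refine ⟨_, stripEval_mem_AP hω u, fun z => α + stripEval (frequency ω hω) w z,
    const_add_mem_AP (stripEval_mem_AP hω w) α, realOnReals_stripEval hω hu, fun ξ => ?_, ?_,
    fun ξ => ?_, image_curveSet_eq conjugacy, conjugacy⟩
  · rw [Complex.add_im, Complex.ofReal_im, zero_add, realOnReals_stripEval hω hw]
  · simp only [add_sub_cancel_left]
    refine (add_le_add (apNorm_stripEval_le hω u) (apNorm_stripEval_le hω w)).trans_lt ?_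
    rw [← ENNReal.ofReal_add (norm_nonneg _) (norm_nonneg _), ENNReal.ofReal_lt_ofReal_iff hε]
    linarith
  · rw [mem_ball_iff_norm, add_sub_cancel_left]
    exact (norm_eval_le w).trans_lt w_norm.2

end AlmostPeriodic

end

theorem theorem2p1 (r₀ s₀ γ μ ε : ℝ) (hr₀ : 0 < r₀) (hs₀ : 0 < s₀) (hγ : 0 < γ) (hμ : 0 < μ)
    (hε : 0 < ε) :
    ∃ δ : ℝ, 0 < δ ∧
      ∀ (γ₀ : ℝ) (ω : ℕ+ → ℝ) (α : ℝ), 0 < γ₀ → IsDiophantine ω γ₀ μ → IsNonresonant ω γ μ α →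
      ∀ f ∈ AP₂ ω α r₀ s₀, ∀ g ∈ AP₂ ω α r₀ s₀,
        RealOnStrip α s₀ f → RealOnStrip α s₀ g →
        HasIntersectionProperty ω α s₀ f g →
        apNorm₂ ω α r₀ s₀ f + apNorm₂ ω α r₀ s₀ g < ENNReal.ofReal δ →
        ∃ u ∈ AP ω (r₀ / 2), ∃ v ∈ AP ω (r₀ / 2),
          RealOnReals u ∧ RealOnReals v ∧
          apNorm ω (r₀ / 2) u + apNorm ω (r₀ / 2) (fun z => v z - (α : ℂ)) < ENNReal.ofReal ε ∧
          -- the curve lies in the domain of the map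
          (∀ ξ : ℝ, v ξ ∈ Metric.ball (α : ℂ) s₀) ∧
          -- it is invariant, and the map acts on it as `ξ ↦ ξ + α`
          twistMap f g '' curveSet (fun ξ => ξ + u ξ) v = curveSet (fun ξ => ξ + u ξ) v ∧
          ∀ ξ : ℝ, twistMap f g ((ξ : ℂ) + u ξ, v ξ) =
            (((ξ + α : ℝ) : ℂ) + u ((ξ + α : ℝ) : ℂ), v ((ξ + α : ℝ) : ℂ)) := by
  obtain ⟨δ, hδ, h⟩ := theorem2p1_general r₀ s₀ γ μ ε hr₀ hs₀ hγ hμ hε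
  exact ⟨δ, hδ, fun _ ω α _ hω hα f _ g _ => h ω α hω.abs_le_one hα f g⟩
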